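/- **Setting.** Let $x_-<x_+$ and let $\kappa:\mathbb R^2\to\mathbb R$ be a bounded measurable function (for instance, piecewise constant) with $\kappa(x,z+1)=\kappa(x,z)$ for all $x,z$, and with $\kappa(x,z)=\kappa_-$ for $x<x_-$ and $\kappa(x,z)=\kappa_+$ for $x>x_+$, where $\kappa_\pm\in\mathbb R$ are constants. Put $S=\mathbb R\times(0,1)$ and $S_0=[x_-,x_+]\times[0,1]$, and let $\gamma\in\mathbb C$. *Problem on the strip.* A solution is a function $\hat v\in H^1(S)$ that has a representative (again denoted $\hat v$) in $C^1(\mathbb R\times[0,1])$ and satisfies $$\Delta\hat v+2\gamma\hat v_z+(\gamma^2+\kappa^2)\hat v=0\ \text{ weakly in }S,\qquad \hat v(x,0)=\hat v(x,1),\quad \hat v_z(x,0)=\hat v_z(x,1)\quad(x\in\mathbb R).$$ *Problem on the bounded domain.* A solution is a function $u\in H^1(S_0)$ that has a representative (again denoted $u$) in $C^1(S_0)$ and satisfies $$\Delta u+2\gamma u_z+(\gamma^2+\kappa^2)u=0\ \text{ weakly in the interior of }S_0,\qquad u(x,0)=u(x,1),\quad u_z(x,0)=u_z(x,1)\quad(x\in(x_-,x_+)),$$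 $$\mathcal T_{-,\gamma}[u(x_-,\cdot)]=-u_x(x_-,\cdot),\qquad \mathcal T_{+,\gamma}[u(x_+,\cdot)]=u_x(x_+,\cdot)\qquad\text{in }L^2(0,1).$$ Here the Dirichlet-to-Neumann maps are given by the series (convergent in $L^2(0,1)$) $$\mathcal T_{\pm,\gamma}[g](z)=\sum_{k\in\mathbb Z}s_{\pm,k}(\gamma)\,g_k\,e^{2\pi ikz},\qquad g_k=\int_0^1 g(z)e^{-2\pi ikz}\,dz,$$ with $\beta_{\pm,k}(\gamma)=(\gamma+2\pi ik)^2+\kappa_\pm^2$ and $s_{\pm,k}(\gamma)=\operatorname{sign}(\operatorname{Im}\beta_{\pm,k}(\gamma))\,i\sqrt{\beta_{\pm,k}(\gamma)}$ (principal square root). **Theorem.** Suppose $\operatorname{Re}\gamma\neq0$ and $\operatorname{Im}\gamma\notin2\pi\mathbb Z$. Then $u$ is a solution of the problem on the bounded domain $S_0$ if and only if there is a solution $\hat v$ of the problem on the strip $S$ such that $u$ is the restriction of $\hat v$ to $S_0$. -/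

import Mathlib

open MeasureTheory Filter Topology Set
open scoped ContDiff

noncomputable section

namespace Waveguide

/-- The open strip `ℝ × (0,1)`. Points are written `(x, z)`. -/
def strip : Set (ℝ × ℝ) := univ ×ˢ Ioo 0 1

/-- The closed strip `ℝ × [0,1]`. -/
def closedStrip : Set (ℝ × ℝ) := univ ×ˢ Icc 0 1

/-- The open rectangle `(xm, xp) × (0,1)`. -/
def rect (xm xp : ℝ) : Set (ℝ × ℝ) := Ioo xm xp ×ˢ Ioo 0 1

/-- The closed rectangle `[xm, xp] × [0,1]`. -/
def closedRect (xm xp : ℝ) : Set (ℝ × ℝ) := Icc xm xp ×ˢ Icc 0 1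

/-! ### Sobolev space `H¹` and weak solutions on an open set -/

/-- Complex-valued test functions: smooth, with compact support contained in `Ω`. -/
structure IsTestFunction (Ω : Set (ℝ × ℝ)) (φ : ℝ × ℝ → ℂ) : Prop where
  smooth : ContDiff ℝ ∞ φ
  compact : HasCompactSupport φ
  support : tsupport φ ⊆ Ω

/-- `w` is the weak derivative of `u` in the direction `e` on `Ω`. -/
def HasWeakDeriv (Ω : Set (ℝ × ℝ)) (e : ℝ × ℝ) (u w : ℝ × ℝ → ℂ) : Prop :=
  ∀ φ : ℝ × ℝ → ℂ, IsTestFunction Ω φ →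
    ∫ p in Ω, u p * fderiv ℝ φ p e = - ∫ p in Ω, w p * φ p

/-- `(ux, uz)` is the weak gradient of `u` on `Ω`, and it is square integrable. -/
structure IsWeakGradient (Ω : Set (ℝ × ℝ)) (u ux uz : ℝ × ℝ → ℂ) : Prop where
  memLp_x : MemLp ux 2 (volume.restrict Ω)
  memLp_z : MemLp uz 2 (volume.restrict Ω)
  weak_x : HasWeakDeriv Ω (1, 0) u ux
  weak_z : HasWeakDeriv Ω (0, 1) u uz

/-- `u` (taken up to equality almost everywhere) belongs to `H¹(Ω)`. -/
def MemH1 (Ω : Set (ℝ × ℝ)) (u : ℝ × ℝ → ℂ) : Prop :=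
  MemLp u 2 (volume.restrict Ω) ∧ ∃ ux uz : ℝ × ℝ → ℂ, IsWeakGradient Ω u ux uz

/-- `u` satisfies `Δu + 2γ u_z + (γ² + κ²) u = 0` weakly in `Ω`; the weak gradient is unique up to
equality almost everywhere, so that the choice of `(ux, uz)` does not matter. -/
def IsWeakSolution (Ω : Set (ℝ × ℝ)) (κ : ℝ × ℝ → ℝ) (γ : ℂ) (u : ℝ × ℝ → ℂ) : Prop :=
  ∃ ux uz : ℝ × ℝ → ℂ, IsWeakGradient Ω u ux uz ∧
    ∀ φ : ℝ × ℝ → ℂ, IsTestFunction Ω φ →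
      ∫ p in Ω, (-(ux p * fderiv ℝ φ p (1, 0) + uz p * fderiv ℝ φ p (0, 1))
        + (2 * γ * uz p + (γ ^ 2 + (κ p : ℂ) ^ 2) * u p) * φ p) = 0

/-! ### Classical partial derivatives on a closed set, for `C¹` functions on it -/

/-- The partial derivative `U_x`, relative to `K` (one-sided at its boundary). -/
def partialX (K : Set (ℝ × ℝ)) (U : ℝ × ℝ → ℂ) (p : ℝ × ℝ) : ℂ := fderivWithin ℝ U K p (1, 0)

/-- The partial derivative `U_z`, relative to `K` (one-sided at its boundary). -/
def partialZ (K : Set (ℝ × ℝ)) (U : ℝ × ℝ → ℂ) (p : ℝ × ℝ) : ℂ := fderivWithin ℝ U K p (0, 1)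

/-- `U` is a representative of the class of `u` on `Ω` that is `C¹` on `K`
(here `K` is the closure of `Ω`). -/
structure IsC1Rep (Ω K : Set (ℝ × ℝ)) (u U : ℝ × ℝ → ℂ) : Prop where
  ae_eq : u =ᵐ[volume.restrict Ω] U
  contDiffOn : ContDiffOn ℝ 1 U K

/-! ### Dirichlet-to-Neumann maps -/

/-- `β_k(γ) = (γ + 2πik)² + κ∞²`. -/
def beta (κinf : ℝ) (γ : ℂ) (k : ℤ) : ℂ :=
  (γ + 2 * Complex.I * Real.pi * k) ^ 2 + (κinf : ℂ) ^ 2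

/-- `s_k(γ) = sign(Im β_k(γ)) i √β_k(γ)`, with the principal square root. -/
def dtnSymbol (κinf : ℝ) (γ : ℂ) (k : ℤ) : ℂ :=
  (Real.sign (beta κinf γ k).im : ℂ) * Complex.I * Complex.sqrt (beta κinf γ k)

/-- Partial sums, over finite sets of frequencies, of the series
`∑ₖ s_k(γ) g_k exp(2πikz)`, where `g_k` are the Fourier coefficients of `g` on `[0,1]`. -/
def dtnPartialSum (κinf : ℝ) (γ : ℂ) (g : ℝ → ℂ) (F : Finset ℤ) (z : ℝ) : ℂ :=
  ∑ k ∈ F, dtnSymbol κinf γ k * fourierCoeffOn (zero_lt_one' ℝ) g k *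
    Complex.exp (2 * Real.pi * Complex.I * k * z)

/-- `T_γ[g] = h` in `L²(0,1)`: the series that defines the Dirichlet-to-Neumann map converges
in `L²(0,1)`, and its sum is `h`. -/
def DtNMapsTo (κinf : ℝ) (γ : ℂ) (g h : ℝ → ℂ) : Prop :=
  MemLp h 2 (volume.restrict (Ioo (0 : ℝ) 1)) ∧
    Tendsto (fun F : Finset ℤ =>
      eLpNorm (fun z => dtnPartialSum κinf γ g F z - h z) 2 (volume.restrict (Ioo (0 : ℝ) 1)))
      atTop (𝓝 0)

/-! ### The two problems -/

/-- `v ∈ H¹(S)` solves the waveguide problem on the unbounded strip `S = ℝ × (0,1)`: the equation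
holds weakly, `v` has a `C¹` representative up to the boundary, and the latter satisfies the
periodic boundary conditions. -/
def IsStripSolution (κ : ℝ × ℝ → ℝ) (γ : ℂ) (v : ℝ × ℝ → ℂ) : Prop :=
  MemH1 strip v ∧ IsWeakSolution strip κ γ v ∧
    ∃ V : ℝ × ℝ → ℂ, IsC1Rep strip closedStrip v V ∧
      (∀ x : ℝ, V (x, 0) = V (x, 1)) ∧
      (∀ x : ℝ, partialZ closedStrip V (x, 0) = partialZ closedStrip V (x, 1))

/-- `u ∈ H¹(S₀)` solves the problem on `S₀ = [xm, xp] × [0,1]` with Dirichlet-to-Neumann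
conditions at `x = xm` and `x = xp`. -/
def IsDtNSolution (κ : ℝ × ℝ → ℝ) (κm κp xm xp : ℝ) (γ : ℂ) (u : ℝ × ℝ → ℂ) : Prop :=
  MemH1 (rect xm xp) u ∧ IsWeakSolution (rect xm xp) κ γ u ∧
    ∃ U : ℝ × ℝ → ℂ, IsC1Rep (rect xm xp) (closedRect xm xp) u U ∧
      (∀ x ∈ Ioo xm xp, U (x, 0) = U (x, 1)) ∧
      (∀ x ∈ Ioo xm xp,
        partialZ (closedRect xm xp) U (x, 0) = partialZ (closedRect xm xp) U (x, 1)) ∧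
      DtNMapsTo κm γ (fun z => U (xm, z)) (fun z => -partialX (closedRect xm xp) U (xm, z)) ∧
      DtNMapsTo κp γ (fun z => U (xp, z)) (fun z => partialX (closedRect xm xp) U (xp, z))

end Waveguide

end

noncomputable section

namespace Waveguide

/-! ### The symbol of the Dirichlet-to-Neumann map -/

/-! Where `κ` equals a constant, the `k`-th Fourier coefficient `y` in `z` of a periodic solution
satisfies `y'' = -β_k y`. Since `Im β_k = 2 Re γ (Im γ + 2πk)`, the hypotheses on `γ` keep `β_k` off
the real axis; then `s_k² = -β_k`, and the sign in `s_k` is chosen so that `Re s_k < 0`. With `t`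
the distance to the rectangle, `exp(s_k t)` is the decaying solution and `exp(-s_k t)` the growing
one. The Dirichlet-to-Neumann condition says that only the decaying one occurs.

From the strip to the rectangle: square integrability excludes the growing solution
(`exists_norm_coeff_lt_one`, `eq_mul_of_not_growing`), so each outward derivative coefficient is
`s_k` times the trace coefficient (`coeff_x_eq_dtnSymbol_mul`). The normal derivative is continuous,
hence in `L²`, and Parseval turns the coefficient relation into convergence of the series
(`dtnMapsTo_of_coeff_eq`).

From the rectangle to the strip: the solution is continued on each side by `∑ g_k exp(s_k t +
2πikz)` (`exists_decaying_extension`). The delicate point is that this series is `C¹` up to `t = 0`,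
although the traces of `u`, `u_z` and `u_x` are merely continuous and their Fourier series need not
converge pointwise. For the symbol `-2π(1 + |k|)` the kernel is a damped Poisson kernel, which is
positive, so Abel summation works (`tendsto_modeSum_poissonSymbol`). The symbol `s_k` differs from
it by a bounded amount, hence the two exponentials differ by `O(1 / (1 + |k|))` uniformly in `t`,
and the square summability of the coefficients makes the difference of the two series tend to zero
(`DecayingSymbol.tendsto_modeSum`). The three pieces then match to first order, and the glued
function solves the equation weakly because the fluxes through the two interfaces cancel
(`weakDiv_strip_of_pieces`).

Weak solutions with a `C¹` representative are handled through flux identities on rectangles, which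
rest on a one-dimensional fundamental theorem of calculus for weak derivatives
(`sub_eq_integral_of_weak_deriv`). -/

lemma beta_im_ne_zero (κinf : ℝ) {γ : ℂ} (hre : γ.re ≠ 0) (him : ∀ n : ℤ, γ.im ≠ 2 * Real.pi * n)
    (k : ℤ) : (beta κinf γ k).im ≠ 0 := by
  have h1 : (beta κinf γ k).im = 2 * γ.re * (γ.im + 2 * Real.pi * k) := by
    simp [beta, pow_two]
    ring
  rw [h1]
  refine mul_ne_zero (mul_ne_zero two_ne_zero hre) fun h => him (-k) ?_
  push_cast
  linarith

lemma sqrt_mul_self (b : ℂ) : Complex.sqrt b * Complex.sqrt b = b := by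
  rw [← pow_two]
  simp [Complex.sqrt]

lemma dtnSymbol_sq (κinf : ℝ) {γ : ℂ} {k : ℤ} (h : (beta κinf γ k).im ≠ 0) :
    dtnSymbol κinf γ k ^ 2 = -beta κinf γ k := by
  have h1 : ((Real.sign (beta κinf γ k).im : ℝ) : ℂ) ^ 2 = 1 := by
    rcases Real.sign_apply_eq_of_ne_zero _ h with h | h <;> simp [h]
  have h2 := sqrt_mul_self (beta κinf γ k)
  unfold dtnSymbol
  calc _ = ((Real.sign (beta κinf γ k).im : ℝ) : ℂ) ^ 2 * Complex.I ^ 2 *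
        (Complex.sqrt (beta κinf γ k) * Complex.sqrt (beta κinf γ k)) := by ring
    _ = _ := by rw [h1, h2, Complex.I_sq]; ring

/-- The principal root `w` has `Re w ≥ 0` and `Im β = 2 Re w Im w`, so `Im w` has the sign of `Im
β`. Multiplying `i w` by that sign gives real part `-|Im w|`. -/
lemma dtnSymbol_re_neg (κinf : ℝ) {γ : ℂ} {k : ℤ} (h : (beta κinf γ k).im ≠ 0) :
    (dtnSymbol κinf γ k).re < 0 := by
  set b := beta κinf γ k with hb
  set w := Complex.sqrt b with hw
  have h2 : w * w = b := sqrt_mul_self b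
  have h0 : 0 ≤ w.re := by
    rw [hw, Complex.sqrt, Complex.cpow_inv_two_re]
    positivity
  have h3 : b.im = 2 * (w.re * w.im) := by
    rw [← h2, Complex.mul_im]; ring
  have h4 : 0 < w.re := by
    refine lt_of_le_of_ne h0 fun h5 => h ?_
    rw [h3, ← h5]; simp
  have h5 : (dtnSymbol κinf γ k).re = -(Real.sign b.im * w.im) := by
    simp [dtnSymbol, ← hb, ← hw]
  rw [h5]
  rcases lt_or_gt_of_ne h with h6 | h6
  · rw [Real.sign_of_neg h6]
    have : w.im < 0 := by
      by_contra! h7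
      have := mul_nonneg h4.le h7
      linarith
    linarith
  · rw [Real.sign_of_pos h6]
    have : 0 < w.im := by
      by_contra! h7
      have := mul_nonpos_of_nonneg_of_nonpos h4.le h7
      linarith
    linarith

lemma exists_bound_of_large {f : ℤ → ℝ} {C : ℝ} {N : ℕ} (h : ∀ k : ℤ, N < |k| → f k ≤ C) :
    ∃ D : ℝ, ∀ k, f k ≤ D := by
  obtain ⟨D, hD⟩ := ((Finset.Icc (-N : ℤ) N).image f).exists_le
  refine ⟨max C D, fun k => ?_⟩
  by_cases hk : (N : ℤ) < |k|
  · exact (h k hk).trans (le_max_left _ _)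
  · refine (hD _ (Finset.mem_image_of_mem _ ?_)).trans (le_max_right _ _)
    rw [Finset.mem_Icc]
    exact abs_le.1 (not_lt.1 hk)

/-- The symbol differs from that of the half-plane Laplacian by a bounded amount. -/
lemma exists_norm_dtnSymbol_add_le (κinf : ℝ) {γ : ℂ} (h : ∀ k, (beta κinf γ k).im ≠ 0) :
    ∃ C : ℝ, ∀ k : ℤ, ‖dtnSymbol κinf γ k + 2 * Real.pi * |(k : ℝ)|‖ ≤ C := by
  -- For `|k| > N` this gives `2π|k| - |Im γ| ≥ 1`, the lower bound needed for `‖s - μ‖`.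
  obtain ⟨N, hN⟩ := exists_nat_gt (|γ.im| + 1)
  refine exists_bound_of_large (N := N) (C := κinf ^ 2 + ‖γ‖) fun k hk => ?_
  set s := dtnSymbol κinf γ k with hs
  have hk' : (N : ℝ) < |(k : ℝ)| := by exact_mod_cast hk
  have key : ∀ ε : ℝ, ε ^ 2 = 1 → ε * k = |(k : ℝ)| →
      ‖s + 2 * Real.pi * |(k : ℝ)|‖ ≤ κinf ^ 2 + ‖γ‖ := by
    intro ε hε hεk
    have habs : |ε| = 1 := by
      exact (pow_eq_one_iff_of_nonneg (abs_nonneg ε) two_ne_zero).1 (by rw [sq_abs, hε])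
    -- With `ε` the sign of `k`, `μ` and `-μ` are the roots of `μ² = -(γ + 2πik)²`, so `(s - μ)(s +
    -- μ) = -κ²`. As `Re s < 0` while `Re μ` is large, the first factor has norm at least one; hence
    -- `s` is close to `-μ`.
    set μ : ℂ := ε * (2 * Real.pi * k - Complex.I * γ) with hμ
    have hεc : ((ε : ℝ) : ℂ) ^ 2 = 1 := by exact_mod_cast hε
    have hεkc : ((ε : ℝ) : ℂ) * k = ((|(k : ℝ)| : ℝ) : ℂ) := by exact_mod_cast hεk
    have h1 : (s - μ) * (s + μ) = -(κinf : ℂ) ^ 2 := by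
      have h2 := dtnSymbol_sq κinf (h k)
      rw [← hs] at h2
      have h3 : μ ^ 2 = -(γ + 2 * Complex.I * Real.pi * k) ^ 2 := by
        rw [hμ, mul_pow, hεc]
        linear_combination (-(γ ^ 2) - 4 * (Real.pi : ℂ) ^ 2 * k ^ 2) * (-Complex.I_sq)
      rw [beta] at h2
      linear_combination h2 - h3
    have h4 : 1 ≤ ‖s - μ‖ := by
      have h5 : μ.re = 2 * Real.pi * |(k : ℝ)| + ε * γ.im := by
        rw [← hεk, hμ]
        simp
        ring
      have h6 := dtnSymbol_re_neg κinf (h k)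
      rw [← hs] at h6
      have h7 : |ε * γ.im| = |γ.im| := by rw [abs_mul, habs, one_mul]
      have h8 := neg_abs_le (ε * γ.im)
      have h9 := Complex.abs_re_le_norm (s - μ)
      rw [Complex.sub_re, h5] at h9
      have h10 := neg_abs_le (s.re - (2 * Real.pi * |(k : ℝ)| + ε * γ.im))
      have h11 := Real.pi_gt_three
      have h12 : |(k : ℝ)| ≤ 2 * Real.pi * |(k : ℝ)| := by nlinarith [abs_nonneg (k : ℝ)]
      linarith
    have h13 : ‖s + μ‖ ≤ κinf ^ 2 := by
      have h14 := congrArg norm h1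
      rw [norm_mul, norm_neg, norm_pow, Complex.norm_real, Real.norm_eq_abs, sq_abs] at h14
      nlinarith [norm_nonneg (s + μ)]
    have h15 : s + 2 * Real.pi * |(k : ℝ)| = (s + μ) + ε * Complex.I * γ := by
      rw [hμ, ← hεkc]; ring
    rw [h15]
    refine (norm_add_le _ _).trans (add_le_add h13 ?_)
    rw [norm_mul, norm_mul, Complex.norm_real, Real.norm_eq_abs, habs]
    simp
  rcases le_total 0 (k : ℝ) with hk0 | hk0
  · exact key 1 (by norm_num) (by rw [abs_of_nonneg hk0, one_mul])
  · exact key (-1) (by norm_num) (by rw [abs_of_nonpos hk0]; ring)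

/-- For large `|k|` the asymptotics `-2π|k| + O(1)` give the bound; the finitely many other
frequencies have negative real part. Bounding the quotient `(1 + |k|) / (-Re s_k)` treats both at
once, and the inverse of its bound serves as `c`. -/
lemma exists_dtnSymbol_re_le (κinf : ℝ) {γ : ℂ} (h : ∀ k, (beta κinf γ k).im ≠ 0) :
    ∃ c : ℝ, 0 < c ∧ c ≤ 1 ∧ ∀ k : ℤ, (dtnSymbol κinf γ k).re ≤ -(c * (1 + |(k : ℝ)|)) := by
  obtain ⟨C, hC⟩ := exists_norm_dtnSymbol_add_le κinf h
  obtain ⟨N, hN⟩ := exists_nat_gt (C + 1)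
  obtain ⟨D, hD⟩ := exists_bound_of_large (N := N) (C := 1)
    (f := fun k : ℤ => (1 + |(k : ℝ)|) / (-(dtnSymbol κinf γ k).re)) (by
      intro k hk
      have hk' : (N : ℝ) < |(k : ℝ)| := by exact_mod_cast hk
      have h1 := (Complex.abs_re_le_norm _).trans (hC k)
      have h2 := le_abs_self (dtnSymbol κinf γ k + 2 * Real.pi * |(k : ℝ)|).re
      have h3 : (dtnSymbol κinf γ k + 2 * Real.pi * |(k : ℝ)|).re =
          (dtnSymbol κinf γ k).re + 2 * Real.pi * |(k : ℝ)| := by simp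
      have h4 := Real.pi_gt_three
      rw [div_le_one (by linarith [dtnSymbol_re_neg κinf (h k)])]
      nlinarith [abs_nonneg (k : ℝ)])
  have hD' : 0 < max D 1 := by positivity
  refine ⟨(max D 1)⁻¹, by positivity, inv_le_one_of_one_le₀ (le_max_right _ _), fun k => ?_⟩
  have h1 := (hD k).trans (le_max_left D 1)
  have h2 := dtnSymbol_re_neg κinf (h k)
  rw [div_le_iff₀ (by linarith)] at h1
  rw [inv_mul_eq_div, le_neg, div_le_iff₀ hD']
  linarith

/-! ### Weak derivatives of continuous functions on an interval -/

/-- A smooth step, equal to `0` on `(-∞, 1]` and to `1` on `[2, ∞)`. -/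
def step (x : ℝ) : ℝ := Real.smoothTransition (x - 1)

lemma contDiff_step : ContDiff ℝ ∞ step :=
  Real.smoothTransition.contDiff.comp (contDiff_id.sub contDiff_const)

lemma step_of_le {x : ℝ} (h : x ≤ 1) : step x = 0 :=
  Real.smoothTransition.zero_of_nonpos (by linarith)

lemma step_of_ge {x : ℝ} (h : 2 ≤ x) : step x = 1 :=
  Real.smoothTransition.one_of_one_le (by linarith)

lemma abs_step_le (x : ℝ) : |step x| ≤ 1 := by
  rw [step, abs_of_nonneg (Real.smoothTransition.nonneg _)]
  exact Real.smoothTransition.le_one _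

lemma hasDerivAt_step (x : ℝ) : HasDerivAt step (deriv step x) x :=
  ((contDiff_step.differentiable (by simp)) x).hasDerivAt

lemma continuous_deriv_step : Continuous (deriv step) :=
  contDiff_step.continuous_deriv (by simp)

lemma hasCompactSupport_deriv_step : HasCompactSupport (deriv step) := by
  refine HasCompactSupport.intro (isCompact_Icc (a := (1 : ℝ)) (b := 2)) fun x hx => ?_
  rw [mem_Icc, not_and_or, not_le, not_le] at hx
  rcases hx with hx | hx
  · have : step =ᶠ[𝓝 x] fun _ => 0 := by
      filter_upwards [Iio_mem_nhds hx] with y hy using step_of_le (le_of_lt hy)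
    rw [this.deriv_eq]; simp
  · have : step =ᶠ[𝓝 x] fun _ => 1 := by
      filter_upwards [Ioi_mem_nhds hx] with y hy using step_of_ge (le_of_lt hy)
    rw [this.deriv_eq]; simp

lemma integrable_deriv_step : Integrable (deriv step) :=
  continuous_deriv_step.integrable_of_hasCompactSupport hasCompactSupport_deriv_step

lemma integral_deriv_step : ∫ x, deriv step x = 1 := by
  have h := integral_of_hasDerivAt_of_tendsto (f := step) (f' := deriv step) (m := 0) (n := 1)
    hasDerivAt_step integrable_deriv_step
    (tendsto_const_nhds.congr' (by
      filter_upwards [Iic_mem_atBot 1] with x hx using (step_of_le hx).symm))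
    (tendsto_const_nhds.congr' (by
      filter_upwards [Ici_mem_atTop 2] with x hx using (step_of_ge hx).symm))
  simpa using h

lemma tendsto_step_mul_sub {L : ℝ} (hL : 0 < L) (x : ℝ) :
    Tendsto (fun n : ℕ => step (n * L - x)) atTop (𝓝 1) := by
  refine tendsto_const_nhds.congr' ?_
  have h : Tendsto (fun n : ℕ => (n : ℝ) * L - x) atTop atTop :=
    tendsto_atTop_add_const_right _ _ (tendsto_natCast_atTop_atTop.atTop_mul_const hL)
  filter_upwards [h.eventually_ge_atTop 2] with n hn using (step_of_ge hn).symm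

/-- The derivative of `step` has integral one, so after rescaling by `1 / n` it acts as an
approximate identity at `c`. The factor `step (n * L - s)` is the cutoff at the opposite endpoint,
which is eventually one for fixed `s`; `σ = ±1` selects the side of `c`. -/
lemma tendsto_integral_deriv_step {G : ℝ → ℂ} (hG : Continuous G) {M : ℝ} (hM : ∀ x, ‖G x‖ ≤ M)
    {L : ℝ} (hL : 0 < L) (c σ : ℝ) :
    Tendsto (fun n : ℕ => ∫ s, G (c + σ * (s / n)) * ((deriv step s * step (n * L - s) : ℝ) : ℂ))
      atTop (𝓝 (G c)) := by
  have h1 : ∫ s, G c * ((deriv step s : ℝ) : ℂ) = G c := by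
    rw [integral_const_mul, integral_complex_ofReal, integral_deriv_step]; simp
  rw [← h1]
  refine tendsto_integral_of_dominated_convergence (fun s => M * |deriv step s|) ?_
    (integrable_deriv_step.abs.const_mul M) ?_ ?_
  · intro n
    have := contDiff_step.continuous
    have := continuous_deriv_step
    exact Continuous.aestronglyMeasurable (by fun_prop)
  · refine fun n => Eventually.of_forall fun s => ?_
    rw [norm_mul, Complex.norm_real, Real.norm_eq_abs, abs_mul]
    have hM0 : 0 ≤ M := (norm_nonneg _).trans (hM 0)
    refine mul_le_mul (hM _) ?_ (by positivity) hM0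
    exact mul_le_of_le_one_right (abs_nonneg _) (abs_step_le _)
  · refine Eventually.of_forall fun s => ?_
    refine Tendsto.mul ?_ ?_
    · have h2 : Tendsto (fun n : ℕ => c + σ * (s / n)) atTop (𝓝 (c + σ * 0)) :=
        tendsto_const_nhds.add (tendsto_const_nhds.mul (tendsto_const_div_atTop_nhds_zero_nat s))
      simp only [mul_zero, add_zero] at h2
      exact (hG.tendsto c).comp h2
    · have h3 := (tendsto_step_mul_sub hL s).const_mul (deriv step s)
      rw [mul_one] at h3
      exact (Complex.continuous_ofReal.tendsto _).comp h3

/-- The cutoff function of `(a, b)` at scale `1 / n`. -/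
def cutoff (a b : ℝ) (n : ℕ) (x : ℝ) : ℝ := step (n * (x - a)) * step (n * (b - x))

lemma contDiff_cutoff (a b : ℝ) (n : ℕ) : ContDiff ℝ ∞ (cutoff a b n) := by
  unfold cutoff
  have := contDiff_step
  fun_prop

lemma abs_cutoff_le (a b : ℝ) (n : ℕ) (x : ℝ) : |cutoff a b n x| ≤ 1 := by
  rw [cutoff, abs_mul]
  exact mul_le_one₀ (abs_step_le _) (abs_nonneg _) (abs_step_le _)

lemma tsupport_cutoff_subset (a b : ℝ) {n : ℕ} (hn : 0 < n) :
    tsupport (cutoff a b n) ⊆ Icc (a + 1 / n) (b - 1 / n) := by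
  have hn' : (0 : ℝ) < n := by exact_mod_cast hn
  refine closure_minimal (fun x hx => ?_) isClosed_Icc
  rw [Function.mem_support, cutoff] at hx
  constructor
  · by_contra! h
    refine left_ne_zero_of_mul hx (step_of_le ?_)
    have := (lt_div_iff₀ hn').1 (show x - a < 1 / n by linarith)
    linarith
  · by_contra! h
    refine right_ne_zero_of_mul hx (step_of_le ?_)
    have := (lt_div_iff₀ hn').1 (show b - x < 1 / n by linarith)
    linarith

lemma tendsto_cutoff {a b x : ℝ} (hx : x ∈ Ioo a b) :
    Tendsto (fun n : ℕ => cutoff a b n x) atTop (𝓝 1) := by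
  have h1 := tendsto_step_mul_sub (sub_pos.2 hx.1) 0
  have h2 := tendsto_step_mul_sub (sub_pos.2 hx.2) 0
  simpa [cutoff] using h1.mul h2

lemma deriv_cutoff (a b : ℝ) (n : ℕ) (x : ℝ) : deriv (cutoff a b n) x =
    n * (deriv step (n * (x - a)) * step (n * (b - x))) -
      n * (deriv step (n * (b - x)) * step (n * (x - a))) := by
  have h1 : HasDerivAt (fun x : ℝ => (n : ℝ) * (x - a)) n x := by
    simpa using ((hasDerivAt_id x).sub_const a).const_mul (n : ℝ)
  have h2 : HasDerivAt (fun x : ℝ => (n : ℝ) * (b - x)) (-n) x := by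
    simpa using ((hasDerivAt_id x).const_sub b).const_mul (n : ℝ)
  have h3 := ((hasDerivAt_step _).comp x h1).mul ((hasDerivAt_step _).comp x h2)
  have h4 : deriv (cutoff a b n) x = _ := h3.deriv
  rw [h4]
  simp only [Function.comp]
  ring

lemma tendsto_integral_mul_deriv_cutoff {a b : ℝ} (hab : a < b) {G : ℝ → ℂ} (hG : Continuous G)
    {M : ℝ} (hM : ∀ x, ‖G x‖ ≤ M) :
    Tendsto (fun n : ℕ => ∫ x, G x * ((deriv (cutoff a b n) x : ℝ) : ℂ)) atTop (𝓝 (G a - G b)) := by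
  have h1 := tendsto_integral_deriv_step hG hM (sub_pos.2 hab) a 1
  have h2 := tendsto_integral_deriv_step hG hM (sub_pos.2 hab) b (-1)
  refine (h1.sub h2).congr' ?_
  filter_upwards [eventually_gt_atTop 0] with n hn
  have hn' : (0 : ℝ) < n := by exact_mod_cast hn
  have hc := contDiff_step.continuous
  have hd := continuous_deriv_step
  have hi : ∀ c σ : ℝ, Integrable
      (fun s => G (c + σ * (s / n)) * ((deriv step s * step (n * (b - a) - s) : ℝ) : ℂ)) := by
    intro c σ
    refine Continuous.integrable_of_hasCompactSupport (by fun_prop) ?_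
    refine HasCompactSupport.mul_left ?_
    exact (hasCompactSupport_deriv_step.mul_right (f' := fun s => step (n * (b - a) - s))).comp_left
      Complex.ofReal_zero
  -- `A` and `B` arise from the two terms of `deriv_cutoff` by the substitutions `s = n (x - a)` and
  -- `s = n (b - x)`.
  set A : ℝ → ℂ := fun s =>
    G (a + 1 * (s / n)) * ((deriv step s * step (n * (b - a) - s) : ℝ) : ℂ) with hA
  set B : ℝ → ℂ := fun s =>
    G (b + -1 * (s / n)) * ((deriv step s * step (n * (b - a) - s) : ℝ) : ℂ) with hB
  have e1 : ∫ s, A s = ∫ x, (n : ℂ) * A (n * (x - a)) := by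
    rw [integral_const_mul, integral_sub_right_eq_self (fun x => A (n * x)) a,
      Measure.integral_comp_mul_left, abs_of_pos (inv_pos.2 hn')]
    simp [hn.ne']
  have e2 : ∫ s, B s = ∫ x, (n : ℂ) * B (n * (b - x)) := by
    rw [integral_const_mul, integral_sub_left_eq_self (fun x => B (n * x)) _ b,
      Measure.integral_comp_mul_left, abs_of_pos (inv_pos.2 hn')]
    simp [hn.ne']
  have i1 : Integrable fun x => (n : ℂ) * A (n * (x - a)) :=
    (((hi a 1).comp_mul_left' hn'.ne').comp_sub_right a).const_mul _
  have i2 : Integrable fun x => (n : ℂ) * B (n * (b - x)) :=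
    (((hi b (-1)).comp_mul_left' hn'.ne').comp_sub_left b).const_mul _
  rw [e1, e2, ← integral_sub i1 i2]
  refine integral_congr_ae (Eventually.of_forall fun x => ?_)
  have f1 : a + 1 * ((n : ℝ) * (x - a) / n) = x := by field_simp; ring
  have f2 : b + -1 * ((n : ℝ) * (b - x) / n) = x := by field_simp; ring
  have f3 : (n : ℝ) * (b - a) - n * (x - a) = n * (b - x) := by ring
  have f4 : (n : ℝ) * (b - a) - n * (b - x) = n * (x - a) := by ring
  simp only [hA, hB, f1, f2, f3, f4, deriv_cutoff]
  push_cast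
  ring

/-- A continuous function on `[a, b]` with integrable weak derivative on `(a, b)` satisfies the
fundamental theorem of calculus. -/
theorem sub_eq_integral_of_weak_deriv {a b : ℝ} (hab : a < b) {F W : ℝ → ℂ}
    (hF : ContinuousOn F (Icc a b)) (hW : IntegrableOn W (Ioo a b))
    (h : ∀ η : ℝ → ℝ, ContDiff ℝ ∞ η → HasCompactSupport η → tsupport η ⊆ Ioo a b →
      ∫ x in Ioo a b, F x * ((deriv η x : ℝ) : ℂ) = -∫ x in Ioo a b, W x * (η x : ℂ)) :
    F b - F a = ∫ x in Ioo a b, W x := by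
  -- Constant continuation outside `[a, b]` gives a bounded continuous function on the line. Testing
  -- with the cutoffs then produces `F a - F b` on one side and the integral of `W` on the other.
  set G : ℝ → ℂ := IccExtend hab.le ((Icc a b).domRestrict F) with hGdef
  have hG : Continuous G := (continuousOn_iff_continuous_domRestrict.1 hF).Icc_extend'
  obtain ⟨M, hM⟩ := isCompact_Icc.exists_bound_of_continuousOn hF
  have hGM : ∀ x, ‖G x‖ ≤ M := fun x => hM _ (projIcc a b hab.le x).2
  have hGF : ∀ x ∈ Icc a b, G x = F x := fun x hx => by
    rw [hGdef, IccExtend_of_mem _ _ hx]; rfl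
  have h1 := tendsto_integral_mul_deriv_cutoff hab hG hGM
  rw [hGF a (left_mem_Icc.2 hab.le), hGF b (right_mem_Icc.2 hab.le)] at h1
  have h2 : Tendsto (fun n : ℕ => -∫ x in Ioo a b, W x * (cutoff a b n x : ℂ)) atTop
      (𝓝 (-∫ x in Ioo a b, W x)) := by
    refine (tendsto_integral_of_dominated_convergence (fun x => ‖W x‖) ?_ hW.norm ?_ ?_).neg
    · intro n
      exact hW.aestronglyMeasurable.mul (Complex.continuous_ofReal.comp
        (contDiff_cutoff a b n).continuous).aestronglyMeasurable
    · refine fun n => Eventually.of_forall fun x => ?_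
      rw [norm_mul, Complex.norm_real]
      exact mul_le_of_le_one_right (norm_nonneg _) (abs_cutoff_le _ _ _ _)
    · refine (ae_restrict_iff' measurableSet_Ioo).2 (Eventually.of_forall fun x hx => ?_)
      have := ((Complex.continuous_ofReal.tendsto _).comp (tendsto_cutoff hx)).const_mul (W x)
      simpa using this
  have h3 : F a - F b = -∫ x in Ioo a b, W x := by
    refine tendsto_nhds_unique h1 (h2.congr' ?_)
    filter_upwards [eventually_gt_atTop 0] with n hn
    have hn' : (0 : ℝ) < 1 / n := by
      have : (0 : ℝ) < n := by exact_mod_cast hn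
      positivity
    have hs : tsupport (cutoff a b n) ⊆ Ioo a b := (tsupport_cutoff_subset a b hn).trans
      fun x hx => ⟨by linarith [hx.1], by linarith [hx.2]⟩
    have hcs : HasCompactSupport (cutoff a b n) :=
      (isCompact_Icc (a := a + 1 / (n : ℝ)) (b := b - 1 / n)).of_isClosed_subset
        (isClosed_tsupport _) (tsupport_cutoff_subset a b hn)
    rw [← h _ (contDiff_cutoff a b n) hcs hs]
    have h4 : ∫ x in Ioo a b, G x * ((deriv (cutoff a b n) x : ℝ) : ℂ) =
        ∫ x, G x * ((deriv (cutoff a b n) x : ℝ) : ℂ) := by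
      refine setIntegral_eq_integral_of_forall_compl_eq_zero fun x hx => ?_
      have : deriv (cutoff a b n) x = 0 := by
        by_contra h0
        exact hx (hs (support_deriv_subset (Function.mem_support.2 h0)))
      simp [this]
    rw [← h4]
    refine setIntegral_congr_fun measurableSet_Ioo fun x hx => ?_
    simp only [hGF x (Ioo_subset_Icc_self hx)]
  linear_combination -h3

/-! ### Functions of class `C¹` on a set, with given partial derivatives -/

/-- The linear form with partial derivatives `a` and `b`. -/
def gradMap (a b : ℂ) : ℝ × ℝ →L[ℝ] ℂ :=
  (ContinuousLinearMap.fst ℝ ℝ ℝ).smulRight a + (ContinuousLinearMap.snd ℝ ℝ ℝ).smulRight b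

lemma gradMap_apply (a b : ℂ) (p : ℝ × ℝ) : gradMap a b p = p.1 * a + p.2 * b := by
  simp [gradMap]

@[simp] lemma gradMap_x (a b : ℂ) : gradMap a b (1, 0) = a := by simp [gradMap]

@[simp] lemma gradMap_z (a b : ℂ) : gradMap a b (0, 1) = b := by simp [gradMap]

lemma eq_gradMap (L : ℝ × ℝ →L[ℝ] ℂ) : L = gradMap (L (1, 0)) (L (0, 1)) := by
  ext <;> simp

lemma gradMap_eq_smul (a b : ℂ) : gradMap a b =
    a • gradMap 1 0 + b • gradMap 0 1 := by
  rw [eq_gradMap (a • gradMap 1 0 + b • gradMap 0 1)]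
  simp

lemma tendsto_gradMap {α : Type*} {l : Filter α} {f g : α → ℂ} {a b : ℂ}
    (hf : Tendsto f l (𝓝 a)) (hg : Tendsto g l (𝓝 b)) :
    Tendsto (fun p => gradMap (f p) (g p)) l (𝓝 (gradMap a b)) := by
  rw [gradMap_eq_smul a b, funext fun p => gradMap_eq_smul (f p) (g p)]
  exact (hf.smul_const (gradMap 1 0)).add (hg.smul_const (gradMap 0 1))

/-- `U` is of class `C¹` on `K` (relative to `K`), with partial derivatives `Ux` and `Uz`. -/
structure C1On (K : Set (ℝ × ℝ)) (U Ux Uz : ℝ × ℝ → ℂ) : Prop where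
  hasFDerivWithinAt : ∀ p ∈ K, HasFDerivWithinAt U (gradMap (Ux p) (Uz p)) K p
  continuousOn_x : ContinuousOn Ux K
  continuousOn_z : ContinuousOn Uz K

namespace C1On

variable {K L : Set (ℝ × ℝ)} {U Ux Uz V Vx Vz : ℝ × ℝ → ℂ}

lemma continuousOn (h : C1On K U Ux Uz) : ContinuousOn U K :=
  fun p hp => (h.hasFDerivWithinAt p hp).continuousWithinAt

lemma of_contDiffOn (hU : ContDiffOn ℝ 1 U K) (hK : UniqueDiffOn ℝ K) :
    C1On K U (partialX K U) (partialZ K U) := by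
  have hc := hU.continuousOn_fderivWithin hK le_rfl
  refine ⟨fun p hp => ?_, hc.clm_apply continuousOn_const, hc.clm_apply continuousOn_const⟩
  have := ((hU.differentiableOn (by simp)) p hp).hasFDerivWithinAt
  rwa [eq_gradMap (fderivWithin ℝ U K p)] at this

lemma contDiffOn (h : C1On K U Ux Uz) (hK : UniqueDiffOn ℝ K) : ContDiffOn ℝ 1 U K := by
  have hc : ContDiffOn ℝ 0 (fun p => gradMap (Ux p) (Uz p)) K := contDiffOn_zero.2
    fun p hp => tendsto_gradMap (h.continuousOn_x p hp) (h.continuousOn_z p hp)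
  rw [← zero_add (1 : WithTop ℕ∞), contDiffOn_succ_iff_hasFDerivWithinAt_of_uniqueDiffOn hK]
  exact ⟨fun h0 => absurd h0 (by simp), _, hc, h.hasFDerivWithinAt⟩

lemma partialX_eq (h : C1On K U Ux Uz) (hK : UniqueDiffOn ℝ K) {p : ℝ × ℝ} (hp : p ∈ K) :
    partialX K U p = Ux p := by
  rw [partialX, (h.hasFDerivWithinAt p hp).fderivWithin (hK p hp), gradMap_x]

lemma partialZ_eq (h : C1On K U Ux Uz) (hK : UniqueDiffOn ℝ K) {p : ℝ × ℝ} (hp : p ∈ K) :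
    partialZ K U p = Uz p := by
  rw [partialZ, (h.hasFDerivWithinAt p hp).fderivWithin (hK p hp), gradMap_z]

lemma mono (h : C1On K U Ux Uz) (hLK : L ⊆ K) : C1On L U Ux Uz :=
  ⟨fun p hp => (h.hasFDerivWithinAt p (hLK hp)).mono hLK, h.continuousOn_x.mono hLK,
    h.continuousOn_z.mono hLK⟩

lemma congr (h : C1On K U Ux Uz) (h0 : EqOn V U K) (h1 : EqOn Vx Ux K) (h2 : EqOn Vz Uz K) :
    C1On K V Vx Vz := by
  refine ⟨fun p hp => ?_, h.continuousOn_x.congr h1, h.continuousOn_z.congr h2⟩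
  rw [h1 hp, h2 hp]
  exact (h.hasFDerivWithinAt p hp).congr h0 (h0 hp)

/-- At a common point both relative derivatives are the same linear map; at a point off a closed
piece the derivative relative to that piece is unconstrained. Thus common `Ux` and `Uz` are the only
matching condition for gluing. -/
lemma union (hK : C1On K U Ux Uz) (hL : C1On L U Ux Uz) (hKc : IsClosed K) (hLc : IsClosed L) :
    C1On (K ∪ L) U Ux Uz := by
  refine ⟨fun p _ => ?_, hK.continuousOn_x.union_of_isClosed hL.continuousOn_x hKc hLc,
    hK.continuousOn_z.union_of_isClosed hL.continuousOn_z hKc hLc⟩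
  refine HasFDerivWithinAt.union ?_ ?_
  · by_cases hp : p ∈ K
    · exact hK.hasFDerivWithinAt p hp
    · exact .of_notMem_closure (by rwa [hKc.closure_eq])
  · by_cases hp : p ∈ L
    · exact hL.hasFDerivWithinAt p hp
    · exact .of_notMem_closure (by rwa [hLc.closure_eq])

lemma hasFDerivAt (h : C1On K U Ux Uz) {p : ℝ × ℝ} (hp : K ∈ 𝓝 p) :
    HasFDerivAt U (gradMap (Ux p) (Uz p)) p :=
  (h.hasFDerivWithinAt p (mem_of_mem_nhds hp)).hasFDerivAt hp

/-- Partial derivatives after the change of variables `(x, z) ↦ (σ (x - c), z)`. -/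
lemma comp_affine (h : C1On K U Ux Uz) (σ c : ℝ) {T : ℝ × ℝ → ℝ × ℝ}
    (hT : T = fun p => (σ * (p.1 - c), p.2)) :
    C1On (T ⁻¹' K) (U ∘ T) (fun p => σ * Ux (T p)) (fun p => Uz (T p)) := by
  have hTc : Continuous T := by rw [hT]; fun_prop
  have hTm : MapsTo T (T ⁻¹' K) K := fun p hp => hp
  refine ⟨fun p hp => ?_, continuousOn_const.mul (h.continuousOn_x.comp hTc.continuousOn hTm),
    h.continuousOn_z.comp hTc.continuousOn hTm⟩
  have h1 : HasFDerivAt T ((σ • ContinuousLinearMap.fst ℝ ℝ ℝ).prod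
      (ContinuousLinearMap.snd ℝ ℝ ℝ)) p := by
    rw [hT]
    exact ((hasFDerivAt_fst.sub_const c).const_mul σ).prodMk hasFDerivAt_snd
  have h2 := (h.hasFDerivWithinAt (T p) hp).comp p h1.hasFDerivWithinAt hTm
  rw [eq_gradMap ((gradMap (Ux (T p)) (Uz (T p))).comp _)] at h2
  simpa [gradMap_apply] using h2

end C1On

/-! ### Weak and classical derivatives -/

lemma IsTestFunction.contDiff_fderiv {Ω : Set (ℝ × ℝ)} {φ : ℝ × ℝ → ℂ} (hφ : IsTestFunction Ω φ)
    (e : ℝ × ℝ) : IsTestFunction Ω fun p => fderiv ℝ φ p e where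
  smooth := (hφ.smooth.fderiv_right (m := ∞) (by simp)).clm_apply contDiff_const
  compact := hφ.compact.fderiv_apply ℝ e
  support := (closure_minimal (fun p hp => by
    refine support_fderiv_subset (𝕜 := ℝ) (f := φ) ?_
    intro h0
    exact hp (by simp [h0])) (isClosed_tsupport φ)).trans hφ.support

lemma IsTestFunction.mono {Ω Ω' : Set (ℝ × ℝ)} {φ : ℝ × ℝ → ℂ} (hφ : IsTestFunction Ω φ)
    (h : Ω ⊆ Ω') : IsTestFunction Ω' φ :=
  ⟨hφ.smooth, hφ.compact, hφ.support.trans h⟩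

lemma IsTestFunction.continuous {Ω : Set (ℝ × ℝ)} {φ : ℝ × ℝ → ℂ} (hφ : IsTestFunction Ω φ) :
    Continuous φ := hφ.smooth.continuous

lemma IsTestFunction.eq_zero {Ω : Set (ℝ × ℝ)} {φ : ℝ × ℝ → ℂ} (hφ : IsTestFunction Ω φ)
    {p : ℝ × ℝ} (hp : p ∉ Ω) : φ p = 0 :=
  image_eq_zero_of_notMem_tsupport fun h => hp (hφ.support h)

/-- No control of `f` at the boundary of `Ω` is needed, since `φ` vanishes in a neighbourhood of
every point outside `Ω`. -/
lemma IsTestFunction.continuous_mul {Ω : Set (ℝ × ℝ)} (hΩ : IsOpen Ω) {φ f : ℝ × ℝ → ℂ}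
    (hφ : IsTestFunction Ω φ) (hf : ContinuousOn f Ω) : Continuous fun p => f p * φ p := by
  refine continuous_iff_continuousAt.2 fun p => ?_
  by_cases hp : p ∈ Ω
  · exact (hf.continuousAt (hΩ.mem_nhds hp)).mul hφ.continuous.continuousAt
  · have h1 : ∀ᶠ q in 𝓝 p, φ q = 0 := by
      filter_upwards [(isClosed_tsupport φ).isOpen_compl.mem_nhds fun h => hp (hφ.support h)]
        with q hq using image_eq_zero_of_notMem_tsupport hq
    have h2 : (fun _ => (0 : ℂ)) =ᶠ[𝓝 p] fun q => f q * φ q := by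
      filter_upwards [h1] with q hq
      rw [hq, mul_zero]
    exact continuousAt_const.congr h2

lemma IsTestFunction.integrable_mul {Ω : Set (ℝ × ℝ)} (hΩ : IsOpen Ω) {φ f : ℝ × ℝ → ℂ}
    (hφ : IsTestFunction Ω φ) (hf : ContinuousOn f Ω) : Integrable fun p => f p * φ p :=
  (hφ.continuous_mul hΩ hf).integrable_of_hasCompactSupport hφ.compact.mul_left

lemma setIntegral_eq_of_eq_zero {Ω Ω' : Set (ℝ × ℝ)}
    (hΩ' : MeasurableSet Ω') (h : Ω ⊆ Ω') {F : ℝ × ℝ → ℂ} (hF : ∀ p ∉ Ω, F p = 0) :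
    ∫ p in Ω', F p = ∫ p in Ω, F p :=
  (setIntegral_eq_of_subset_of_forall_sdiff_eq_zero hΩ' h fun p hp => hF p hp.2)

/-- A classical derivative is a weak derivative. -/
lemma hasWeakDeriv_of_hasFDerivAt {Ω : Set (ℝ × ℝ)} (hΩ : IsOpen Ω) {f : ℝ × ℝ → ℂ}
    {L : ℝ × ℝ → ℝ × ℝ →L[ℝ] ℂ} (e : ℝ × ℝ) (hf : ∀ p ∈ Ω, HasFDerivAt f (L p) p)
    (hL : ContinuousOn (fun p => L p e) Ω) : HasWeakDeriv Ω e f fun p => L p e := by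
  intro φ hφ
  have hfc : ContinuousOn f Ω := fun p hp => (hf p hp).continuousAt.continuousWithinAt
  have hφe := hφ.contDiff_fderiv e
  have h1 : ∫ p in Ω, f p * fderiv ℝ φ p e = ∫ p, f p * fderiv ℝ φ p e :=
    setIntegral_eq_integral_of_forall_compl_eq_zero fun p hp => by rw [hφe.eq_zero hp, mul_zero]
  have h2 : ∫ p in Ω, L p e * φ p = ∫ p, L p e * φ p :=
    setIntegral_eq_integral_of_forall_compl_eq_zero fun p hp => by rw [hφ.eq_zero hp, mul_zero]
  rw [h1, h2]
  exact integral_bilinear_hasLineDerivAt_right_eq_neg_left_of_integrable (v := e)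
    (B := ContinuousLinearMap.mul ℝ ℂ) (f := f) (f' := fun p => L p e) (g := φ)
    (g' := fun p => fderiv ℝ φ p e) (hφ.integrable_mul hΩ hL) (hφe.integrable_mul hΩ hfc)
    (hφ.integrable_mul hΩ hfc) (fun p hp => (hf p (hφ.support hp)).hasLineDerivAt e)
    (fun p _ => ((hφ.smooth.differentiable (by simp)) p).hasFDerivAt.hasLineDerivAt e)

/-- Weak derivatives are unique up to equality almost everywhere. -/
lemma HasWeakDeriv.ae_eq {Ω : Set (ℝ × ℝ)} (hΩ : IsOpen Ω) {e : ℝ × ℝ} {u w w' : ℝ × ℝ → ℂ}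
    (h : HasWeakDeriv Ω e u w) (h' : HasWeakDeriv Ω e u w') (hw : LocallyIntegrableOn w Ω)
    (hw' : LocallyIntegrableOn w' Ω) : w =ᵐ[volume.restrict Ω] w' := by
  have key := hΩ.ae_eq_zero_of_integral_contDiff_smul_eq_zero (μ := volume)
    (f := fun p => w p - w' p) (hw.sub hw') (by
      intro g hg hgc hgs
      have ht : IsTestFunction Ω fun p => (g p : ℂ) :=
        ⟨Complex.ofRealCLM.contDiff.comp hg, hgc.comp_left Complex.ofReal_zero,
          (tsupport_comp_subset Complex.ofReal_zero g).trans hgs⟩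
      have hi : ∀ v : ℝ × ℝ → ℂ, LocallyIntegrableOn v Ω → IntegrableOn (fun p => v p * g p) Ω := by
        intro v hv
        have h1 : IntegrableOn v (tsupport g) :=
          (hv.mono_set hgs).integrableOn_isCompact hgc
        have h2 : IntegrableOn (fun p => v p * g p) (tsupport g) :=
          h1.mul_continuousOn ht.continuous.continuousOn hgc
        have h3 : Integrable fun p => v p * g p :=
          (integrableOn_iff_integrable_of_support_subset (fun p hp => by
            refine subset_tsupport _ fun h0 => hp ?_
            simp [h0])).1 h2
        exact h3.integrableOn
      have h1 := h _ ht
      rw [h' _ ht, neg_inj] at h1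
      rw [← setIntegral_eq_integral_of_forall_compl_eq_zero (s := Ω)]
      · have h2 : ∫ p in Ω, (w p * g p - w' p * g p) = 0 := by
          rw [integral_sub (hi w hw) (hi w' hw'), h1, sub_self]
        rw [← h2]
        refine integral_congr_ae (Eventually.of_forall fun p => ?_)
        simp only [Complex.real_smul]
        ring
      · intro p hp
        rw [image_eq_zero_of_notMem_tsupport fun h0 => hp (hgs h0), zero_smul])
  rw [EventuallyEq, ae_restrict_iff' hΩ.measurableSet]
  filter_upwards [key] with p hp hpΩ using sub_eq_zero.1 (hp hpΩ)

lemma HasWeakDeriv.congr {Ω : Set (ℝ × ℝ)} {e : ℝ × ℝ} {u v w : ℝ × ℝ → ℂ}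
    (h : HasWeakDeriv Ω e u w) (huv : u =ᵐ[volume.restrict Ω] v) : HasWeakDeriv Ω e v w := by
  intro φ hφ
  rw [← h φ hφ]
  refine integral_congr_ae ?_
  filter_upwards [huv] with p hp
  rw [hp]

lemma HasWeakDeriv.mono {Ω Ω' : Set (ℝ × ℝ)} (hΩ' : MeasurableSet Ω')
    (hs : Ω ⊆ Ω') {e : ℝ × ℝ} {u w : ℝ × ℝ → ℂ} (h : HasWeakDeriv Ω' e u w) :
    HasWeakDeriv Ω e u w := by
  intro φ hφ
  have h1 := h φ (hφ.mono hs)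
  rwa [setIntegral_eq_of_eq_zero hΩ' hs fun p hp => by
    rw [(hφ.contDiff_fderiv e).eq_zero hp, mul_zero], setIntegral_eq_of_eq_zero hΩ' hs
    fun p hp => by rw [hφ.eq_zero hp, mul_zero]] at h1

lemma IsWeakGradient.congr {Ω : Set (ℝ × ℝ)} {u v ux uz : ℝ × ℝ → ℂ}
    (h : IsWeakGradient Ω u ux uz) (huv : u =ᵐ[volume.restrict Ω] v) : IsWeakGradient Ω v ux uz :=
  ⟨h.memLp_x, h.memLp_z, h.weak_x.congr huv, h.weak_z.congr huv⟩

lemma IsWeakGradient.mono {Ω Ω' : Set (ℝ × ℝ)} (hΩ' : MeasurableSet Ω')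
    (hs : Ω ⊆ Ω') {u ux uz : ℝ × ℝ → ℂ} (h : IsWeakGradient Ω' u ux uz) :
    IsWeakGradient Ω u ux uz :=
  ⟨h.memLp_x.mono_measure (Measure.restrict_mono_set _ hs),
    h.memLp_z.mono_measure (Measure.restrict_mono_set _ hs),
    h.weak_x.mono hΩ' hs, h.weak_z.mono hΩ' hs⟩

lemma C1On.hasWeakDeriv {Ω K : Set (ℝ × ℝ)} {U Ux Uz : ℝ × ℝ → ℂ} (h : C1On K U Ux Uz)
    (hΩ : IsOpen Ω) (hΩK : Ω ⊆ K) :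
    HasWeakDeriv Ω (1, 0) U Ux ∧ HasWeakDeriv Ω (0, 1) U Uz := by
  have h1 : ∀ p ∈ Ω, HasFDerivAt U (gradMap (Ux p) (Uz p)) p := fun p hp =>
    h.hasFDerivAt (mem_of_superset (hΩ.mem_nhds hp) hΩK)
  constructor
  · simpa using hasWeakDeriv_of_hasFDerivAt hΩ (1, 0) h1
      (by simpa using h.continuousOn_x.mono hΩK)
  · simpa using hasWeakDeriv_of_hasFDerivAt hΩ (0, 1) h1
      (by simpa using h.continuousOn_z.mono hΩK)

/-! ### Equations in divergence form -/

/-- `A_x + B_z + Q = 0` weakly in `Ω`. -/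
def WeakDiv (Ω : Set (ℝ × ℝ)) (A B Q : ℝ × ℝ → ℂ) : Prop :=
  ∀ φ : ℝ × ℝ → ℂ, IsTestFunction Ω φ →
    ∫ p in Ω, (-(A p * fderiv ℝ φ p (1, 0) + B p * fderiv ℝ φ p (0, 1)) + Q p * φ p) = 0

/-- The zeroth order part of the equation, for a function `U` with `z`-derivative `Uz`. -/
def lowerOrder (κ : ℝ × ℝ → ℝ) (γ : ℂ) (U Uz : ℝ × ℝ → ℂ) (p : ℝ × ℝ) : ℂ :=
  2 * γ * Uz p + (γ ^ 2 + (κ p : ℂ) ^ 2) * U p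

lemma WeakDiv.mono {Ω Ω' : Set (ℝ × ℝ)} (hΩ' : MeasurableSet Ω') (hs : Ω ⊆ Ω')
    {A B Q : ℝ × ℝ → ℂ} (h : WeakDiv Ω' A B Q) : WeakDiv Ω A B Q := by
  intro φ hφ
  have h1 := h φ (hφ.mono hs)
  rwa [setIntegral_eq_of_eq_zero hΩ' hs fun p hp => by
    rw [(hφ.contDiff_fderiv (1, 0)).eq_zero hp, (hφ.contDiff_fderiv (0, 1)).eq_zero hp,
      hφ.eq_zero hp]; simp] at h1

lemma WeakDiv.congr {Ω : Set (ℝ × ℝ)} (hΩ : MeasurableSet Ω) {A B Q A' B' Q' : ℝ × ℝ → ℂ}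
    (h : WeakDiv Ω A B Q) (hA : EqOn A' A Ω) (hB : EqOn B' B Ω) (hQ : EqOn Q' Q Ω) :
    WeakDiv Ω A' B' Q' := by
  intro φ hφ
  rw [← h φ hφ]
  refine setIntegral_congr_fun hΩ fun p hp => ?_
  simp only [hA hp, hB hp, hQ hp]

/-- The weak formulation may be written with the classical gradient of a `C¹` representative. -/
lemma IsWeakSolution.weakDiv {Ω K : Set (ℝ × ℝ)} {κ : ℝ × ℝ → ℝ} {γ : ℂ} {u U Ux Uz : ℝ × ℝ → ℂ}
    (h : IsWeakSolution Ω κ γ u) (hu : u =ᵐ[volume.restrict Ω] U) (hU : C1On K U Ux Uz)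
    (hΩ : IsOpen Ω) (hΩK : Ω ⊆ K) : WeakDiv Ω Ux Uz (lowerOrder κ γ U Uz) := by
  obtain ⟨ux, uz, hg, hw⟩ := h
  have hg' := hg.congr hu
  obtain ⟨h1, h2⟩ := hU.hasWeakDeriv hΩ hΩK
  have hl : ∀ w : ℝ × ℝ → ℂ, MemLp w 2 (volume.restrict Ω) → LocallyIntegrableOn w Ω := fun w hw =>
    locallyIntegrableOn_of_locallyIntegrable_restrict (hw.locallyIntegrable (by norm_num))
  have e1 := hg'.weak_x.ae_eq hΩ h1 (hl _ hg.memLp_x)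
    ((hU.continuousOn_x.mono hΩK).locallyIntegrableOn hΩ.measurableSet)
  have e2 := hg'.weak_z.ae_eq hΩ h2 (hl _ hg.memLp_z)
    ((hU.continuousOn_z.mono hΩK).locallyIntegrableOn hΩ.measurableSet)
  intro φ hφ
  rw [← hw φ hφ]
  refine integral_congr_ae ?_
  filter_upwards [hu, e1, e2] with p h0 h1 h2
  rw [lowerOrder, h0, h1, h2]

/-- A classical solution is a weak solution. -/
lemma weakDiv_of_hasWeakDeriv {Ω : Set (ℝ × ℝ)} (hΩ : IsOpen Ω) {A B Q A' B' : ℝ × ℝ → ℂ}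
    (hA : HasWeakDeriv Ω (1, 0) A A') (hB : HasWeakDeriv Ω (0, 1) B B') (cA : ContinuousOn A Ω)
    (cB : ContinuousOn B Ω) (cA' : ContinuousOn A' Ω) (cB' : ContinuousOn B' Ω)
    (h : ∀ p ∈ Ω, A' p + B' p + Q p = 0) : WeakDiv Ω A B Q := by
  intro φ hφ
  have hx := hφ.contDiff_fderiv (1, 0)
  have hz := hφ.contDiff_fderiv (0, 1)
  have h1 : ∫ p in Ω, (A p * fderiv ℝ φ p (1, 0) + B p * fderiv ℝ φ p (0, 1) +
      (A' p * φ p + B' p * φ p)) = 0 := by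
    rw [integral_add, integral_add, integral_add, hA φ hφ, hB φ hφ]
    · ring
    · exact (hφ.integrable_mul hΩ cA').integrableOn
    · exact (hφ.integrable_mul hΩ cB').integrableOn
    · exact (hx.integrable_mul hΩ cA).integrableOn
    · exact (hz.integrable_mul hΩ cB).integrableOn
    · exact ((hx.integrable_mul hΩ cA).add (hz.integrable_mul hΩ cB)).integrableOn
    · exact ((hφ.integrable_mul hΩ cA').add (hφ.integrable_mul hΩ cB')).integrableOn
  rw [← neg_eq_zero, ← integral_neg, ← h1]
  refine setIntegral_congr_fun hΩ.measurableSet fun p hp => ?_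
  linear_combination (-(φ p)) * h p hp

/-! ### Flux identities on rectangles -/

lemma continuousOn_integral_of_continuousOn_prod {a b c d : ℝ} {f : ℝ × ℝ → ℂ}
    (hf : ContinuousOn f (Icc a b ×ˢ Icc c d)) :
    ContinuousOn (fun x => ∫ z in Ioo c d, f (x, z)) (Icc a b) := by
  obtain ⟨M, hM⟩ := (isCompact_Icc.prod isCompact_Icc).exists_bound_of_continuousOn hf
  refine continuousOn_of_dominated (bound := fun _ => M) ?_ ?_ (by simp) ?_
  · intro x hx
    refine ContinuousOn.aestronglyMeasurable ?_ measurableSet_Ioo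
    exact hf.comp (by fun_prop) fun z hz => ⟨hx, Ioo_subset_Icc_self hz⟩
  · intro x hx
    exact (ae_restrict_iff' measurableSet_Ioo).2
      (Eventually.of_forall fun z hz => hM _ ⟨hx, Ioo_subset_Icc_self hz⟩)
  · refine (ae_restrict_iff' measurableSet_Ioo).2 (Eventually.of_forall fun z hz => ?_)
    exact hf.comp (by fun_prop) fun x hx => ⟨hx, Ioo_subset_Icc_self hz⟩

lemma integrableOn_rect_of_continuousOn {a b c d : ℝ} {f : ℝ × ℝ → ℂ}
    (hf : ContinuousOn f (Icc a b ×ˢ Icc c d)) : IntegrableOn f (Ioo a b ×ˢ Ioo c d) :=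
  (hf.integrableOn_compact (isCompact_Icc.prod isCompact_Icc)).mono_set
    (prod_mono Ioo_subset_Icc_self Ioo_subset_Icc_self)

lemma fderiv_mul_ofReal_fst {φ : ℝ × ℝ → ℂ} (hφ : ContDiff ℝ ∞ φ) {η : ℝ → ℝ}
    (hη : ContDiff ℝ ∞ η) (p : ℝ × ℝ) :
    fderiv ℝ (fun q : ℝ × ℝ => φ q * (η q.1 : ℂ)) p =
      gradMap (fderiv ℝ φ p (1, 0) * η p.1 + φ p * ((deriv η p.1 : ℝ) : ℂ))
        (fderiv ℝ φ p (0, 1) * η p.1) := by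
  have h1 : HasFDerivAt φ (fderiv ℝ φ p) p := ((hφ.differentiable (by simp)) p).hasFDerivAt
  have h2 : HasDerivAt η (deriv η p.1) p.1 := ((hη.differentiable (by simp)) p.1).hasDerivAt
  have h3 : HasFDerivAt (fun q : ℝ × ℝ => (η q.1 : ℂ)) (gradMap ((deriv η p.1 : ℝ) : ℂ) 0) p := by
    have h := h2.ofReal_comp.hasFDerivAt.comp p
      (hasFDerivAt_fst (𝕜 := ℝ) (E := ℝ) (F := ℝ) (p := p))
    rw [eq_gradMap (ContinuousLinearMap.comp _ _)] at h
    simpa [Function.comp_def] using h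
  have h4 := (h1.mul h3).fderiv
  rw [eq_gradMap (fderiv ℝ (fun q : ℝ × ℝ => φ q * (η q.1 : ℂ)) p)]
  have h5 : fderiv ℝ (fun q : ℝ × ℝ => φ q * (η q.1 : ℂ)) p = _ := h4
  rw [h5]
  simp [mul_comm, add_comm]

lemma integrableOn_flux {a b c d : ℝ} {A B Q : ℝ × ℝ → ℂ}
    (hA : ContinuousOn A (Icc a b ×ˢ Icc c d)) (hB : ContinuousOn B (Icc a b ×ˢ Icc c d))
    (hQ : IntegrableOn Q (Ioo a b ×ˢ Ioo c d)) {φ : ℝ × ℝ → ℂ} (hφ : ContDiff ℝ ∞ φ) :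
    IntegrableOn (fun p => A p * fderiv ℝ φ p (1, 0) + B p * fderiv ℝ φ p (0, 1) - Q p * φ p)
      (Ioo a b ×ˢ Ioo c d) := by
  have hφ' : ∀ e : ℝ × ℝ, Continuous fun p => fderiv ℝ φ p e := fun e =>
    (hφ.continuous_fderiv (by simp)).clm_apply continuous_const
  refine IntegrableOn.sub (integrableOn_rect_of_continuousOn
    ((hA.mul (hφ' _).continuousOn).add (hB.mul (hφ' _).continuousOn))) ?_
  exact hQ.mul_continuousOn_of_subset (K := Icc a b ×ˢ Icc c d) hφ.continuous.continuousOn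
    (measurableSet_Ioo.prod measurableSet_Ioo) (isCompact_Icc.prod isCompact_Icc)
    (prod_mono Ioo_subset_Icc_self Ioo_subset_Icc_self)

/-- Flux identity in the direction `x`. -/
theorem WeakDiv.flux_x {a b c d : ℝ} (hab : a < b) {A B Q : ℝ × ℝ → ℂ}
    (h : WeakDiv (Ioo a b ×ˢ Ioo c d) A B Q) (hA : ContinuousOn A (Icc a b ×ˢ Icc c d))
    (hB : ContinuousOn B (Icc a b ×ˢ Icc c d)) (hQ : IntegrableOn Q (Ioo a b ×ˢ Ioo c d))
    {φ : ℝ × ℝ → ℂ} (hφ : ContDiff ℝ ∞ φ) (hφs : tsupport φ ⊆ univ ×ˢ Ioo c d) :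
    ∫ p in Ioo a b ×ˢ Ioo c d,
      (A p * fderiv ℝ φ p (1, 0) + B p * fderiv ℝ φ p (0, 1) - Q p * φ p) =
    (∫ z in Ioo c d, A (b, z) * φ (b, z)) - ∫ z in Ioo c d, A (a, z) * φ (a, z) := by
  set R : Set (ℝ × ℝ) := Ioo a b ×ˢ Ioo c d with hR
  have hRm : MeasurableSet R := measurableSet_Ioo.prod measurableSet_Ioo
  set G : ℝ × ℝ → ℂ := fun p =>
    A p * fderiv ℝ φ p (1, 0) + B p * fderiv ℝ φ p (0, 1) - Q p * φ p with hG
  have hGi : IntegrableOn G R := integrableOn_flux hA hB hQ hφ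
  have hAφ : ContinuousOn (fun p => A p * φ p) (Icc a b ×ˢ Icc c d) :=
    hA.mul hφ.continuous.continuousOn
  have hGi' : Integrable G ((volume.restrict (Ioo a b)).prod (volume.restrict (Ioo c d))) := by
    rw [Measure.prod_restrict]; exact hGi
  have hfub : ∀ f : ℝ × ℝ → ℂ, IntegrableOn f R →
      ∫ p in R, f p = ∫ x in Ioo a b, ∫ z in Ioo c d, f (x, z) := fun f hf => by
    exact setIntegral_prod f hf
  rw [hfub G hGi]
  symm
  -- The support of `φ` may reach the sides `x = a` and `x = b`. Testing with `φ(x, z) η(x)` shows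
  -- that `∫ G dz` is the weak `x`-derivative of `∫ A φ dz`, and the one-dimensional theorem
  -- recovers the boundary values.
  refine sub_eq_integral_of_weak_deriv (F := fun x => ∫ z in Ioo c d, A (x, z) * φ (x, z)) hab
    (continuousOn_integral_of_continuousOn_prod hAφ) hGi'.integral_prod_left ?_
  intro η hη hηc hηs
  have hηR : Continuous fun p : ℝ × ℝ => (η p.1 : ℂ) :=
    Complex.continuous_ofReal.comp (hη.continuous.comp continuous_fst)
  have hη'R : Continuous fun p : ℝ × ℝ => ((deriv η p.1 : ℝ) : ℂ) :=
    Complex.continuous_ofReal.comp ((hη.continuous_deriv (by simp)).comp continuous_fst)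
  have ht : IsTestFunction R fun p => φ p * (η p.1 : ℂ) := by
    have hs : tsupport (fun p : ℝ × ℝ => φ p * (η p.1 : ℂ)) ⊆
        Prod.fst ⁻¹' tsupport η ∩ tsupport φ := by
      refine closure_minimal (fun p hp => ?_)
        (((isClosed_tsupport η).preimage continuous_fst).inter (isClosed_tsupport φ))
      refine ⟨subset_tsupport η fun h0 => hp ?_, subset_tsupport φ fun h0 => hp ?_⟩ <;> simp [h0]
    have hsR : tsupport (fun p : ℝ × ℝ => φ p * (η p.1 : ℂ)) ⊆ R :=
      hs.trans fun p hp => ⟨hηs hp.1, (hφs hp.2).2⟩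
    refine ⟨hφ.mul (Complex.ofRealCLM.contDiff.comp (hη.comp contDiff_fst)), ?_, hsR⟩
    exact (isCompact_Icc.prod isCompact_Icc).of_isClosed_subset (isClosed_tsupport _)
      (hsR.trans (prod_mono Ioo_subset_Icc_self Ioo_subset_Icc_self))
  have h1 := h _ ht
  have hi1 : IntegrableOn (fun p => A p * φ p * ((deriv η p.1 : ℝ) : ℂ)) R :=
    integrableOn_rect_of_continuousOn (hAφ.mul hη'R.continuousOn)
  have hi2 : IntegrableOn (fun p => G p * (η p.1 : ℂ)) R :=
    hGi.mul_continuousOn_of_subset (K := Icc a b ×ˢ Icc c d) hηR.continuousOn hRm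
      (isCompact_Icc.prod isCompact_Icc) (prod_mono Ioo_subset_Icc_self Ioo_subset_Icc_self)
  have h2 : (∫ p in R, A p * φ p * ((deriv η p.1 : ℝ) : ℂ)) + ∫ p in R, G p * (η p.1 : ℂ) = 0 := by
    rw [← integral_add hi1 hi2, ← neg_eq_zero, ← integral_neg, ← h1]
    refine setIntegral_congr_fun hRm fun p _ => ?_
    simp only [fderiv_mul_ofReal_fst hφ hη, gradMap_x, gradMap_z, hG]
    ring
  rw [hfub _ hi1, hfub _ hi2] at h2
  simp only [integral_mul_const] at h2
  exact eq_neg_of_add_eq_zero_left h2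

lemma fderiv_comp_swap {φ : ℝ × ℝ → ℂ} (hφ : ContDiff ℝ ∞ φ) (p e : ℝ × ℝ) :
    fderiv ℝ (fun q : ℝ × ℝ => φ q.swap) p e = fderiv ℝ φ p.swap e.swap := by
  have h1 : HasFDerivAt φ (fderiv ℝ φ p.swap) p.swap :=
    ((hφ.differentiable (by simp)) p.swap).hasFDerivAt
  have h2 : HasFDerivAt (fun q : ℝ × ℝ => q.swap) ((ContinuousLinearMap.snd ℝ ℝ ℝ).prod
      (ContinuousLinearMap.fst ℝ ℝ ℝ)) p := hasFDerivAt_snd.prodMk hasFDerivAt_fst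
  have h3 : fderiv ℝ (fun q : ℝ × ℝ => φ q.swap) p = _ := (h1.comp p h2).fderiv
  rw [h3]
  rfl

lemma tsupport_comp_swap (φ : ℝ × ℝ → ℂ) :
    tsupport (fun q : ℝ × ℝ => φ q.swap) = Prod.swap ⁻¹' tsupport φ :=
  tsupport_comp_eq_preimage φ (Homeomorph.prodComm ℝ ℝ)

lemma WeakDiv.swap {s t : Set ℝ} {A B Q : ℝ × ℝ → ℂ} (h : WeakDiv (s ×ˢ t) A B Q) :
    WeakDiv (t ×ˢ s) (fun p => B p.swap) (fun p => A p.swap) (fun p => Q p.swap) := by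
  intro φ hφ
  have ht : IsTestFunction (s ×ˢ t) fun p => φ p.swap :=
    ⟨hφ.smooth.comp (contDiff_snd.prodMk contDiff_fst),
      hφ.compact.comp_homeomorph (Homeomorph.prodComm ℝ ℝ), by
      rw [tsupport_comp_swap]
      exact fun p hp => (hφ.support hp).symm⟩
  have h1 := h _ ht
  rw [Measure.volume_eq_prod, ← setIntegral_prod_swap] at h1
  rw [Measure.volume_eq_prod, ← h1]
  congr 1
  ext p
  simp only [fderiv_comp_swap hφ.smooth, Prod.swap_swap, Prod.swap_prod_mk]
  ring

/-- Flux identity in the direction `z`. -/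
theorem WeakDiv.flux_z {a b c d : ℝ} (hcd : c < d) {A B Q : ℝ × ℝ → ℂ}
    (h : WeakDiv (Ioo a b ×ˢ Ioo c d) A B Q) (hA : ContinuousOn A (Icc a b ×ˢ Icc c d))
    (hB : ContinuousOn B (Icc a b ×ˢ Icc c d)) (hQ : IntegrableOn Q (Ioo a b ×ˢ Ioo c d))
    {φ : ℝ × ℝ → ℂ} (hφ : ContDiff ℝ ∞ φ) (hφs : tsupport φ ⊆ Ioo a b ×ˢ univ) :
    ∫ p in Ioo a b ×ˢ Ioo c d,
      (A p * fderiv ℝ φ p (1, 0) + B p * fderiv ℝ φ p (0, 1) - Q p * φ p) =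
    (∫ x in Ioo a b, B (x, d) * φ (x, d)) - ∫ x in Ioo a b, B (x, c) * φ (x, c) := by
  have hsw : MapsTo Prod.swap (Icc c d ×ˢ Icc a b) (Icc a b ×ˢ Icc c d) := fun p hp => hp.symm
  have hQ' : IntegrableOn (fun p : ℝ × ℝ => Q p.swap) (Ioo c d ×ˢ Ioo a b) := by
    have h1 : Integrable Q ((volume.restrict (Ioo a b)).prod (volume.restrict (Ioo c d))) := by
      rw [Measure.prod_restrict]; exact hQ
    have h2 := h1.swap
    rw [Measure.prod_restrict] at h2
    exact h2
  have h1 := h.swap.flux_x hcd (hB.comp continuous_swap.continuousOn hsw)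
    (hA.comp continuous_swap.continuousOn hsw) hQ'
    (φ := fun p => φ p.swap) (hφ.comp (contDiff_snd.prodMk contDiff_fst)) (by
      rw [tsupport_comp_swap]
      exact fun p hp => ⟨trivial, (hφs hp).1⟩)
  simp only [Prod.swap_prod_mk] at h1
  rw [← h1, Measure.volume_eq_prod, ← setIntegral_prod_swap]
  congr 1
  ext p
  simp only [fderiv_comp_swap hφ, Prod.swap_prod_mk]
  ring

/-! ### Series of exponentially decaying modes -/

/-- Symbols of the form `-2π|k| + O(1)` with negative real part. -/
structure DecayingSymbol (s : ℤ → ℂ) (c C : ℝ) : Prop where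
  pos : 0 < c
  re_le : ∀ k : ℤ, (s k).re ≤ -(c * (1 + |(k : ℝ)|))
  norm_le : ∀ k : ℤ, ‖s k + 2 * Real.pi * |(k : ℝ)|‖ ≤ C

/-- Sequences of subexponential growth. -/
def Tempered (a : ℤ → ℂ) : Prop :=
  ∀ δ : ℝ, 0 < δ → Summable fun k : ℤ => ‖a k‖ * Real.exp (-(δ * (1 + |(k : ℝ)|)))

/-- The series `∑ₖ a_k exp(s_k t + 2πikz)`. -/
def modeSum (s a : ℤ → ℂ) (p : ℝ × ℝ) : ℂ :=
  ∑' k : ℤ, a k * Complex.exp (s k * p.1 + 2 * Real.pi * Complex.I * k * p.2)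

lemma summable_exp_neg_abs {δ : ℝ} (hδ : 0 < δ) :
    Summable fun k : ℤ => Real.exp (-(δ * (1 + |(k : ℝ)|))) := by
  have h : Summable fun n : ℕ => Real.exp (-(δ * (1 + |(n : ℝ)|))) := by
    have h1 : Summable fun n : ℕ => Real.exp (-δ) * Real.exp (-δ) ^ n :=
      (summable_geometric_of_lt_one (Real.exp_pos _).le (by simpa using hδ)).mul_left _
    refine h1.congr fun n => ?_
    rw [← Real.exp_nat_mul, ← Real.exp_add, abs_of_nonneg (Nat.cast_nonneg n)]
    congr 1
    ring
  refine Summable.of_nat_of_neg ?_ ?_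
  · exact_mod_cast h
  · refine h.congr fun n => ?_
    simp

lemma tempered_of_bounded {a : ℤ → ℂ} {M : ℝ} (h : ∀ k, ‖a k‖ ≤ M) : Tempered a := fun δ hδ => by
  refine Summable.of_nonneg_of_le (fun k => by positivity) (fun k => ?_)
    ((summable_exp_neg_abs hδ).mul_left M)
  exact mul_le_mul_of_nonneg_right (h k) (Real.exp_pos _).le

/-- Half of the exponential weight absorbs the linear factor. This closes the class under
multiplication by `s_k` and by `freq k`, that is, under termwise differentiation of `modeSum`. -/
lemma Tempered.mul {a m : ℤ → ℂ} (ha : Tempered a) {M : ℝ}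
    (hm : ∀ k : ℤ, ‖m k‖ ≤ M * (1 + |(k : ℝ)|)) : Tempered fun k => m k * a k := fun δ hδ => by
  have hM : 0 ≤ M := by
    have := (norm_nonneg _).trans (hm 0)
    simpa using this
  refine Summable.of_nonneg_of_le (fun k => by positivity) (fun k => ?_)
    ((ha (δ / 2) (half_pos hδ)).mul_left (M * (2 / δ)))
  have h1 : (1 + |(k : ℝ)|) ≤ 2 / δ * Real.exp (δ / 2 * (1 + |(k : ℝ)|)) := by
    have h2 := Real.add_one_le_exp (δ / 2 * (1 + |(k : ℝ)|))
    calc (1 + |(k : ℝ)|) = 2 / δ * (δ / 2 * (1 + |(k : ℝ)|)) := by field_simp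
      _ ≤ _ := mul_le_mul_of_nonneg_left (by linarith) (by positivity)
  have h3 : Real.exp (δ / 2 * (1 + |(k : ℝ)|)) * Real.exp (-(δ * (1 + |(k : ℝ)|))) =
      Real.exp (-(δ / 2 * (1 + |(k : ℝ)|))) := by
    rw [← Real.exp_add]; congr 1; ring
  rw [norm_mul]
  calc ‖m k‖ * ‖a k‖ * Real.exp (-(δ * (1 + |(k : ℝ)|)))
      ≤ (M * (2 / δ * Real.exp (δ / 2 * (1 + |(k : ℝ)|)))) * ‖a k‖ *
          Real.exp (-(δ * (1 + |(k : ℝ)|))) := by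
        gcongr
        exact (hm k).trans (mul_le_mul_of_nonneg_left h1 hM)
    _ = M * (2 / δ) * (‖a k‖ * (Real.exp (δ / 2 * (1 + |(k : ℝ)|)) *
          Real.exp (-(δ * (1 + |(k : ℝ)|))))) := by ring
    _ = _ := by rw [h3]

/-- The multiplier of `∂_z`. -/
def freq (k : ℤ) : ℂ := 2 * Real.pi * Complex.I * k

lemma norm_freq (k : ℤ) : ‖freq k‖ = 2 * Real.pi * |(k : ℝ)| := by
  simp [freq, abs_of_pos Real.pi_pos]

lemma norm_freq_le (k : ℤ) : ‖freq k‖ ≤ 2 * Real.pi * (1 + |(k : ℝ)|) := by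
  rw [norm_freq]
  have := Real.pi_pos
  nlinarith

lemma norm_mode (s a : ℂ) (k : ℤ) (t z : ℝ) :
    ‖a * Complex.exp (s * t + 2 * Real.pi * Complex.I * k * z)‖ = ‖a‖ * Real.exp (s.re * t) := by
  rw [norm_mul, Complex.norm_exp]
  simp

namespace DecayingSymbol

variable {s : ℤ → ℂ} {c C : ℝ}

lemma norm_symbol_le (hs : DecayingSymbol s c C) (k : ℤ) :
    ‖s k‖ ≤ (C + 2 * Real.pi) * (1 + |(k : ℝ)|) := by
  have h1 := hs.norm_le k
  have hC : 0 ≤ C := (norm_nonneg _).trans h1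
  have h2 : ‖s k‖ ≤ C + 2 * Real.pi * |(k : ℝ)| := by
    calc ‖s k‖ = ‖(s k + 2 * Real.pi * |(k : ℝ)|) - ((2 * Real.pi * |(k : ℝ)| : ℝ) : ℂ)‖ := by
          push_cast; congr 1; ring
      _ ≤ ‖s k + 2 * Real.pi * |(k : ℝ)|‖ + ‖((2 * Real.pi * |(k : ℝ)| : ℝ) : ℂ)‖ := norm_sub_le _ _
      _ ≤ _ := by
        rw [Complex.norm_real, Real.norm_of_nonneg (by positivity)]
        linarith
  have := Real.pi_pos
  nlinarith [abs_nonneg (k : ℝ), mul_nonneg hC (abs_nonneg (k : ℝ))]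

lemma exp_re_le (hs : DecayingSymbol s c C) {δ t : ℝ} (hδ : 0 ≤ δ) (ht : δ ≤ t) (k : ℤ) :
    Real.exp ((s k).re * t) ≤ Real.exp (-(c * δ * (1 + |(k : ℝ)|))) := by
  refine Real.exp_le_exp.2 ?_
  have h1 := hs.re_le k
  have h2 : 0 ≤ c * (1 + |(k : ℝ)|) := mul_nonneg hs.pos.le (by positivity)
  nlinarith [mul_le_mul_of_nonneg_right h1 (hδ.trans ht), mul_le_mul_of_nonneg_left ht h2]

lemma summable_mode (hs : DecayingSymbol s c C) {a : ℤ → ℂ} (ha : Tempered a) {p : ℝ × ℝ}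
    (hp : 0 < p.1) : Summable fun k : ℤ =>
      ‖a k * Complex.exp (s k * p.1 + 2 * Real.pi * Complex.I * k * p.2)‖ := by
  refine Summable.of_nonneg_of_le (fun _ => norm_nonneg _) (fun k => ?_)
    (ha (c * p.1) (mul_pos hs.pos hp))
  rw [norm_mode]
  exact mul_le_mul_of_nonneg_left (hs.exp_re_le hp.le le_rfl k) (norm_nonneg _)

/-- On the half-plane `t > p.1 / 2` the differentiated terms are dominated by a summable sequence
independent of the point, so the series may be differentiated termwise. -/
lemma hasFDerivAt_modeSum (hs : DecayingSymbol s c C) {a : ℤ → ℂ} (ha : Tempered a) {p : ℝ × ℝ}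
    (hp : 0 < p.1) :
    HasFDerivAt (modeSum s a) (gradMap (modeSum s (fun k => s k * a k) p)
      (modeSum s (fun k => freq k * a k) p)) p := by
  have has := ha.mul hs.norm_symbol_le
  have haf := ha.mul norm_freq_le
  set D : Set (ℝ × ℝ) := Ioi (p.1 / 2) ×ˢ univ with hD
  have hDo : IsOpen D := isOpen_Ioi.prod isOpen_univ
  have hDc : IsPreconnected D := ((convex_Ioi _).prod convex_univ).isPreconnected
  have hpD : p ∈ D := ⟨half_lt_self hp, trivial⟩
  have hδ : 0 < c * (p.1 / 2) := mul_pos hs.pos (half_pos hp)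
  have key := hasFDerivAt_tsum_of_isPreconnected
    (f := fun (k : ℤ) (q : ℝ × ℝ) =>
      a k * Complex.exp (s k * q.1 + 2 * Real.pi * Complex.I * k * q.2))
    (f' := fun (k : ℤ) (q : ℝ × ℝ) =>
      gradMap (s k * a k * Complex.exp (s k * q.1 + 2 * Real.pi * Complex.I * k * q.2))
        (freq k * a k * Complex.exp (s k * q.1 + 2 * Real.pi * Complex.I * k * q.2)))
    (u := fun k : ℤ => (‖s k * a k‖ * Real.exp (-(c * (p.1 / 2) * (1 + |(k : ℝ)|)))) *
        ‖gradMap 1 0‖ + (‖freq k * a k‖ * Real.exp (-(c * (p.1 / 2) * (1 + |(k : ℝ)|)))) *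
        ‖gradMap 0 1‖)
    (((has _ hδ).mul_right _).add ((haf _ hδ).mul_right _)) hDo hDc ?_ ?_ hpD
    (hs.summable_mode ha hp).of_norm hpD
  · have h1 : (∑' k : ℤ, gradMap
        (s k * a k * Complex.exp (s k * p.1 + 2 * Real.pi * Complex.I * k * p.2))
        (freq k * a k * Complex.exp (s k * p.1 + 2 * Real.pi * Complex.I * k * p.2))) =
        gradMap (modeSum s (fun k => s k * a k) p) (modeSum s (fun k => freq k * a k) p) := by
      rw [funext fun k => gradMap_eq_smul
        (s k * a k * Complex.exp (s k * p.1 + 2 * Real.pi * Complex.I * k * p.2)) _,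
        gradMap_eq_smul (modeSum _ _ _)]
      have s1 := (hs.summable_mode has hp).of_norm
      have s2 := (hs.summable_mode haf hp).of_norm
      rw [Summable.tsum_add (s1.smul_const _) (s2.smul_const _), s1.tsum_smul_const,
        s2.tsum_smul_const]
      rfl
    rw [← h1]
    exact key
  · intro k q _
    have h1 : HasFDerivAt
        (fun q : ℝ × ℝ => s k * (q.1 : ℂ) + 2 * Real.pi * Complex.I * k * (q.2 : ℂ)) (gradMap (s k) (freq k)) q := by
      have h2 : (fun q : ℝ × ℝ => s k * (q.1 : ℂ) + 2 * Real.pi * Complex.I * k * (q.2 : ℂ)) =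
          gradMap (s k) (freq k) := by
        ext q
        rw [gradMap_apply, freq]
        ring
      rw [h2]
      exact (gradMap (s k) (freq k)).hasFDerivAt
    set E := Complex.exp (s k * (q.1 : ℂ) + 2 * Real.pi * Complex.I * k * (q.2 : ℂ)) with hE
    have h3 := h1.cexp.const_mul (a k)
    have h4 : gradMap (s k * a k * E) (freq k * a k * E) = a k • E • gradMap (s k) (freq k) := by
      rw [eq_gradMap (a k • E • gradMap (s k) (freq k))]
      simp only [_root_.smul_apply, gradMap_x, gradMap_z, smul_eq_mul]
      rw [show s k * a k * E = a k * (E * s k) by ring,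
        show freq k * a k * E = a k * (E * freq k) by ring]
    rw [h4]
    exact h3
  · intro k q hq
    rw [gradMap_eq_smul]
    refine (norm_add_le _ _).trans ?_
    rw [norm_smul, norm_smul, norm_mode, norm_mode]
    have h1 := hs.exp_re_le (half_pos hp).le (le_of_lt hq.1) k
    gcongr

lemma c1On_modeSum (hs : DecayingSymbol s c C) {a : ℤ → ℂ} (ha : Tempered a) :
    C1On (Ioi 0 ×ˢ univ) (modeSum s a) (modeSum s fun k => s k * a k)
      (modeSum s fun k => freq k * a k) := by
  have has := ha.mul hs.norm_symbol_le
  have haf := ha.mul norm_freq_le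
  exact ⟨fun p hp => (hs.hasFDerivAt_modeSum ha hp.1).hasFDerivWithinAt,
    fun p hp => (hs.hasFDerivAt_modeSum has hp.1).continuousAt.continuousWithinAt,
    fun p hp => (hs.hasFDerivAt_modeSum haf hp.1).continuousAt.continuousWithinAt⟩

/-- The restriction to `t ≥ 1` is essential: tempered coefficients give no control as `t` tends to
zero. -/
lemma exists_norm_modeSum_le (hs : DecayingSymbol s c C) {a : ℤ → ℂ} (ha : Tempered a) :
    ∃ M : ℝ, ∀ p : ℝ × ℝ, 1 ≤ p.1 → ‖modeSum s a p‖ ≤ M * Real.exp (-(c / 2 * p.1)) := by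
  have hsum := ha (c / 2) (half_pos hs.pos)
  refine ⟨∑' k : ℤ, ‖a k‖ * Real.exp (-(c / 2 * (1 + |(k : ℝ)|))), fun p hp => ?_⟩
  rw [← tsum_mul_right]
  refine tsum_of_norm_bounded (hsum.mul_right _).hasSum fun k => ?_
  rw [norm_mode, mul_assoc, ← Real.exp_add]
  gcongr
  have h1 := hs.re_le k
  have h2 := abs_nonneg (k : ℝ)
  -- Both `1 + |k|` and `t` are at least one, so their product dominates their mean. Half of the
  -- decay sums the series in `k` and the other half remains as decay in `t`.
  have h3 : 1 + |(k : ℝ)| + p.1 ≤ 2 * ((1 + |(k : ℝ)|) * p.1) := by nlinarith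
  nlinarith [mul_le_mul_of_nonneg_right h1 (by linarith : 0 ≤ p.1),
    mul_le_mul_of_nonneg_left h3 hs.pos.le]

end DecayingSymbol

lemma modeSum_periodic (s a : ℤ → ℂ) (t z : ℝ) : modeSum s a (t, z + 1) = modeSum s a (t, z) := by
  unfold modeSum
  congr 1
  ext k
  have h : s k * (t : ℂ) + 2 * Real.pi * Complex.I * k * ((z + 1 : ℝ) : ℂ) =
      s k * t + 2 * Real.pi * Complex.I * k * z + k * (2 * Real.pi * Complex.I) := by
    push_cast; ring
  simp only [h]
  rw [Complex.exp_add _ ((k : ℂ) * _), Complex.exp_int_mul_two_pi_mul_I, mul_one]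

lemma decayingSymbol_dtnSymbol (κinf : ℝ) {γ : ℂ} (h : ∀ k, (beta κinf γ k).im ≠ 0) :
    ∃ c C : ℝ, DecayingSymbol (dtnSymbol κinf γ) c C := by
  obtain ⟨c, hc, -, hc'⟩ := exists_dtnSymbol_re_le κinf h
  obtain ⟨C, hC⟩ := exists_norm_dtnSymbol_add_le κinf h
  exact ⟨c, C, hc, hc', hC⟩

/-! ### Fourier coefficients on `[0, 1]` -/

/-- The Fourier coefficients of a function on `(0, 1)`. -/
def coeff (g : ℝ → ℂ) (k : ℤ) : ℂ :=
  ∫ z in Ioo (0 : ℝ) 1, g z * Complex.exp (-(2 * Real.pi * Complex.I * k * z))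

lemma fourier_neg_coe (k : ℤ) (z : ℝ) :
    fourier (-k) (z : AddCircle (1 : ℝ)) = Complex.exp (-(2 * Real.pi * Complex.I * k * z)) := by
  rw [fourier_coe_apply]
  congr 1
  push_cast
  ring

lemma fourierCoeffOn_eq_coeff (g : ℝ → ℂ) (k : ℤ) :
    fourierCoeffOn (zero_lt_one' ℝ) g k = coeff g k := by
  rw [fourierCoeffOn_eq_integral, intervalIntegral.integral_of_le zero_le_one,
    integral_Ioc_eq_integral_Ioo, coeff]
  simp only [sub_zero, div_one, one_smul]
  congr 1
  ext z
  rw [fourier_coe_apply, smul_eq_mul, mul_comm]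
  congr 2
  push_cast
  ring

lemma fourierCoeff_eq_coeff (f : AddCircle (1 : ℝ) → ℂ) (k : ℤ) :
    fourierCoeff f k = coeff (fun z => f z) k := by
  rw [fourierCoeff_eq_intervalIntegral f k 0, zero_add,
    intervalIntegral.integral_of_le zero_le_one, integral_Ioc_eq_integral_Ioo, coeff]
  simp only [div_one, one_smul]
  congr 1
  ext z
  rw [fourier_neg_coe, smul_eq_mul, mul_comm]

lemma norm_exp_neg_freq (k : ℤ) (z : ℝ) :
    ‖Complex.exp (-(2 * Real.pi * Complex.I * k * z))‖ = 1 := by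
  rw [Complex.norm_exp]
  simp

lemma continuous_exp_neg_freq (k : ℤ) :
    Continuous fun z : ℝ => Complex.exp (-(2 * Real.pi * Complex.I * k * z)) := by
  fun_prop

lemma norm_coeff_le (g : ℝ → ℂ) (k : ℤ) : ‖coeff g k‖ ≤ ∫ z in Ioo (0 : ℝ) 1, ‖g z‖ := by
  refine (norm_integral_le_integral_norm _).trans_eq ?_
  simp only [norm_mul, norm_exp_neg_freq, mul_one]

lemma tempered_coeff (g : ℝ → ℂ) : Tempered (coeff g) := tempered_of_bounded (norm_coeff_le g)

lemma summable_sq_coeff {g : ℝ → ℂ} (hg : MemLp g 2 (volume.restrict (Ioo (0 : ℝ) 1))) :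
    Summable fun k => ‖coeff g k‖ ^ 2 := by
  rw [restrict_Ioo_eq_restrict_Ioc] at hg
  have := (hasSum_sq_fourierCoeffOn (zero_lt_one' ℝ) hg).summable
  simpa only [fourierCoeffOn_eq_coeff] using this

/-! ### The Poisson kernel of the half-plane, periodized -/

/-- The comparison symbol `-2π(1 + |k|)`. -/
def poissonSymbol (k : ℤ) : ℂ := ((-(2 * Real.pi * (1 + |(k : ℝ)|)) : ℝ) : ℂ)

/-- The shift from `|k|` to `1 + |k|` makes the real part negative at `k = 0` too; in the kernel it
is only a factor `exp(-2πt)`. -/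
lemma decayingSymbol_poissonSymbol :
    DecayingSymbol poissonSymbol (2 * Real.pi) (2 * Real.pi) := by
  have hpi := Real.pi_pos
  refine ⟨by positivity, fun k => by simp [poissonSymbol], fun k => ?_⟩
  have h : poissonSymbol k + 2 * Real.pi * |(k : ℝ)| = ((-(2 * Real.pi) : ℝ) : ℂ) := by
    rw [poissonSymbol]; push_cast; ring
  rw [h, Complex.norm_real, norm_neg, Real.norm_of_nonneg (by positivity)]

/-- The kernel of the operator with multipliers `exp(t s_k)` for the comparison symbol. -/
def poissonKer (t y : ℝ) : ℂ := modeSum poissonSymbol (fun _ => 1) (t, y)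

lemma tempered_one : Tempered fun _ => 1 := tempered_of_bounded (M := 1) (by simp)

/-- The positivity of the Poisson kernel: two geometric series sum to `A (1 - |w|²) / |1 - w|²` with
`|w| < 1` and `A > 0`. -/
lemma norm_poissonKer {t : ℝ} (ht : 0 < t) (y : ℝ) : (‖poissonKer t y‖ : ℂ) = poissonKer t y := by
  set w : ℂ := Complex.exp (-(2 * Real.pi * t : ℝ) + 2 * Real.pi * Complex.I * y) with hw
  set w' : ℂ := Complex.exp (-(2 * Real.pi * t : ℝ) - 2 * Real.pi * Complex.I * y) with hw'
  have hconj : w' = (starRingEnd ℂ) w := by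
    rw [hw, ← Complex.exp_conj, hw']
    have h2 : (starRingEnd ℂ) 2 = 2 := map_ofNat _ 2
    congr 1
    simp [h2]
    ring
  have hnorm : ‖w‖ < 1 := by
    rw [hw, Complex.norm_exp]
    simp
    positivity
  have hnorm' : ‖w'‖ < 1 := by rw [hconj, RCLike.norm_conj]; exact hnorm
  set A : ℝ := Real.exp (-(2 * Real.pi * t)) with hA
  set f : ℤ → ℂ := fun k =>
    1 * Complex.exp (poissonSymbol k * t + 2 * Real.pi * Complex.I * k * y) with hf
  have h1 : HasSum (fun n : ℕ => f n) (A * (1 - w)⁻¹) := by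
    refine ((hasSum_geometric_of_norm_lt_one hnorm).mul_left (A : ℂ)).congr_fun ?_
    intro n
    rw [hf, hA, hw, ← Complex.exp_nat_mul, Complex.ofReal_exp, ← Complex.exp_add]
    simp only [poissonSymbol, Int.cast_natCast, Nat.abs_cast, one_mul]
    congr 1
    push_cast
    ring
  -- The negative frequencies start at `-1`, since `k = 0` already belongs to the first series; this
  -- produces the extra factor `w'`.
  have h2 : HasSum (fun n : ℕ => f (-(n + 1 : ℤ))) (A * w' * (1 - w')⁻¹) := by
    refine ((hasSum_geometric_of_norm_lt_one hnorm').mul_left (A * w' : ℂ)).congr_fun ?_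
    intro n
    have h3 : |((-(n + 1 : ℤ) : ℤ) : ℝ)| = n + 1 := by
      push_cast
      rw [abs_neg, abs_of_nonneg (by positivity)]
    rw [hf, hA, hw', ← Complex.exp_nat_mul, Complex.ofReal_exp, ← Complex.exp_add,
      ← Complex.exp_add]
    simp only [poissonSymbol, h3, one_mul]
    congr 1
    push_cast
    ring
  have h3 : poissonKer t y = A * (1 - w)⁻¹ + A * w' * (1 - w')⁻¹ :=
    (HasSum.of_nat_of_neg_add_one h1 h2).tsum_eq
  have hw1 : 1 - w ≠ 0 := by
    intro h0
    rw [← sub_eq_zero.1 h0] at hnorm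
    simp at hnorm
  have hw1' : 1 - w' ≠ 0 := by
    intro h0
    rw [← sub_eq_zero.1 h0] at hnorm'
    simp at hnorm'
  have h4 : poissonKer t y = ((A * (1 - ‖w‖ ^ 2) / ‖1 - w‖ ^ 2 : ℝ) : ℂ) := by
    have e1 : ((‖w‖ ^ 2 : ℝ) : ℂ) = w * w' := by
      rw [hconj, Complex.mul_conj, Complex.normSq_eq_norm_sq]
    have e2 : ((‖1 - w‖ ^ 2 : ℝ) : ℂ) = (1 - w) * (1 - w') := by
      rw [hconj, ← map_one (starRingEnd ℂ), ← map_sub, map_one, Complex.mul_conj,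
        Complex.normSq_eq_norm_sq]
    rw [h3, Complex.ofReal_div, Complex.ofReal_mul, Complex.ofReal_sub, e1, e2, Complex.ofReal_one]
    field_simp
    ring
  have h5 : 0 ≤ A * (1 - ‖w‖ ^ 2) / ‖1 - w‖ ^ 2 := by
    have : ‖w‖ ^ 2 ≤ 1 := pow_le_one₀ (norm_nonneg _) hnorm.le
    have : 0 < A := Real.exp_pos _
    refine div_nonneg (mul_nonneg this.le (by linarith)) (by positivity)
  rw [h4, Complex.norm_real, Real.norm_of_nonneg h5]

lemma continuous_poissonKer {t : ℝ} (ht : 0 < t) : Continuous (poissonKer t) := by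
  refine continuous_iff_continuousAt.2 fun y => ?_
  have h := (decayingSymbol_poissonSymbol.hasFDerivAt_modeSum tempered_one
    (p := (t, y)) ht).continuousAt
  exact h.comp (f := fun y : ℝ => (t, y)) (by fun_prop)

/-- Convolution with the kernel: for `t > 0` the kernel series converges absolutely and uniformly in
`y`, so it may be integrated termwise against `f`. -/
lemma modeSum_poissonSymbol_coeff {f : ℝ → ℂ} (hf : IntegrableOn f (Ioo 0 1)) {t : ℝ} (ht : 0 < t)
    (z : ℝ) : modeSum poissonSymbol (coeff f) (t, z) =
      ∫ y in Ioo (0 : ℝ) 1, f y * poissonKer t (z - y) := by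
  have hsum := (decayingSymbol_poissonSymbol.summable_mode tempered_one (p := (t, z)) ht)
  have key := hasSum_integral_of_summable_integral_norm (μ := volume.restrict (Ioo (0 : ℝ) 1))
    (F := fun (k : ℤ) (y : ℝ) => f y *
      (1 * Complex.exp (poissonSymbol k * t + 2 * Real.pi * Complex.I * k * ((z - y : ℝ) : ℂ))))
    (by
      intro k
      refine Integrable.mul_bdd (c := Real.exp ((poissonSymbol k).re * t)) hf
        (Continuous.aestronglyMeasurable (by fun_prop)) (Eventually.of_forall fun y => ?_)
      rw [norm_mode]
      simp) (by
      refine (hsum.mul_left (∫ y in Ioo (0 : ℝ) 1, ‖f y‖)).congr fun k => ?_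
      simp only [norm_mul (f _), norm_mode]
      rw [integral_mul_const])
  simp only [poissonKer, modeSum, ← tsum_mul_left]
  rw [← key.tsum_eq]
  congr 1
  ext k
  rw [coeff, ← integral_mul_const]
  congr 1
  ext y
  rw [one_mul, mul_assoc, ← Complex.exp_add]
  congr 2
  push_cast
  ring

lemma coeff_one (k : ℤ) : coeff (fun _ => 1) k = if k = 0 then 1 else 0 := by
  have h := congrFun (fourierCoeff_fourier (T := (1 : ℝ)) 0) k
  rw [fourierCoeff_eq_coeff] at h
  simp only [fourier_zero] at h
  rw [h, Pi.single_apply]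

/-- The operators with multipliers `exp(t s_k)` are contractions in the uniform norm, for the
comparison symbol. -/
lemma norm_modeSum_poissonSymbol_le {f : ℝ → ℂ} (hf : IntegrableOn f (Ioo 0 1)) {M : ℝ}
    (hM : ∀ y, ‖f y‖ ≤ M) {t : ℝ} (ht : 0 < t) (z : ℝ) :
    ‖modeSum poissonSymbol (coeff f) (t, z)‖ ≤ M := by
  have hM0 : 0 ≤ M := (norm_nonneg _).trans (hM 0)
  have hK : Continuous fun y => poissonKer t (z - y) :=
    (continuous_poissonKer ht).comp (continuous_const.sub continuous_id)
  have hKi : IntegrableOn (fun y => poissonKer t (z - y)) (Ioo 0 1) :=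
    hK.integrableOn_Icc.mono_set Ioo_subset_Icc_self
  -- By positivity the `L¹` norm of the kernel is the operator applied to the constant one, where
  -- only the mode `k = 0` survives and gives `exp(-2πt) ≤ 1`.
  have h1 : ((∫ y in Ioo (0 : ℝ) 1, ‖poissonKer t (z - y)‖ : ℝ) : ℂ) =
      modeSum poissonSymbol (coeff fun _ => 1) (t, z) := by
    rw [modeSum_poissonSymbol_coeff (by simp) ht, ← integral_complex_ofReal]
    simp only [norm_poissonKer ht, one_mul]
  have h2 : modeSum poissonSymbol (coeff fun _ => 1) (t, z) =
      ((Real.exp (-(2 * Real.pi * t)) : ℝ) : ℂ) := by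
    rw [modeSum, tsum_eq_single 0]
    · simp [coeff_one, poissonSymbol]
    · intro k hk
      simp [coeff_one, hk]
  have h3 : ∫ y in Ioo (0 : ℝ) 1, ‖poissonKer t (z - y)‖ ≤ 1 := by
    rw [h2] at h1
    rw [Complex.ofReal_inj.1 h1, Real.exp_le_one_iff]
    have := Real.pi_pos
    simp
    positivity
  rw [modeSum_poissonSymbol_coeff hf ht]
  calc _ ≤ ∫ y in Ioo (0 : ℝ) 1, M * ‖poissonKer t (z - y)‖ := by
        refine norm_integral_le_of_norm_le (hKi.norm.const_mul M) (Eventually.of_forall fun y => ?_)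
        rw [norm_mul]
        exact mul_le_mul_of_nonneg_right (hM y) (norm_nonneg _)
    _ ≤ M := by
        rw [integral_const_mul]
        exact mul_le_of_le_one_right hM0 h3

/-! ### Boundary values of series of modes -/

lemma fourierCoeff_eq_coeff' (f : AddCircle (1 : ℝ) → ℂ) :
    fourierCoeff f = coeff fun z => f z := funext (fourierCoeff_eq_coeff f)

lemma tempered_fourierCoeff (f : AddCircle (1 : ℝ) → ℂ) : Tempered (fourierCoeff f) := by
  rw [fourierCoeff_eq_coeff']
  exact tempered_coeff _

lemma modeSum_add {s : ℤ → ℂ} {c C : ℝ} (hs : DecayingSymbol s c C) {a b : ℤ → ℂ} (ha : Tempered a)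
    (hb : Tempered b) {p : ℝ × ℝ} (hp : 0 < p.1) :
    modeSum s (a + b) p = modeSum s a p + modeSum s b p := by
  unfold modeSum
  rw [← Summable.tsum_add (hs.summable_mode ha hp).of_norm (hs.summable_mode hb hp).of_norm]
  simp only [Pi.add_apply, add_mul]

lemma modeSum_smul (s : ℤ → ℂ) (r : ℂ) (a : ℤ → ℂ) (p : ℝ × ℝ) :
    modeSum s (r • a) p = r * modeSum s a p := by
  unfold modeSum
  rw [← tsum_mul_left]
  simp only [Pi.smul_apply, smul_eq_mul, mul_assoc]

lemma continuousMap_integrable (f : C(AddCircle (1 : ℝ), ℂ)) :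
    Integrable f AddCircle.haarAddCircle :=
  f.continuous.integrable_of_hasCompactSupport (HasCompactSupport.of_compactSpace f)

lemma fourierCoeff_coe_add (f g : C(AddCircle (1 : ℝ), ℂ)) :
    fourierCoeff (f + g : C(AddCircle (1 : ℝ), ℂ)) = fourierCoeff f + fourierCoeff g :=
  fourierCoeff.add (continuousMap_integrable f) (continuousMap_integrable g)

lemma fourierCoeff_coe_smul (r : ℂ) (f : C(AddCircle (1 : ℝ), ℂ)) :
    fourierCoeff (r • f : C(AddCircle (1 : ℝ), ℂ)) = r • fourierCoeff f :=
  funext fun k => fourierCoeff.const_smul f r k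

lemma continuous_coe_addCircle (f : C(AddCircle (1 : ℝ), ℂ)) : Continuous fun z : ℝ => f z :=
  f.continuous.comp (AddCircle.continuous_mk' 1)

lemma norm_modeSum_poissonSymbol_fourierCoeff_le (f : C(AddCircle (1 : ℝ), ℂ)) {p : ℝ × ℝ}
    (hp : 0 < p.1) : ‖modeSum poissonSymbol (fourierCoeff f) p‖ ≤ ‖f‖ := by
  rw [fourierCoeff_eq_coeff']
  exact norm_modeSum_poissonSymbol_le
    ((continuous_coe_addCircle f).integrableOn_Icc.mono_set Ioo_subset_Icc_self)
    (fun y => f.norm_coe_le_norm y) hp p.2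

/-- For trigonometric polynomials the sum is finite and the limit is immediate. They are uniformly
dense, and the contraction bound, uniform in `t`, passes the limit to every continuous `f`. -/
lemma tendsto_modeSum_poissonSymbol (f : C(AddCircle (1 : ℝ), ℂ)) (z : ℝ) :
    Tendsto (modeSum poissonSymbol (fourierCoeff f)) (𝓝[Ioi 0 ×ˢ univ] ((0 : ℝ), z))
      (𝓝 (f z)) := by
  have hpos : ∀ᶠ p : ℝ × ℝ in 𝓝[Ioi 0 ×ˢ univ] ((0 : ℝ), z), 0 < p.1 := by
    filter_upwards [self_mem_nhdsWithin] with p hp using hp.1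
  have hspan : ∀ g ∈ Submodule.span ℂ (range (@fourier 1)),
      Tendsto (modeSum poissonSymbol (fourierCoeff g)) (𝓝[Ioi 0 ×ˢ univ] ((0 : ℝ), z))
        (𝓝 (g z)) := by
    intro g hg
    induction hg using Submodule.span_induction with
    | mem g hg =>
      obtain ⟨n, rfl⟩ := hg
      have h1 : modeSum poissonSymbol (fourierCoeff (fourier n : C(AddCircle (1 : ℝ), ℂ))) =
          fun p => Complex.exp (poissonSymbol n * p.1 + 2 * Real.pi * Complex.I * n * p.2) := by
        ext p
        rw [fourierCoeff_fourier, modeSum, tsum_eq_single n]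
        · simp
        · intro k hk
          simp [Pi.single_eq_of_ne hk]
      rw [h1]
      have h2 : Continuous fun p : ℝ × ℝ =>
          Complex.exp (poissonSymbol n * p.1 + 2 * Real.pi * Complex.I * n * p.2) := by fun_prop
      have h3 := (h2.tendsto ((0 : ℝ), z)).mono_left (nhdsWithin_le_nhds (s := Ioi 0 ×ˢ univ))
      convert h3 using 2
      rw [fourier_coe_apply]
      simp
    | zero =>
      have h0 : modeSum poissonSymbol (fourierCoeff (0 : C(AddCircle (1 : ℝ), ℂ))) = fun _ => 0 := by
        ext p
        simp [modeSum, fourierCoeff]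
      rw [h0]
      exact tendsto_const_nhds
    | add g h _ _ ihg ihh =>
      refine (ihg.add ihh).congr' ?_
      filter_upwards [hpos] with p hp
      rw [fourierCoeff_coe_add, modeSum_add decayingSymbol_poissonSymbol (tempered_fourierCoeff g)
        (tempered_fourierCoeff h) hp]
    | smul r g _ ih =>
      refine (ih.const_mul r).congr fun p => ?_
      rw [fourierCoeff_coe_smul, modeSum_smul]
  rw [Metric.tendsto_nhds]
  intro ε hε
  have hf : f ∈ (Submodule.span ℂ (range (@fourier 1))).topologicalClosure := by
    have : Fact ((0 : ℝ) < 1) := ⟨zero_lt_one⟩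
    rw [span_fourier_closure_eq_top]
    trivial
  rw [← SetLike.mem_coe, Submodule.topologicalClosure_coe, Metric.mem_closure_iff] at hf
  obtain ⟨g, hg, hfg⟩ := hf (ε / 3) (by positivity)
  filter_upwards [hpos, Metric.tendsto_nhds.1 (hspan g hg) (ε / 3) (by positivity)] with p hp hgp
  have h1 : ‖modeSum poissonSymbol (fourierCoeff f) p - modeSum poissonSymbol (fourierCoeff g) p‖ ≤
      ‖f - g‖ := by
    have h2 := norm_modeSum_poissonSymbol_fourierCoeff_le (f - g) hp
    have h3 : fourierCoeff f = fourierCoeff (f - g : C(AddCircle (1 : ℝ), ℂ)) + fourierCoeff g := by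
      rw [← fourierCoeff_coe_add, sub_add_cancel]
    rwa [h3, modeSum_add decayingSymbol_poissonSymbol (tempered_fourierCoeff _)
        (tempered_fourierCoeff g) hp, add_sub_cancel_right]
  rw [dist_eq_norm] at hfg hgp ⊢
  have h4 : ‖f z - g z‖ ≤ ‖f - g‖ := (f - g).norm_coe_le_norm z
  calc ‖modeSum poissonSymbol (fourierCoeff f) p - f z‖
      = ‖(modeSum poissonSymbol (fourierCoeff f) p - modeSum poissonSymbol (fourierCoeff g) p) +
          (modeSum poissonSymbol (fourierCoeff g) p - g z) - (f z - g z)‖ := by congr 1; ring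
    _ ≤ ‖modeSum poissonSymbol (fourierCoeff f) p - modeSum poissonSymbol (fourierCoeff g) p‖ +
          ‖modeSum poissonSymbol (fourierCoeff g) p - g z‖ + ‖f z - g z‖ :=
        (norm_sub_le _ _).trans (add_le_add_left (norm_add_le _ _) _)
    _ < ε := by linarith

lemma norm_cexp_sub_cexp_le {A B : ℂ} {M : ℝ} (hA : A.re ≤ M) (hB : B.re ≤ M) :
    ‖Complex.exp A - Complex.exp B‖ ≤ Real.exp M * ‖A - B‖ := by
  refine Convex.norm_image_sub_le_of_norm_hasDerivWithin_le (s := {w : ℂ | w.re ≤ M})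
    (f' := Complex.exp) (fun w _ => (Complex.hasDerivAt_exp w).hasDerivWithinAt) (fun w hw => ?_)
    (convex_halfSpace_re_le M) hB hA
  rw [Complex.norm_exp]
  exact Real.exp_le_exp.2 hw

/-- The exponents differ by `O(t)` and both have real part at most `-m(1 + |k|)t`, so the difference
is at most a constant times `t exp(-m(1 + |k|)t)`, which is `O(1 / (1 + |k|))` uniformly in `t`.
This gain pairs with square summable coefficients. -/
lemma DecayingSymbol.norm_exp_sub_exp_le {s : ℤ → ℂ} {c C : ℝ} (hs : DecayingSymbol s c C) :
    ∃ D : ℝ, ∀ (k : ℤ) (t : ℝ), 0 < t →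
      ‖Complex.exp (s k * t) - Complex.exp (poissonSymbol k * t)‖ ≤ D * (1 + |(k : ℝ)|)⁻¹ := by
  have hpi := Real.pi_pos
  have hp := decayingSymbol_poissonSymbol
  set m := min c (2 * Real.pi) with hm
  have hm0 : 0 < m := lt_min hs.pos (by positivity)
  refine ⟨(C + 2 * Real.pi) / m, fun k t ht => ?_⟩
  have hk : 0 < 1 + |(k : ℝ)| := by positivity
  have h1 : ∀ w : ℂ, ∀ c' : ℝ, m ≤ c' → w.re ≤ -(c' * (1 + |(k : ℝ)|)) →
      (w * t).re ≤ -(m * (1 + |(k : ℝ)|) * t) := by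
    intro w c' hc' hw
    rw [Complex.re_mul_ofReal]
    nlinarith [mul_le_mul_of_nonneg_right hw ht.le,
      mul_le_mul_of_nonneg_right hc' (mul_pos hk ht).le]
  have h2 := norm_cexp_sub_cexp_le (h1 _ _ (min_le_left _ _) (hs.re_le k))
    (h1 _ _ (min_le_right _ _) (hp.re_le k))
  have h3 : ‖s k * t - poissonSymbol k * t‖ ≤ (C + 2 * Real.pi) * t := by
    rw [← sub_mul, norm_mul, Complex.norm_real, Real.norm_of_nonneg ht.le]
    refine mul_le_mul_of_nonneg_right ?_ ht.le
    calc ‖s k - poissonSymbol k‖ = ‖(s k + 2 * Real.pi * |(k : ℝ)|) -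
          (poissonSymbol k + 2 * Real.pi * |(k : ℝ)|)‖ := by congr 1; ring
      _ ≤ _ := (norm_sub_le _ _).trans (add_le_add (hs.norm_le k) (hp.norm_le k))
  have h4 : Real.exp (-(m * (1 + |(k : ℝ)|) * t)) * t ≤ (m * (1 + |(k : ℝ)|))⁻¹ := by
    rw [Real.exp_neg, inv_mul_eq_div, div_le_iff₀ (Real.exp_pos _), inv_mul_eq_div,
      le_div_iff₀ (by positivity)]
    have := Real.add_one_le_exp (m * (1 + |(k : ℝ)|) * t)
    linarith
  have hC : 0 ≤ C + 2 * Real.pi := by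
    have := (norm_nonneg _).trans (hs.norm_le 0)
    positivity
  calc _ ≤ Real.exp (-(m * (1 + |(k : ℝ)|) * t)) * ((C + 2 * Real.pi) * t) :=
        h2.trans (mul_le_mul_of_nonneg_left h3 (Real.exp_pos _).le)
    _ = (C + 2 * Real.pi) * (Real.exp (-(m * (1 + |(k : ℝ)|) * t)) * t) := by ring
    _ ≤ (C + 2 * Real.pi) * (m * (1 + |(k : ℝ)|))⁻¹ := mul_le_mul_of_nonneg_left h4 hC
    _ = _ := by rw [mul_inv]; ring

lemma summable_inv_sq_one_add_abs : Summable fun k : ℤ => ((1 + |(k : ℝ)|)⁻¹) ^ 2 := by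
  have h : Summable fun n : ℕ => ((1 + |(n : ℝ)|)⁻¹) ^ 2 := by
    have h1 := (summable_nat_add_iff 1).2 (Real.summable_nat_pow_inv.2 (one_lt_two))
    refine h1.congr fun n => ?_
    rw [Nat.abs_cast, inv_pow]
    push_cast
    ring
  refine Summable.of_nat_of_neg ?_ ?_
  · exact_mod_cast h
  · refine h.congr fun n => ?_
    simp

lemma summable_norm_coeff_mul_inv {g : ℝ → ℂ} (hg : MemLp g 2 (volume.restrict (Ioo (0 : ℝ) 1))) :
    Summable fun k : ℤ => ‖coeff g k‖ * (1 + |(k : ℝ)|)⁻¹ := by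
  refine Summable.of_nonneg_of_le (fun k => by positivity) (fun k => ?_)
    ((summable_sq_coeff hg).add summable_inv_sq_one_add_abs)
  nlinarith [sq_nonneg (‖coeff g k‖ - (1 + |(k : ℝ)|)⁻¹), sq_nonneg (‖coeff g k‖),
    sq_nonneg ((1 + |(k : ℝ)|)⁻¹)]

lemma memLp_of_continuousOn {g : ℝ → ℂ} (hg : ContinuousOn g (Icc 0 1)) :
    MemLp g 2 (volume.restrict (Ioo (0 : ℝ) 1)) := by
  obtain ⟨M, hM⟩ := isCompact_Icc.exists_bound_of_continuousOn hg
  refine MemLp.of_bound ((hg.mono Ioo_subset_Icc_self).aestronglyMeasurable measurableSet_Ioo) M ?_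
  exact (ae_restrict_iff' measurableSet_Ioo).2
    (Eventually.of_forall fun z hz => hM z (Ioo_subset_Icc_self hz))

/-- Abel-type summation: the series of modes with Fourier coefficients of a continuous function `f`
attains the boundary values `f`. -/
theorem DecayingSymbol.tendsto_modeSum {s : ℤ → ℂ} {c C : ℝ} (hs : DecayingSymbol s c C)
    (f : C(AddCircle (1 : ℝ), ℂ)) (z : ℝ) :
    Tendsto (modeSum s (fourierCoeff f)) (𝓝[Ioi 0 ×ˢ univ] ((0 : ℝ), z)) (𝓝 (f z)) := by
  have hpos : ∀ᶠ p : ℝ × ℝ in 𝓝[Ioi 0 ×ˢ univ] ((0 : ℝ), z), 0 < p.1 := by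
    filter_upwards [self_mem_nhdsWithin] with p hp using hp.1
  obtain ⟨D, hD⟩ := hs.norm_exp_sub_exp_le
  have hsum : Summable fun k : ℤ => D * (‖fourierCoeff f k‖ * (1 + |(k : ℝ)|)⁻¹) := by
    rw [fourierCoeff_eq_coeff']
    exact (summable_norm_coeff_mul_inv
      (memLp_of_continuousOn (continuous_coe_addCircle f).continuousOn)).mul_left D
  -- Each term of the difference of the two series vanishes at `t = 0`, and dominated convergence
  -- applies because the gain `1 / (1 + |k|)` makes the majorant summable. Neither series alone need
  -- have a summable majorant.
  have h1 : Tendsto (fun p : ℝ × ℝ => ∑' k : ℤ, fourierCoeff f k *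
      ((Complex.exp (s k * p.1) - Complex.exp (poissonSymbol k * p.1)) *
        Complex.exp (2 * Real.pi * Complex.I * k * p.2))) (𝓝[Ioi 0 ×ˢ univ] ((0 : ℝ), z))
      (𝓝 (∑' _ : ℤ, 0)) := by
    refine tendsto_tsum_of_dominated_convergence hsum (fun k => ?_) ?_
    · have h2 : Continuous fun p : ℝ × ℝ => fourierCoeff f k *
          ((Complex.exp (s k * p.1) - Complex.exp (poissonSymbol k * p.1)) *
            Complex.exp (2 * Real.pi * Complex.I * k * p.2)) := by fun_prop
      have h3 := (h2.tendsto ((0 : ℝ), z)).mono_left (nhdsWithin_le_nhds (s := Ioi 0 ×ˢ univ))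
      simpa using h3
    · filter_upwards [hpos] with p hp k
      have h4 : ‖Complex.exp (2 * Real.pi * Complex.I * k * p.2)‖ = 1 := by
        rw [Complex.norm_exp]; simp
      rw [norm_mul, norm_mul, h4, mul_one]
      calc _ ≤ ‖fourierCoeff f k‖ * (D * (1 + |(k : ℝ)|)⁻¹) :=
            mul_le_mul_of_nonneg_left (hD k p.1 hp) (norm_nonneg _)
        _ = _ := by ring
  rw [tsum_zero] at h1
  have h2 := h1.add (tendsto_modeSum_poissonSymbol f z)
  rw [zero_add] at h2
  refine h2.congr' ?_
  filter_upwards [hpos] with p hp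
  have s1 := (hs.summable_mode (tempered_fourierCoeff f) hp).of_norm
  have s2 := (decayingSymbol_poissonSymbol.summable_mode (tempered_fourierCoeff f) hp).of_norm
  rw [← sub_eq_iff_eq_add.1]
  unfold modeSum
  rw [← Summable.tsum_sub s1 s2]
  congr 1
  ext k
  rw [Complex.exp_add, Complex.exp_add]
  ring

/-- The series of modes with Fourier coefficients of `f`, extended to `t = 0` by `f`. -/
def modeExt (s : ℤ → ℂ) (f : C(AddCircle (1 : ℝ), ℂ)) (p : ℝ × ℝ) : ℂ :=
  if 0 < p.1 then modeSum s (fourierCoeff f) p else f p.2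

lemma modeExt_of_pos (s : ℤ → ℂ) (f : C(AddCircle (1 : ℝ), ℂ)) {p : ℝ × ℝ} (hp : 0 < p.1) :
    modeExt s f p = modeSum s (fourierCoeff f) p := if_pos hp

lemma modeExt_zero (s : ℤ → ℂ) (f : C(AddCircle (1 : ℝ), ℂ)) (z : ℝ) :
    modeExt s f (0, z) = f z := if_neg (lt_irrefl _)

lemma modeExt_periodic (s : ℤ → ℂ) (f : C(AddCircle (1 : ℝ), ℂ)) (t z : ℝ) :
    modeExt s f (t, z + 1) = modeExt s f (t, z) := by
  unfold modeExt
  simp only [modeSum_periodic]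
  congr 2
  simp

lemma DecayingSymbol.tendsto_modeExt {s : ℤ → ℂ} {c C : ℝ} (hs : DecayingSymbol s c C)
    (f : C(AddCircle (1 : ℝ), ℂ)) {p : ℝ × ℝ} (hp : 0 ≤ p.1) :
    Tendsto (modeExt s f) (𝓝[Ioi 0 ×ˢ univ] p) (𝓝 (modeExt s f p)) := by
  have he : modeSum s (fourierCoeff f) =ᶠ[𝓝[Ioi 0 ×ˢ univ] p] modeExt s f := by
    filter_upwards [self_mem_nhdsWithin] with q hq using (modeExt_of_pos s f hq.1).symm
  refine Tendsto.congr' he ?_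
  rcases hp.lt_or_eq with hp | hp
  · rw [modeExt_of_pos s f hp]
    exact (hs.hasFDerivAt_modeSum (tempered_fourierCoeff f) hp).continuousAt.continuousWithinAt
  · obtain ⟨t, z⟩ := p
    simp only at hp
    rw [← hp, modeExt_zero]
    exact hs.tendsto_modeSum f z

lemma DecayingSymbol.continuousOn_modeExt {s : ℤ → ℂ} {c C : ℝ} (hs : DecayingSymbol s c C)
    (f : C(AddCircle (1 : ℝ), ℂ)) : ContinuousOn (modeExt s f) (Ici 0 ×ˢ univ) := by
  intro p hp
  have h0 : (Ici 0 ×ˢ univ : Set (ℝ × ℝ)) = (Ioi 0 ×ˢ univ) ∪ ({0} ×ˢ univ) := by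
    rw [← union_prod, union_comm, singleton_union, Ioi_insert]
  rw [h0]
  refine ContinuousWithinAt.union (hs.tendsto_modeExt f hp.1) ?_
  by_cases h : p ∈ ({0} ×ˢ univ : Set (ℝ × ℝ))
  · have h1 : Continuous fun q : ℝ × ℝ => f q.2 := (continuous_coe_addCircle f).comp continuous_snd
    refine h1.continuousWithinAt.congr (fun q hq => ?_) ?_
    · have : q.1 = 0 := hq.1
      simp [modeExt, this]
    · have : p.1 = 0 := h.1
      simp [modeExt, this]
  · exact continuousWithinAt_of_notMem_closure (by
      rwa [(isClosed_singleton.prod isClosed_univ).closure_eq])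

/-- A series of modes is `C¹` up to the boundary if its boundary values and the candidates for the
boundary values of its derivatives are continuous. -/
theorem DecayingSymbol.c1On_modeExt {s : ℤ → ℂ} {c C : ℝ} (hs : DecayingSymbol s c C)
    {f fx fz : C(AddCircle (1 : ℝ), ℂ)} (hx : ∀ k, fourierCoeff fx k = s k * fourierCoeff f k)
    (hz : ∀ k, fourierCoeff fz k = freq k * fourierCoeff f k) :
    C1On (Ici 0 ×ˢ univ) (modeExt s f) (modeExt s fx) (modeExt s fz) := by
  refine ⟨fun p hp => ?_, hs.continuousOn_modeExt fx, hs.continuousOn_modeExt fz⟩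
  have hcl : closure (Ioi 0 ×ˢ univ : Set (ℝ × ℝ)) = Ici 0 ×ˢ univ := by
    rw [closure_prod_eq, closure_Ioi, closure_univ]
  have hd : ∀ q ∈ (Ioi 0 ×ˢ univ : Set (ℝ × ℝ)),
      HasFDerivAt (modeExt s f) (gradMap (modeExt s fx q) (modeExt s fz q)) q := by
    intro q hq
    have h1 := hs.hasFDerivAt_modeSum (tempered_fourierCoeff f) hq.1
    rw [modeExt_of_pos s fx hq.1, modeExt_of_pos s fz hq.1, funext hx, funext hz]
    refine h1.congr_of_eventuallyEq ?_
    filter_upwards [(isOpen_Ioi.prod isOpen_univ).mem_nhds hq] with r hr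
      using modeExt_of_pos s f hr.1
  rw [← hcl]
  -- In the convex open half-plane the function is differentiable, and its derivative has limits at
  -- the boundary by the Abel summation of `fx` and `fz`; hence it is differentiable up to the
  -- boundary.
  refine hasFDerivWithinAt_closure_of_tendsto_fderiv
    (fun q hq => (hd q hq).differentiableAt.differentiableWithinAt)
    ((convex_Ioi 0).prod convex_univ) (isOpen_Ioi.prod isOpen_univ) ?_ ?_
  · intro q hq
    rw [hcl] at hq
    exact hs.tendsto_modeExt f hq.1
  · refine (tendsto_gradMap (hs.tendsto_modeExt fx hp.1) (hs.tendsto_modeExt fz hp.1)).congr' ?_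
    filter_upwards [self_mem_nhdsWithin] with q hq using (hd q hq).fderiv.symm

/-- Exponential decay up to the boundary. -/
lemma DecayingSymbol.exists_norm_modeExt_le {s : ℤ → ℂ} {c C : ℝ} (hs : DecayingSymbol s c C)
    (f : C(AddCircle (1 : ℝ), ℂ)) :
    ∃ M : ℝ, ∀ p ∈ (Ici 0 ×ˢ Icc 0 1 : Set (ℝ × ℝ)),
      ‖modeExt s f p‖ ≤ M * Real.exp (-(c / 2 * p.1)) := by
  obtain ⟨M, hM⟩ := hs.exists_norm_modeSum_le (tempered_fourierCoeff f)
  obtain ⟨N, hN⟩ := ((isCompact_Icc (a := (0 : ℝ)) (b := 1)).prod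
    (isCompact_Icc (a := (0 : ℝ)) (b := 1))).exists_bound_of_continuousOn
    ((hs.continuousOn_modeExt f).mono (prod_mono Icc_subset_Ici_self (subset_univ _)))
  have hN0 : 0 ≤ N := (norm_nonneg _).trans (hN (0, 0) (by simp))
  -- For `0 ≤ t ≤ 1` only the compactness bound `N` is available; the factor `exp(c / 2)`
  -- compensates for the decay required there.
  refine ⟨max M (N * Real.exp (c / 2)), fun p hp => ?_⟩
  rcases le_total 1 p.1 with h | h
  · rw [modeExt_of_pos s f (by linarith)]
    exact (hM p h).trans (mul_le_mul_of_nonneg_right (le_max_left _ _) (Real.exp_pos _).le)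
  · refine (hN p ⟨⟨hp.1, h⟩, hp.2⟩).trans ?_
    refine le_trans ?_ (mul_le_mul_of_nonneg_right (le_max_right _ _) (Real.exp_pos _).le)
    rw [mul_assoc, ← Real.exp_add]
    refine le_mul_of_one_le_right hN0 (Real.one_le_exp ?_)
    nlinarith [hs.pos]

/-! ### The Dirichlet-to-Neumann map in terms of Fourier coefficients -/

lemma coeff_add {f g : ℝ → ℂ} (hf : IntegrableOn f (Ioo 0 1)) (hg : IntegrableOn g (Ioo 0 1))
    (k : ℤ) : coeff (fun z => f z + g z) k = coeff f k + coeff g k := by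
  have hi : ∀ u : ℝ → ℂ, IntegrableOn u (Ioo 0 1) →
      IntegrableOn (fun z => u z * Complex.exp (-(2 * Real.pi * Complex.I * k * z))) (Ioo 0 1) :=
    fun u hu => Integrable.mul_bdd (c := 1) hu (continuous_exp_neg_freq k).aestronglyMeasurable
      (Eventually.of_forall fun z => (norm_exp_neg_freq k z).le)
  unfold coeff
  rw [← integral_add (hi f hf) (hi g hg)]
  simp only [add_mul]

lemma coeff_const_mul (r : ℂ) (f : ℝ → ℂ) (k : ℤ) : coeff (fun z => r * f z) k = r * coeff f k := by
  unfold coeff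
  rw [← integral_const_mul]
  simp only [mul_assoc]

lemma coeff_exp (n k : ℤ) :
    coeff (fun z => Complex.exp (2 * Real.pi * Complex.I * n * z)) k = if k = n then 1 else 0 := by
  have h := congrFun (fourierCoeff_fourier (T := (1 : ℝ)) n) k
  rw [fourierCoeff_eq_coeff] at h
  simp only [fourier_coe_apply] at h
  rw [Pi.single_apply] at h
  rw [← h]
  congr 1
  ext z
  simp

lemma continuous_sum_exp (F : Finset ℤ) (a : ℤ → ℂ) :
    Continuous fun z : ℝ => ∑ n ∈ F, a n * Complex.exp (2 * Real.pi * Complex.I * n * z) := by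
  fun_prop

lemma integrableOn_of_continuousOn {g : ℝ → ℂ} (hg : ContinuousOn g (Icc 0 1)) :
    IntegrableOn g (Ioo 0 1) := hg.integrableOn_Icc.mono_set Ioo_subset_Icc_self

lemma coeff_sum_exp (F : Finset ℤ) (a : ℤ → ℂ) (k : ℤ) :
    coeff (fun z => ∑ n ∈ F, a n * Complex.exp (2 * Real.pi * Complex.I * n * z)) k =
      if k ∈ F then a k else 0 := by
  classical
  induction F using Finset.induction_on with
  | empty => simp [coeff]
  | insert n F hn ih =>
    simp only [Finset.sum_insert hn]
    rw [coeff_add (integrableOn_of_continuousOn (Continuous.continuousOn (by fun_prop)))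
      (integrableOn_of_continuousOn (continuous_sum_exp F a).continuousOn), ih, coeff_const_mul,
      coeff_exp]
    by_cases h : k = n
    · subst h
      simp [hn]
    · simp [h]

lemma norm_coeff_le_eLpNorm {g : ℝ → ℂ} (hg : MemLp g 2 (volume.restrict (Ioo (0 : ℝ) 1))) (k : ℤ) :
    ‖coeff g k‖ ≤ (eLpNorm g 2 (volume.restrict (Ioo (0 : ℝ) 1))).toReal := by
  have hprob : IsProbabilityMeasure (volume.restrict (Ioo (0 : ℝ) 1)) := ⟨by simp⟩
  refine (norm_coeff_le g k).trans ?_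
  rw [integral_norm_eq_lintegral_enorm hg.aestronglyMeasurable, ← eLpNorm_one_eq_lintegral_enorm]
  exact ENNReal.toReal_mono hg.eLpNorm_ne_top
    (eLpNorm_le_eLpNorm_of_exponent_le (by norm_num) hg.aestronglyMeasurable)

lemma dtnPartialSum_eq (κinf : ℝ) (γ : ℂ) (g : ℝ → ℂ) (F : Finset ℤ) :
    dtnPartialSum κinf γ g F = fun z : ℝ => ∑ n ∈ F, dtnSymbol κinf γ n * coeff g n *
      Complex.exp (2 * Real.pi * Complex.I * n * z) := by
  ext z
  simp only [dtnPartialSum, fourierCoeffOn_eq_coeff]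

lemma integrableOn_of_memLp {g : ℝ → ℂ} (hg : MemLp g 2 (volume.restrict (Ioo (0 : ℝ) 1))) :
    IntegrableOn g (Ioo 0 1) := hg.integrable (by norm_num)

lemma coeff_dtnPartialSum_sub (κinf : ℝ) (γ : ℂ) (g : ℝ → ℂ) {h : ℝ → ℂ}
    (hh : MemLp h 2 (volume.restrict (Ioo (0 : ℝ) 1))) (F : Finset ℤ) (k : ℤ) :
    coeff (fun z => dtnPartialSum κinf γ g F z - h z) k =
      (if k ∈ F then dtnSymbol κinf γ k * coeff g k else 0) - coeff h k := by
  have h1 := coeff_sum_exp F (fun n => dtnSymbol κinf γ n * coeff g n) k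
  rw [dtnPartialSum_eq, ← h1, sub_eq_add_neg, ← neg_one_mul (coeff h k),
    ← coeff_const_mul, ← coeff_add]
  · simp only [neg_one_mul, sub_eq_add_neg]
  · exact integrableOn_of_continuousOn (continuous_sum_exp F _).continuousOn
  · exact (integrableOn_of_memLp hh).const_mul (-1)

lemma memLp_dtnPartialSum_sub (κinf : ℝ) (γ : ℂ) (g : ℝ → ℂ) {h : ℝ → ℂ}
    (hh : MemLp h 2 (volume.restrict (Ioo (0 : ℝ) 1))) (F : Finset ℤ) :
    MemLp (fun z => dtnPartialSum κinf γ g F z - h z) 2 (volume.restrict (Ioo (0 : ℝ) 1)) := by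
  rw [dtnPartialSum_eq]
  exact (memLp_of_continuousOn (continuous_sum_exp F _).continuousOn).sub hh

/-- Taking a Fourier coefficient is continuous in `L²(0,1)`, and the `k`-th coefficient of the
partial sums is constant once `F` contains `k`. -/
lemma DtNMapsTo.coeff_eq {κinf : ℝ} {γ : ℂ} {g h : ℝ → ℂ} (H : DtNMapsTo κinf γ g h) (k : ℤ) :
    coeff h k = dtnSymbol κinf γ k * coeff g k := by
  obtain ⟨hh, hT⟩ := H
  have h1 : Tendsto (fun F : Finset ℤ => coeff (fun z => dtnPartialSum κinf γ g F z - h z) k) atTop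
      (𝓝 0) := by
    refine squeeze_zero_norm
      (fun F => norm_coeff_le_eLpNorm (memLp_dtnPartialSum_sub κinf γ g hh F) k) ?_
    rw [← ENNReal.toReal_zero]
    exact (ENNReal.tendsto_toReal ENNReal.zero_ne_top).comp hT
  have h2 : Tendsto (fun F : Finset ℤ => coeff (fun z => dtnPartialSum κinf γ g F z - h z) k) atTop
      (𝓝 (dtnSymbol κinf γ k * coeff g k - coeff h k)) := by
    refine tendsto_const_nhds.congr' ?_
    filter_upwards [eventually_ge_atTop {k}] with F hF
    rw [coeff_dtnPartialSum_sub κinf γ g hh, if_pos (hF (Finset.mem_singleton_self k))]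
  exact (sub_eq_zero.1 (tendsto_nhds_unique h2 h1)).symm

/-- The error of the partial sum over `F` has coefficients `-coeff h k` off `F` and zero on `F`. By
Parseval its norm is a tail of `∑ |coeff h k|²`, so the only regularity required is that `h` be in
`L²`. -/
lemma dtnMapsTo_of_coeff_eq {κinf : ℝ} {γ : ℂ} {g h : ℝ → ℂ}
    (hh : MemLp h 2 (volume.restrict (Ioo (0 : ℝ) 1)))
    (H : ∀ k, coeff h k = dtnSymbol κinf γ k * coeff g k) : DtNMapsTo κinf γ g h := by
  refine ⟨hh, ?_⟩
  have h1 : ∀ F : Finset ℤ,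
      eLpNorm (fun z => dtnPartialSum κinf γ g F z - h z) 2 (volume.restrict (Ioo (0 : ℝ) 1)) =
        ENNReal.ofReal ((∑' k : {k // k ∉ F}, ‖coeff h k‖ ^ 2) ^ (2⁻¹ : ℝ)) := by
    intro F
    have hm := memLp_dtnPartialSum_sub κinf γ g hh F
    have hm' := hm
    rw [restrict_Ioo_eq_restrict_Ioc] at hm'
    have hP := hasSum_sq_fourierCoeffOn (zero_lt_one' ℝ) hm'
    simp only [fourierCoeffOn_eq_coeff, coeff_dtnPartialSum_sub κinf γ g hh, ← H] at hP
    rw [sub_zero, inv_one, one_smul, intervalIntegral.integral_of_le zero_le_one,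
      integral_Ioc_eq_integral_Ioo] at hP
    rw [hm.eLpNorm_eq_integral_rpow_norm (by norm_num) (by norm_num)]
    simp only [ENNReal.toReal_ofNat, Real.rpow_two]
    rw [← hP.tsum_eq]
    congr 2
    have e1 := tsum_subtype ((F : Set ℤ)ᶜ) (fun k => ‖coeff h k‖ ^ 2)
    refine Eq.trans ?_ e1.symm
    congr 1
    ext k
    by_cases hk : k ∈ F <;> simp [hk]
  simp only [h1]
  have h2 := tendsto_tsum_compl_atTop_zero fun k : ℤ => ‖coeff h k‖ ^ 2
  have h3 := ENNReal.tendsto_ofReal (h2.rpow_const (p := (2⁻¹ : ℝ)) (Or.inr (by norm_num)))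
  simpa using h3

lemma coeff_deriv {g g' : ℝ → ℂ} (hg : ContinuousOn g (Icc 0 1)) (hg' : ContinuousOn g' (Icc 0 1))
    (hd : ∀ z ∈ Ioo (0 : ℝ) 1, HasDerivAt g (g' z) z) (h01 : g 0 = g 1) (k : ℤ) :
    coeff g' k = freq k * coeff g k := by
  have hE := continuous_exp_neg_freq k
  have h1 := intervalIntegral.integral_eq_sub_of_hasDerivAt_of_le (zero_le_one' ℝ)
    (f := fun z => g z * Complex.exp (-(2 * Real.pi * Complex.I * k * z)))
    (f' := fun z => g' z * Complex.exp (-(2 * Real.pi * Complex.I * k * z)) -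
      freq k * (g z * Complex.exp (-(2 * Real.pi * Complex.I * k * z))))
    (hg.mul hE.continuousOn) (by
      intro z hz
      have h2 : HasDerivAt (fun z : ℝ => -(2 * Real.pi * Complex.I * k * (z : ℂ))) (-freq k) z := by
        have h : HasDerivAt (fun z : ℝ => 2 * Real.pi * Complex.I * k * (z : ℂ)) (freq k * 1) z :=
          (Complex.ofRealCLM.hasDerivAt (x := z)).const_mul (2 * Real.pi * Complex.I * (k : ℂ))
        rw [mul_one] at h
        exact h.neg
      have h3 := (hd z hz).mul h2.cexp
      have h6 : g' z * Complex.exp (-(2 * Real.pi * Complex.I * k * z)) -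
          freq k * (g z * Complex.exp (-(2 * Real.pi * Complex.I * k * z))) =
          g' z * Complex.exp (-(2 * Real.pi * Complex.I * k * z)) +
          g z * (Complex.exp (-(2 * Real.pi * Complex.I * k * z)) * -freq k) := by ring
      rw [h6]
      exact h3) (by
      rw [intervalIntegrable_iff_integrableOn_Icc_of_le zero_le_one]
      exact ContinuousOn.integrableOn_Icc ((hg'.mul hE.continuousOn).sub
        (continuousOn_const.mul (hg.mul hE.continuousOn))))
  have h4 : Complex.exp (-(2 * Real.pi * Complex.I * k * (1 : ℝ))) = 1 := by
    rw [Complex.exp_neg, show 2 * Real.pi * Complex.I * k * ((1 : ℝ) : ℂ) =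
      k * (2 * Real.pi * Complex.I) by push_cast; ring, Complex.exp_int_mul_two_pi_mul_I, inv_one]
  have h5 : Complex.exp (-(2 * Real.pi * Complex.I * k * (0 : ℝ))) = 1 := by simp
  rw [h4, h5, ← h01, sub_self, intervalIntegral.integral_of_le zero_le_one,
    integral_Ioc_eq_integral_Ioo, integral_sub, integral_const_mul] at h1
  · exact sub_eq_zero.1 h1
  · exact integrableOn_of_continuousOn (hg'.mul hE.continuousOn)
  · exact integrableOn_of_continuousOn (continuousOn_const.mul (hg.mul hE.continuousOn))

lemma exists_periodic_lift {g : ℝ → ℂ} (hg : ContinuousOn g (Icc 0 1)) (h01 : g 0 = g 1) :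
    ∃ f : C(AddCircle (1 : ℝ), ℂ), (∀ z ∈ Icc (0 : ℝ) 1, f z = g z) ∧
      ∀ k, fourierCoeff f k = coeff g k := by
  have hp : Fact ((0 : ℝ) < 1) := ⟨zero_lt_one⟩
  have h1 : ∀ z ∈ Icc (0 : ℝ) 1, AddCircle.liftIco 1 0 g (z : AddCircle (1 : ℝ)) = g z := by
    intro z hz
    rcases hz.2.lt_or_eq with h | h
    · exact AddCircle.liftIco_zero_coe_apply ⟨hz.1, h⟩
    · rw [h, ← h01, AddCircle.coe_period, ← AddCircle.coe_zero]
      exact AddCircle.liftIco_zero_coe_apply ⟨le_rfl, zero_lt_one⟩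
  refine ⟨⟨AddCircle.liftIco 1 0 g, AddCircle.liftIco_continuous (by simpa using h01)
    (by simpa using hg)⟩, h1, fun k => ?_⟩
  rw [fourierCoeff_eq_coeff]
  refine setIntegral_congr_fun measurableSet_Ioo fun z hz => ?_
  simp only [ContinuousMap.coe_mk, h1 z (Ioo_subset_Icc_self hz)]

/-! ### Exponentially decaying extensions to half-strips -/

lemma C1On.const_mul {K : Set (ℝ × ℝ)} {U Ux Uz : ℝ × ℝ → ℂ} (h : C1On K U Ux Uz) (r : ℂ) :
    C1On K (fun p => r * U p) (fun p => r * Ux p) (fun p => r * Uz p) := by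
  refine ⟨fun p hp => ?_, continuousOn_const.mul h.continuousOn_x,
    continuousOn_const.mul h.continuousOn_z⟩
  have h1 := (h.hasFDerivWithinAt p hp).const_mul r
  rw [eq_gradMap (r • gradMap (Ux p) (Uz p))] at h1
  simpa using h1

lemma freq_zero_order (κinf : ℝ) (γ : ℂ) (k : ℤ) :
    freq k * freq k + 2 * γ * freq k + (γ ^ 2 + (κinf : ℂ) ^ 2) = beta κinf γ k := by
  rw [freq, beta]
  ring

/-- Every mode solves the equation: `freq_zero_order` collects the terms without `x`-derivatives
into `β_k`, and `s_k² + β_k = 0`. -/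
lemma modeSum_equation {κinf : ℝ} {γ : ℂ} (hβ : ∀ k, (beta κinf γ k).im ≠ 0) {a : ℤ → ℂ}
    (ha : Tempered a) {p : ℝ × ℝ} (hp : 0 < p.1) :
    modeSum (dtnSymbol κinf γ) (fun k => dtnSymbol κinf γ k * (dtnSymbol κinf γ k * a k)) p +
      modeSum (dtnSymbol κinf γ) (fun k => freq k * (freq k * a k)) p +
      (2 * γ * modeSum (dtnSymbol κinf γ) (fun k => freq k * a k) p +
        (γ ^ 2 + (κinf : ℂ) ^ 2) * modeSum (dtnSymbol κinf γ) a p) = 0 := by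
  obtain ⟨c, C, hs⟩ := decayingSymbol_dtnSymbol κinf hβ
  have hsa := ha.mul hs.norm_symbol_le
  have hfa := ha.mul norm_freq_le
  have h1 := (hs.summable_mode (hsa.mul hs.norm_symbol_le) hp).of_norm
  have h2 := (hs.summable_mode (hfa.mul norm_freq_le) hp).of_norm
  have h3 := (hs.summable_mode hfa hp).of_norm
  have h4 := (hs.summable_mode ha hp).of_norm
  unfold modeSum
  rw [← tsum_mul_left, ← tsum_mul_left, ← Summable.tsum_add h1 h2,
    ← Summable.tsum_add (h3.mul_left _) (h4.mul_left _),
    ← Summable.tsum_add (h1.add h2) ((h3.mul_left _).add (h4.mul_left _))]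
  refine Eq.trans (tsum_congr fun k => ?_) tsum_zero
  have h5 := dtnSymbol_sq κinf (hβ k)
  have h6 := freq_zero_order κinf γ k
  linear_combination (a k * Complex.exp (dtnSymbol κinf γ k * p.1 +
    2 * Real.pi * Complex.I * k * p.2)) * (h5 + h6)

/-- Decaying solution in the half-strip `σ (x - c₀) > 0` with given Cauchy data at `x = c₀`. -/
theorem exists_decaying_extension {κinf : ℝ} {γ : ℂ} (hβ : ∀ k, (beta κinf γ k).im ≠ 0) {σ : ℝ}
    (hσ : σ * σ = 1) (c₀ : ℝ) {g gz h : ℝ → ℂ} (hg : ContinuousOn g (Icc 0 1))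
    (hgz : ContinuousOn gz (Icc 0 1)) (hh : ContinuousOn h (Icc 0 1))
    (hd : ∀ z ∈ Ioo (0 : ℝ) 1, HasDerivAt g (gz z) z) (g01 : g 0 = g 1) (gz01 : gz 0 = gz 1)
    (h01 : h 0 = h 1) (H : ∀ k, coeff h k = dtnSymbol κinf γ k * coeff g k) :
    ∃ W Wx Wz : ℝ × ℝ → ℂ,
      C1On ({x | 0 ≤ σ * (x - c₀)} ×ˢ Icc 0 1) W Wx Wz ∧
      (∀ z ∈ Icc (0 : ℝ) 1, W (c₀, z) = g z ∧ Wx (c₀, z) = σ * h z ∧ Wz (c₀, z) = gz z) ∧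
      (∀ x, W (x, 0) = W (x, 1) ∧ Wz (x, 0) = Wz (x, 1)) ∧
      (∃ M δ : ℝ, 0 < δ ∧ ∀ p ∈ {x | 0 ≤ σ * (x - c₀)} ×ˢ Icc (0 : ℝ) 1,
        ‖W p‖ ≤ M * Real.exp (-(δ * (σ * (p.1 - c₀)))) ∧
        ‖Wx p‖ ≤ M * Real.exp (-(δ * (σ * (p.1 - c₀)))) ∧
        ‖Wz p‖ ≤ M * Real.exp (-(δ * (σ * (p.1 - c₀))))) ∧
      WeakDiv ({x | 0 < σ * (x - c₀)} ×ˢ Ioo 0 1) Wx Wz (lowerOrder (fun _ => κinf) γ W Wz) := by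
  obtain ⟨c, C, hs⟩ := decayingSymbol_dtnSymbol κinf hβ
  set s := dtnSymbol κinf γ with hsdef
  obtain ⟨f, hf, hfc⟩ := exists_periodic_lift hg g01
  obtain ⟨fz, hfz, hfzc⟩ := exists_periodic_lift hgz gz01
  obtain ⟨fx, hfx, hfxc⟩ := exists_periodic_lift hh h01
  -- The Dirichlet-to-Neumann relation and the integration by parts in `coeff_deriv` identify `h`
  -- and `gz` as the boundary values of the two differentiated series, which is what `c1On_modeExt`
  -- asks for.
  have hx : ∀ k, fourierCoeff fx k = s k * fourierCoeff f k := fun k => by rw [hfxc, hfc, H]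
  have hz : ∀ k, fourierCoeff fz k = freq k * fourierCoeff f k := fun k => by
    rw [hfzc, hfc, coeff_deriv hg hgz hd g01]
  have hC := hs.c1On_modeExt hx hz
  set T : ℝ × ℝ → ℝ × ℝ := fun p => (σ * (p.1 - c₀), p.2) with hT
  have hσc : (σ : ℂ) * σ = 1 := by exact_mod_cast hσ
  have hσn : ‖(σ : ℂ)‖ = 1 := by
    have h1 := congrArg norm hσc
    rw [norm_mul, norm_one] at h1
    nlinarith [norm_nonneg (σ : ℂ)]
  refine ⟨modeExt s f ∘ T, fun p => σ * modeExt s fx (T p), fun p => modeExt s fz (T p), ?_, ?_, ?_,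
    ?_, ?_⟩
  · exact (hC.comp_affine σ c₀ hT).mono fun p hp => ⟨hp.1, trivial⟩
  · intro z hz
    simp only [hT, Function.comp, sub_self, mul_zero, modeExt_zero, hf z hz, hfx z hz, hfz z hz,
      and_self]
  · intro x
    have h1 := modeExt_periodic s f (σ * (x - c₀)) 0
    have h2 := modeExt_periodic s fz (σ * (x - c₀)) 0
    rw [zero_add] at h1 h2
    exact ⟨h1.symm, h2.symm⟩
  · obtain ⟨M, hM⟩ := hs.exists_norm_modeExt_le f
    obtain ⟨Mx, hMx⟩ := hs.exists_norm_modeExt_le fx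
    obtain ⟨Mz, hMz⟩ := hs.exists_norm_modeExt_le fz
    refine ⟨max M (max Mx Mz), c / 2, half_pos hs.pos, fun p hp => ?_⟩
    have hpT : T p ∈ (Ici 0 ×ˢ Icc 0 1 : Set (ℝ × ℝ)) := hp
    refine ⟨(hM _ hpT).trans ?_, ?_, (hMz _ hpT).trans ?_⟩
    · exact mul_le_mul_of_nonneg_right (le_max_left _ _) (Real.exp_pos _).le
    · rw [norm_mul, hσn, one_mul]
      refine (hMx _ hpT).trans ?_
      exact mul_le_mul_of_nonneg_right ((le_max_left _ _).trans (le_max_right _ _))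
        (Real.exp_pos _).le
    · exact mul_le_mul_of_nonneg_right ((le_max_right _ _).trans (le_max_right _ _))
        (Real.exp_pos _).le
  · set a := fourierCoeff f with ha
    have hta : Tempered a := tempered_fourierCoeff f
    have htx := hta.mul hs.norm_symbol_le
    have htz := hta.mul norm_freq_le
    have hO : IsOpen ({x | 0 < σ * (x - c₀)} ×ˢ Ioo (0 : ℝ) 1) :=
      (isOpen_lt (by fun_prop) (by fun_prop)).prod isOpen_Ioo
    have hsub : ({x | 0 < σ * (x - c₀)} ×ˢ Ioo (0 : ℝ) 1) ⊆ T ⁻¹' (Ioi 0 ×ˢ univ) :=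
      fun p hp => ⟨hp.1, trivial⟩
    have c1 := ((hs.c1On_modeSum hta).comp_affine σ c₀ hT).mono hsub
    have c2 := (((hs.c1On_modeSum htx).comp_affine σ c₀ hT).mono hsub).const_mul σ
    have c3 := ((hs.c1On_modeSum htz).comp_affine σ c₀ hT).mono hsub
    have key := weakDiv_of_hasWeakDeriv hO (c2.hasWeakDeriv hO subset_rfl).1
      (c3.hasWeakDeriv hO subset_rfl).2 c2.continuousOn c3.continuousOn c2.continuousOn_x
      c3.continuousOn_z (Q := lowerOrder (fun _ => κinf) γ (modeSum s a ∘ T)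
        (modeSum s (fun k => freq k * a k) ∘ T)) (by
        intro p hp
        have h1 := modeSum_equation hβ hta (p := T p) hp.1
        simp only [lowerOrder, Function.comp]
        -- The reflection contributes a factor `σ` to each `x`-derivative, so `σ² = 1` leaves the
        -- second derivative unchanged.
        linear_combination h1 + modeSum s (fun k => s k * (s k * a k)) (T p) * hσc)
    refine key.congr hO.measurableSet (fun p hp => ?_) (fun p hp => ?_) (fun p hp => ?_)
    · simp only [Function.comp, modeExt_of_pos s fx (hsub hp).1, funext hx]
    · simp only [Function.comp, modeExt_of_pos s fz (hsub hp).1, funext hz]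
    · simp only [lowerOrder, Function.comp, modeExt_of_pos s fz (hsub hp).1,
        modeExt_of_pos s f (hsub hp).1, funext hz, ha]

/-! ### Gluing solutions on the strip -/

lemma uniqueDiffOn_closedStrip : UniqueDiffOn ℝ closedStrip :=
  uniqueDiffOn_univ.prod (uniqueDiffOn_Icc zero_lt_one)

lemma uniqueDiffOn_closedRect {xm xp : ℝ} (h : xm < xp) : UniqueDiffOn ℝ (closedRect xm xp) :=
  (uniqueDiffOn_Icc h).prod (uniqueDiffOn_Icc zero_lt_one)

lemma isOpen_strip : IsOpen strip := isOpen_univ.prod isOpen_Ioo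

lemma isOpen_rect (xm xp : ℝ) : IsOpen (rect xm xp) := isOpen_Ioo.prod isOpen_Ioo

lemma strip_subset : strip ⊆ closedStrip := prod_mono subset_rfl Ioo_subset_Icc_self

lemma rect_subset (xm xp : ℝ) : rect xm xp ⊆ closedRect xm xp :=
  prod_mono Ioo_subset_Icc_self Ioo_subset_Icc_self

lemma rect_subset_strip (xm xp : ℝ) : rect xm xp ⊆ strip := prod_mono (subset_univ _) subset_rfl

lemma closedRect_subset_closedStrip (xm xp : ℝ) : closedRect xm xp ⊆ closedStrip :=
  prod_mono (subset_univ _) subset_rfl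

lemma C1On.hasDerivWithinAt_x {s t : Set ℝ} {U Ux Uz : ℝ × ℝ → ℂ} (h : C1On (s ×ˢ t) U Ux Uz)
    {x z : ℝ} (hx : x ∈ s) (hz : z ∈ t) :
    HasDerivWithinAt (fun x => U (x, z)) (Ux (x, z)) s x := by
  have h1 : HasDerivWithinAt (fun x : ℝ => (x, z)) ((1 : ℝ), (0 : ℝ)) s x :=
    (hasDerivWithinAt_id x s).prodMk (hasDerivWithinAt_const x s z)
  have hm : MapsTo (fun x : ℝ => (x, z)) s (s ×ˢ t) := fun y hy => ⟨hy, hz⟩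
  have h2 := (h.hasFDerivWithinAt (x, z) ⟨hx, hz⟩).comp_hasDerivWithinAt x h1 hm
  rwa [gradMap_x] at h2

lemma C1On.hasDerivWithinAt_z {s t : Set ℝ} {U Ux Uz : ℝ × ℝ → ℂ} (h : C1On (s ×ˢ t) U Ux Uz)
    {x z : ℝ} (hx : x ∈ s) (hz : z ∈ t) :
    HasDerivWithinAt (fun z => U (x, z)) (Uz (x, z)) t z := by
  have h1 : HasDerivWithinAt (fun z : ℝ => (x, z)) ((0 : ℝ), (1 : ℝ)) t z :=
    (hasDerivWithinAt_const z t x).prodMk (hasDerivWithinAt_id z t)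
  have hm : MapsTo (fun z : ℝ => (x, z)) t (s ×ˢ t) := fun y hy => ⟨hx, hy⟩
  have h2 := (h.hasFDerivWithinAt (x, z) ⟨hx, hz⟩).comp_hasDerivWithinAt z h1 hm
  rwa [gradMap_z] at h2

lemma continuousOn_slice {s : Set ℝ} {f : ℝ × ℝ → ℂ} (hf : ContinuousOn f (s ×ˢ Icc 0 1)) {x : ℝ}
    (hx : x ∈ s) : ContinuousOn (fun z => f (x, z)) (Icc 0 1) :=
  hf.comp (by fun_prop) fun _ hz => ⟨hx, hz⟩

lemma integrable_exp_neg_abs {δ : ℝ} (hδ : 0 < δ) : Integrable fun x : ℝ => Real.exp (-(δ * |x|)) := by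
  rw [← integrableOn_univ, ← Iic_union_Ioi (a := (0 : ℝ))]
  refine IntegrableOn.union ?_ ?_
  · refine (integrableOn_exp_mul_Iic hδ 0).congr_fun (fun x hx => ?_) measurableSet_Iic
    simp only [abs_of_nonpos (show x ≤ 0 from hx)]
    congr 1
    ring
  · refine (exp_neg_integrableOn_Ioi 0 hδ).congr_fun (fun x hx => ?_) measurableSet_Ioi
    simp only [abs_of_pos (show 0 < x from hx)]
    congr 1
    ring

lemma memLp_exp_neg_abs_sub {δ : ℝ} (hδ : 0 < δ) (c : ℝ) :
    MemLp (fun x : ℝ => Real.exp (-(δ * |x - c|))) 2 volume := by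
  rw [memLp_two_iff_integrable_sq (Continuous.aestronglyMeasurable (by fun_prop))]
  refine ((integrable_exp_neg_abs (δ := 2 * δ) (by positivity)).comp_sub_right c).congr
    (Eventually.of_forall fun x => ?_)
  simp only [← Real.exp_nat_mul]
  congr 1
  push_cast
  ring

lemma volume_restrict_strip :
    volume.restrict strip = (volume : Measure ℝ).prod (volume.restrict (Ioo (0 : ℝ) 1)) := by
  rw [strip, Measure.volume_eq_prod, ← Measure.prod_restrict, Measure.restrict_univ]

lemma memLp_strip_of_le {f : ℝ × ℝ → ℂ} (hf : ContinuousOn f closedStrip) {b : ℝ → ℝ}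
    (hb : MemLp b 2 volume) (h : ∀ p ∈ strip, ‖f p‖ ≤ b p.1) :
    MemLp f 2 (volume.restrict strip) := by
  have h1 : MemLp (fun p : ℝ × ℝ => b p.1) 2 (volume.restrict strip) := by
    rw [volume_restrict_strip]
    exact hb.comp_fst _
  refine h1.mono ((hf.mono strip_subset).aestronglyMeasurable isOpen_strip.measurableSet) ?_
  refine (ae_restrict_iff' isOpen_strip.measurableSet).2 (Eventually.of_forall fun p hp => ?_)
  exact (h p hp).trans (le_abs_self _)

lemma integrableOn_lowerOrder {κ : ℝ × ℝ → ℝ} (hκ : Measurable κ) {M : ℝ} (hM : ∀ p, |κ p| ≤ M)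
    (γ : ℂ) {a b : ℝ} {U Uz : ℝ × ℝ → ℂ} (hU : ContinuousOn U (Icc a b ×ˢ Icc 0 1))
    (hUz : ContinuousOn Uz (Icc a b ×ˢ Icc 0 1)) :
    IntegrableOn (lowerOrder κ γ U Uz) (Ioo a b ×ˢ Ioo 0 1) := by
  refine IntegrableOn.add (integrableOn_rect_of_continuousOn (continuousOn_const.mul hUz)) ?_
  have hm : Measurable fun p => γ ^ 2 + (κ p : ℂ) ^ 2 :=
    measurable_const.add ((Complex.measurable_ofReal.comp hκ).pow_const 2)
  refine Integrable.bdd_mul (c := ‖γ ^ 2‖ + M ^ 2) (integrableOn_rect_of_continuousOn hU)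
    hm.aestronglyMeasurable (Eventually.of_forall fun p => (norm_add_le _ _).trans ?_)
  rw [norm_pow (κ p : ℂ), Complex.norm_real, Real.norm_eq_abs]
  gcongr
  exact hM p

/-- Flux identity in iterated form. -/
lemma WeakDiv.integral_flux {κ : ℝ × ℝ → ℝ} (hκ : Measurable κ) {M : ℝ} (hM : ∀ p, |κ p| ≤ M)
    {γ : ℂ} {U Ux Uz : ℝ × ℝ → ℂ} (hU : C1On closedStrip U Ux Uz) {a b : ℝ} (hab : a < b)
    (h : WeakDiv (Ioo a b ×ˢ Ioo 0 1) Ux Uz (lowerOrder κ γ U Uz)) {φ : ℝ × ℝ → ℂ}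
    (hφ : IsTestFunction strip φ) {w : ℝ → ℂ}
    (hw : w = fun x => ∫ z in Ioo (0 : ℝ) 1, (Ux (x, z) * fderiv ℝ φ (x, z) (1, 0) +
      Uz (x, z) * fderiv ℝ φ (x, z) (0, 1) - lowerOrder κ γ U Uz (x, z) * φ (x, z))) :
    IntervalIntegrable w volume a b ∧ ∫ x in a..b, w x =
      (∫ z in Ioo (0 : ℝ) 1, Ux (b, z) * φ (b, z)) - ∫ z in Ioo (0 : ℝ) 1, Ux (a, z) * φ (a, z) := by
  have hsub : (Icc a b ×ˢ Icc 0 1 : Set (ℝ × ℝ)) ⊆ closedStrip :=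
    closedRect_subset_closedStrip a b
  have hQ := integrableOn_lowerOrder hκ hM γ (hU.continuousOn.mono hsub)
    (hU.continuousOn_z.mono hsub)
  have hi := integrableOn_flux (hU.continuousOn_x.mono hsub) (hU.continuousOn_z.mono hsub) hQ
    hφ.smooth
  have hi' := hi
  rw [IntegrableOn, Measure.volume_eq_prod, ← Measure.prod_restrict] at hi'
  have hf := h.flux_x hab (hU.continuousOn_x.mono hsub) (hU.continuousOn_z.mono hsub) hQ hφ.smooth
    hφ.support
  constructor
  · rw [intervalIntegrable_iff_integrableOn_Ioo_of_le hab.le, hw]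
    exact hi'.integral_prod_left
  · rw [← hf, intervalIntegral.integral_of_le hab.le, integral_Ioc_eq_integral_Ioo, hw]
    exact (setIntegral_prod _ hi).symm

/-- A `C¹` function on the strip that solves the equation away from the lines `x = xm` and `x = xp`
solves it on the whole strip. -/
theorem weakDiv_strip_of_pieces {κ : ℝ × ℝ → ℝ} (hκ : Measurable κ) {M : ℝ} (hM : ∀ p, |κ p| ≤ M)
    {γ : ℂ} {U Ux Uz : ℝ × ℝ → ℂ} (hU : C1On closedStrip U Ux Uz) {xm xp : ℝ} (hx : xm < xp)
    (h1 : WeakDiv (Iio xm ×ˢ Ioo 0 1) Ux Uz (lowerOrder κ γ U Uz))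
    (h2 : WeakDiv (rect xm xp) Ux Uz (lowerOrder κ γ U Uz))
    (h3 : WeakDiv (Ioi xp ×ˢ Ioo 0 1) Ux Uz (lowerOrder κ γ U Uz)) :
    WeakDiv strip Ux Uz (lowerOrder κ γ U Uz) := by
  intro φ hφ
  obtain ⟨R₀, hR₀⟩ := (hφ.compact.isBounded).exists_norm_le
  -- The lines `x = ±R` lie beyond both interfaces and outside the support of `φ`.
  set R := max R₀ (max |xm| |xp|) + 1 with hR
  have hm : -R < xm := by
    have := neg_abs_le xm
    have := (le_max_left |xm| |xp|).trans (le_max_right R₀ _)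
    linarith
  have hp : xp < R := by
    have := le_abs_self xp
    have := (le_max_right |xm| |xp|).trans (le_max_right R₀ _)
    linarith
  have hout : ∀ x z : ℝ, R ≤ |x| → (x, z) ∉ tsupport φ := by
    intro x z hx h
    have h4 : |x| ≤ R₀ := (norm_fst_le (x, z)).trans (hR₀ _ h)
    have := le_max_left R₀ (max |xm| |xp|)
    linarith
  have hzero : ∀ x z : ℝ, R ≤ |x| → φ (x, z) = 0 := fun x z hx =>
    image_eq_zero_of_notMem_tsupport (hout x z hx)
  set w : ℝ → ℂ := fun x => ∫ z in Ioo (0 : ℝ) 1, (Ux (x, z) * fderiv ℝ φ (x, z) (1, 0) +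
      Uz (x, z) * fderiv ℝ φ (x, z) (0, 1) - lowerOrder κ γ U Uz (x, z) * φ (x, z)) with hw
  obtain ⟨i1, e1⟩ := (h1.mono (measurableSet_Iio.prod measurableSet_Ioo)
    (prod_mono Ioo_subset_Iio_self subset_rfl)).integral_flux hκ hM hU hm hφ hw
  obtain ⟨i2, e2⟩ := WeakDiv.integral_flux hκ hM hU hx h2 hφ hw
  obtain ⟨i3, e3⟩ := (h3.mono (measurableSet_Ioi.prod measurableSet_Ioo)
    (prod_mono Ioo_subset_Ioi_self subset_rfl)).integral_flux hκ hM hU hp hφ hw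
  have hRpos : 0 < R := by
    have := (abs_nonneg xm).trans ((le_max_left |xm| |xp|).trans (le_max_right R₀ _))
    linarith
  -- The three flux identities telescope: at `xm` and `xp` the fluxes cancel because the same `Ux`
  -- is used on both sides, and at `±R` they vanish with `φ`.
  have e0 : ∫ x in -R..R, w x = 0 := by
    rw [← intervalIntegral.integral_add_adjacent_intervals i1 (i2.trans i3),
      ← intervalIntegral.integral_add_adjacent_intervals i2 i3, e1, e2, e3]
    have z1 : ∀ z, φ (R, z) = 0 := fun z => hzero R z (le_abs_self R)
    have z2 : ∀ z, φ (-R, z) = 0 := fun z => hzero (-R) z (by rw [abs_neg]; exact le_abs_self R)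
    simp only [z1, z2, mul_zero, integral_zero]
    ring
  have hsub : (Icc (-R) R ×ˢ Icc 0 1 : Set (ℝ × ℝ)) ⊆ closedStrip :=
    closedRect_subset_closedStrip _ _
  have hi := integrableOn_flux (hU.continuousOn_x.mono hsub) (hU.continuousOn_z.mono hsub)
    (integrableOn_lowerOrder hκ hM γ (hU.continuousOn.mono hsub) (hU.continuousOn_z.mono hsub))
    hφ.smooth
  rw [intervalIntegral.integral_of_le (by linarith), integral_Ioc_eq_integral_Ioo, hw] at e0
  have e4 := (setIntegral_prod _ hi).trans e0
  rw [← Measure.volume_eq_prod] at e4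
  rw [setIntegral_eq_of_eq_zero isOpen_strip.measurableSet (rect_subset_strip (-R) R),
    ← neg_eq_zero, ← integral_neg, ← e4]
  · refine integral_congr_ae (Eventually.of_forall fun p => ?_)
    ring
  · rintro ⟨x, z⟩ hp
    by_cases hs : (x, z) ∈ tsupport φ
    · have hxR : |x| < R := not_le.1 fun h => hout x z h hs
      exact absurd ⟨abs_lt.1 hxR, (hφ.support hs).2⟩ hp
    · have hd : fderiv ℝ φ (x, z) = 0 := by
        by_contra h0
        exact hs (support_fderiv_subset ℝ h0)
      simp [image_eq_zero_of_notMem_tsupport hs, hd]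

/-! ### From the bounded domain to the strip -/

/-- The function equal to `a` for `x < xm`, to `b` for `xm ≤ x ≤ xp` and to `c` for `x > xp`. -/
def glue (xm xp : ℝ) (a b c : ℝ × ℝ → ℂ) (p : ℝ × ℝ) : ℂ :=
  if p.1 < xm then a p else if p.1 ≤ xp then b p else c p

section glue

variable {xm xp : ℝ} {a b c : ℝ × ℝ → ℂ} {p : ℝ × ℝ}

lemma glue_left (h : p.1 < xm) : glue xm xp a b c p = a p := if_pos h

lemma glue_mid (h : xm ≤ p.1) (h' : p.1 ≤ xp) : glue xm xp a b c p = b p := by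
  rw [glue, if_neg (not_lt.2 h), if_pos h']

lemma glue_right (hx : xm < xp) (h : xp < p.1) : glue xm xp a b c p = c p := by
  rw [glue, if_neg (not_lt.2 (hx.le.trans h.le)), if_neg (not_le.2 h)]

lemma glue_left' (hx : xm < xp) (hab : ∀ z ∈ Icc (0 : ℝ) 1, a (xm, z) = b (xm, z)) :
    EqOn (glue xm xp a b c) a (Iic xm ×ˢ Icc 0 1) := by
  rintro ⟨x, z⟩ ⟨h, hz⟩
  rcases (show x ≤ xm from h).lt_or_eq with h | rfl
  · exact glue_left h
  · rw [glue_mid (p := (x, z)) le_rfl hx.le, hab z hz]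

lemma glue_right' (hx : xm < xp) (hcb : ∀ z ∈ Icc (0 : ℝ) 1, c (xp, z) = b (xp, z)) :
    EqOn (glue xm xp a b c) c (Ici xp ×ˢ Icc 0 1) := by
  rintro ⟨x, z⟩ ⟨h, hz⟩
  rcases (show xp ≤ x from h).lt_or_eq with h | rfl
  · exact glue_right hx h
  · rw [glue_mid (p := (xp, z)) hx.le le_rfl, hcb z hz]

lemma glue_periodic (hx : xm < xp) (ha : ∀ x, a (x, 0) = a (x, 1))
    (hb : ∀ x ∈ Icc xm xp, b (x, 0) = b (x, 1)) (hc : ∀ x, c (x, 0) = c (x, 1)) (x : ℝ) :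
    glue xm xp a b c (x, 0) = glue xm xp a b c (x, 1) := by
  rcases lt_or_ge x xm with h | h
  · rw [glue_left (p := (x, 0)) h, glue_left (p := (x, 1)) h, ha]
  rcases le_or_gt x xp with h' | h'
  · rw [glue_mid (p := (x, 0)) h h', glue_mid (p := (x, 1)) h h', hb x ⟨h, h'⟩]
  · rw [glue_right (p := (x, 0)) hx h', glue_right (p := (x, 1)) hx h', hc]

/-- The majorant depends on `x` alone: an exponential tail on each side plus a multiple of the
indicator of `[xm, xp]`. It is square integrable on the strip because the cross-section has finite
measure. -/
lemma memLp_glue (hx : xm < xp) (hcont : ContinuousOn (glue xm xp a b c) closedStrip)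
    {M δ M' δ' : ℝ} (hδ : 0 < δ) (hδ' : 0 < δ')
    (ha : ∀ p ∈ Iic xm ×ˢ Icc (0 : ℝ) 1, ‖a p‖ ≤ M * Real.exp (-(δ * |p.1 - xm|)))
    (hc : ∀ p ∈ Ici xp ×ˢ Icc (0 : ℝ) 1, ‖c p‖ ≤ M' * Real.exp (-(δ' * |p.1 - xp|)))
    (hb : ContinuousOn b (closedRect xm xp)) :
    MemLp (glue xm xp a b c) 2 (volume.restrict strip) := by
  obtain ⟨N, hN⟩ := (isCompact_Icc.prod isCompact_Icc).exists_bound_of_continuousOn hb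
  have hN0 : 0 ≤ N := (norm_nonneg _).trans
    (hN (xm, 0) ⟨left_mem_Icc.2 hx.le, left_mem_Icc.2 zero_le_one⟩)
  have hM0 : 0 ≤ M := by
    have := (norm_nonneg _).trans
      (ha (xm, 0) ⟨mem_Iic.2 (le_refl xm), left_mem_Icc.2 zero_le_one⟩)
    simpa using this
  have hM0' : 0 ≤ M' := by
    have := (norm_nonneg _).trans
      (hc (xp, 0) ⟨mem_Ici.2 (le_refl xp), left_mem_Icc.2 zero_le_one⟩)
    simpa using this
  have hi : MemLp ((Icc xm xp).indicator fun _ => N) 2 volume :=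
    memLp_indicator_const 2 measurableSet_Icc N (Or.inr (by simp))
  refine memLp_strip_of_le hcont ((((memLp_exp_neg_abs_sub hδ xm).const_mul M).add
    ((memLp_exp_neg_abs_sub hδ' xp).const_mul M')).add hi) ?_
  intro p hp
  have hz : p.2 ∈ Icc (0 : ℝ) 1 := Ioo_subset_Icc_self hp.2
  have n1 : 0 ≤ M * Real.exp (-(δ * |p.1 - xm|)) := by positivity
  have n2 : 0 ≤ M' * Real.exp (-(δ' * |p.1 - xp|)) := by positivity
  have n3 : 0 ≤ (Icc xm xp).indicator (fun _ => N) p.1 := indicator_nonneg (fun _ _ => hN0) _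
  simp only [Pi.add_apply]
  rcases lt_or_ge p.1 xm with h | h
  · rw [glue_left h]
    have := ha p ⟨h.le, hz⟩
    linarith
  rcases le_or_gt p.1 xp with h' | h'
  · rw [glue_mid h h', indicator_of_mem (show p.1 ∈ Icc xm xp from ⟨h, h'⟩)]
    have := hN p ⟨⟨h, h'⟩, hz⟩
    linarith
  · rw [glue_right hx h']
    have := hc p ⟨h'.le, hz⟩
    linarith

end glue

/-- Periodicity of a `C¹` function on the closed rectangle, and of its first derivatives. -/
lemma periodic_closedRect {xm xp : ℝ} (hx : xm < xp) {U Ux Uz : ℝ × ℝ → ℂ}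
    (hU : C1On (closedRect xm xp) U Ux Uz) (h0 : ∀ x ∈ Ioo xm xp, U (x, 0) = U (x, 1))
    (h1 : ∀ x ∈ Ioo xm xp, Uz (x, 0) = Uz (x, 1)) :
    (∀ x ∈ Icc xm xp, U (x, 0) = U (x, 1)) ∧ (∀ x ∈ Icc xm xp, Ux (x, 0) = Ux (x, 1)) ∧
      ∀ x ∈ Icc xm xp, Uz (x, 0) = Uz (x, 1) := by
  have h00 : (0 : ℝ) ∈ Icc (0 : ℝ) 1 := left_mem_Icc.2 zero_le_one
  have h11 : (1 : ℝ) ∈ Icc (0 : ℝ) 1 := right_mem_Icc.2 zero_le_one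
  have hc : ∀ f : ℝ × ℝ → ℂ, ContinuousOn f (closedRect xm xp) →
      (∀ x ∈ Ioo xm xp, f (x, 0) = f (x, 1)) → ∀ x ∈ Icc xm xp, f (x, 0) = f (x, 1) := by
    intro f hf h
    have hs : ∀ z ∈ Icc (0 : ℝ) 1, ContinuousOn (fun x => f (x, z)) (Icc xm xp) := fun z hz =>
      hf.comp (by fun_prop) fun x hx => ⟨hx, hz⟩
    exact EqOn.of_subset_closure (s := Ioo xm xp) (t := Icc xm xp) h (hs 0 h00) (hs 1 h11)
      Ioo_subset_Icc_self (by rw [closure_Ioo hx.ne])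
  have hU0 := hc U hU.continuousOn h0
  refine ⟨hU0, fun x hxm => ?_, hc Uz hU.continuousOn_z h1⟩
  -- `U(·, 0)` and `U(·, 1)` agree on `[xm, xp]`, so uniqueness of the derivative relative to the
  -- interval gives the periodicity of `Ux`, at the endpoints as well.
  have d0 := hU.hasDerivWithinAt_x hxm h00
  have d1 := (hU.hasDerivWithinAt_x hxm h11).congr hU0 (hU0 x hxm)
  exact (uniqueDiffOn_Icc hx x hxm).eq_deriv _ d0 d1

/-- The decaying extensions take their value and `z`-derivative from `U`. The Dirichlet-to-Neumann
conditions make their `x`-derivatives agree with `Ux` too, so the glued function is `C¹` across both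
interfaces. -/
theorem exists_stripSolution_of_dtNSolution {κ : ℝ × ℝ → ℝ} {κm κp xm xp : ℝ} (hx : xm < xp)
    (hκ : Measurable κ) {M : ℝ} (hM : ∀ p, |κ p| ≤ M)
    (hκm : ∀ x z : ℝ, x < xm → κ (x, z) = κm) (hκp : ∀ x z : ℝ, xp < x → κ (x, z) = κp) {γ : ℂ}
    (hβm : ∀ k, (beta κm γ k).im ≠ 0) (hβp : ∀ k, (beta κp γ k).im ≠ 0) {u : ℝ × ℝ → ℂ}
    (hu : IsDtNSolution κ κm κp xm xp γ u) :
    ∃ v : ℝ × ℝ → ℂ, IsStripSolution κ γ v ∧ u =ᵐ[volume.restrict (rect xm xp)] v := by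
  obtain ⟨-, hweak, U, ⟨hae, hUC⟩, hper0, hper1, hDm, hDp⟩ := hu
  have hxm : xm ∈ Icc xm xp := left_mem_Icc.2 hx.le
  have hxp : xp ∈ Icc xm xp := right_mem_Icc.2 hx.le
  have hC := C1On.of_contDiffOn hUC (uniqueDiffOn_closedRect hx)
  set Ux := partialX (closedRect xm xp) U with hUx
  set Uz := partialZ (closedRect xm xp) U with hUz
  obtain ⟨pU, pUx, pUz⟩ := periodic_closedRect hx hC hper0 hper1
  have hd : ∀ x ∈ Icc xm xp, ∀ z ∈ Ioo (0 : ℝ) 1, HasDerivAt (fun z => U (x, z)) (Uz (x, z)) z :=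
    fun x hx z hz => (hC.hasDerivWithinAt_z hx (Ioo_subset_Icc_self hz)).hasDerivAt
      (Icc_mem_nhds hz.1 hz.2)
  obtain ⟨P, Px, Pz, cP, bP, pP, ⟨Mp, δp, hδp, decP⟩, wP⟩ :=
    exists_decaying_extension hβp (σ := 1) (by norm_num) xp
      (continuousOn_slice hC.continuousOn hxp) (continuousOn_slice hC.continuousOn_z hxp)
      (continuousOn_slice hC.continuousOn_x hxp) (hd xp hxp) (pU xp hxp) (pUz xp hxp) (pUx xp hxp)
      hDp.coeff_eq
  -- On the left the outward derivative is `-Ux`. With `σ = -1` the extension has `x`-derivative `σ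
  -- (-Ux) = Ux` at the interface.
  obtain ⟨N, Nx, Nz, cN, bN, pN, ⟨Mm, δm, hδm, decN⟩, wN⟩ :=
    exists_decaying_extension hβm (σ := -1) (by norm_num) xm
      (continuousOn_slice hC.continuousOn hxm) (continuousOn_slice hC.continuousOn_z hxm)
      (continuousOn_slice hC.continuousOn_x hxm).neg (hd xm hxm) (pU xm hxm) (pUz xm hxm)
      (congrArg Neg.neg (pUx xm hxm)) hDm.coeff_eq
  have sP : {x : ℝ | 0 ≤ 1 * (x - xp)} = Ici xp := by ext x; simp
  have sN : {x : ℝ | 0 ≤ -1 * (x - xm)} = Iic xm := by ext x; simp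
  have sP' : {x : ℝ | 0 < 1 * (x - xp)} = Ioi xp := by ext x; simp
  have sN' : {x : ℝ | 0 < -1 * (x - xm)} = Iio xm := by ext x; simp
  rw [sP] at cP decP
  rw [sN] at cN decN
  rw [sP'] at wP
  rw [sN'] at wN
  set V := glue xm xp N U P with hV
  set Vx := glue xm xp Nx Ux Px with hVx
  set Vz := glue xm xp Nz Uz Pz with hVz
  have eN : EqOn V N (Iic xm ×ˢ Icc 0 1) := glue_left' hx fun z hz => (bN z hz).1
  have eNx : EqOn Vx Nx (Iic xm ×ˢ Icc 0 1) := glue_left' hx fun z hz => by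
    rw [(bN z hz).2.1]; simp
  have eNz : EqOn Vz Nz (Iic xm ×ˢ Icc 0 1) := glue_left' hx fun z hz => (bN z hz).2.2
  have eP : EqOn V P (Ici xp ×ˢ Icc 0 1) := glue_right' hx fun z hz => (bP z hz).1
  have ePx : EqOn Vx Px (Ici xp ×ˢ Icc 0 1) := glue_right' hx fun z hz => by
    rw [(bP z hz).2.1]; simp
  have ePz : EqOn Vz Pz (Ici xp ×ˢ Icc 0 1) := glue_right' hx fun z hz => (bP z hz).2.2
  have eU : ∀ a b c : ℝ × ℝ → ℂ, EqOn (glue xm xp a b c) b (closedRect xm xp) :=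
    fun a b c p hp => glue_mid hp.1.1 hp.1.2
  have hunion : closedStrip = (Iic xm ×ˢ Icc 0 1 ∪ closedRect xm xp) ∪ Ici xp ×ˢ Icc 0 1 := by
    rw [closedRect, ← union_prod, ← union_prod, Iic_union_Icc_eq_Iic hx.le, Iic_union_Ici]
    rfl
  have hVC : C1On closedStrip V Vx Vz := by
    rw [hunion]
    refine ((cN.congr eN eNx eNz).union (hC.congr (eU _ _ _) (eU _ _ _) (eU _ _ _)) ?_ ?_).union
      (cP.congr eP ePx ePz) ?_ ?_
    · exact isClosed_Iic.prod isClosed_Icc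
    · exact isClosed_Icc.prod isClosed_Icc
    · exact (isClosed_Iic.prod isClosed_Icc).union (isClosed_Icc.prod isClosed_Icc)
    · exact isClosed_Ici.prod isClosed_Icc
  have aN : ∀ p ∈ Iic xm ×ˢ Icc (0 : ℝ) 1, -1 * (p.1 - xm) = |p.1 - xm| := fun p hp => by
    rw [abs_of_nonpos (sub_nonpos.2 hp.1)]; ring
  have aP : ∀ p ∈ Ici xp ×ˢ Icc (0 : ℝ) 1, 1 * (p.1 - xp) = |p.1 - xp| := fun p hp => by
    rw [abs_of_nonneg (sub_nonneg.2 hp.1)]; ring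
  have dN : ∀ p ∈ Iic xm ×ˢ Icc (0 : ℝ) 1, ‖N p‖ ≤ Mm * Real.exp (-(δm * |p.1 - xm|)) ∧
      ‖Nx p‖ ≤ Mm * Real.exp (-(δm * |p.1 - xm|)) ∧
      ‖Nz p‖ ≤ Mm * Real.exp (-(δm * |p.1 - xm|)) := fun p hp => by
    rw [← aN p hp]; exact decN p hp
  have dP : ∀ p ∈ Ici xp ×ˢ Icc (0 : ℝ) 1, ‖P p‖ ≤ Mp * Real.exp (-(δp * |p.1 - xp|)) ∧
      ‖Px p‖ ≤ Mp * Real.exp (-(δp * |p.1 - xp|)) ∧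
      ‖Pz p‖ ≤ Mp * Real.exp (-(δp * |p.1 - xp|)) := fun p hp => by
    rw [← aP p hp]; exact decP p hp
  have mV : MemLp V 2 (volume.restrict strip) := memLp_glue hx hVC.continuousOn hδm hδp
    (fun p hp => (dN p hp).1) (fun p hp => (dP p hp).1) hC.continuousOn
  have mVx : MemLp Vx 2 (volume.restrict strip) := memLp_glue hx hVC.continuousOn_x hδm hδp
    (fun p hp => (dN p hp).2.1) (fun p hp => (dP p hp).2.1) hC.continuousOn_x
  have mVz : MemLp Vz 2 (volume.restrict strip) := memLp_glue hx hVC.continuousOn_z hδm hδp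
    (fun p hp => (dN p hp).2.2) (fun p hp => (dP p hp).2.2) hC.continuousOn_z
  have hgrad : IsWeakGradient strip V Vx Vz := by
    obtain ⟨h1, h2⟩ := hVC.hasWeakDeriv isOpen_strip strip_subset
    exact ⟨mVx, mVz, h1, h2⟩
  have hdiv : WeakDiv strip Vx Vz (lowerOrder κ γ V Vz) := by
    have subN : (Iio xm ×ˢ Ioo 0 1 : Set (ℝ × ℝ)) ⊆ Iic xm ×ˢ Icc 0 1 :=
      prod_mono Iio_subset_Iic_self Ioo_subset_Icc_self
    have subP : (Ioi xp ×ˢ Ioo 0 1 : Set (ℝ × ℝ)) ⊆ Ici xp ×ˢ Icc 0 1 :=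
      prod_mono Ioi_subset_Ici_self Ioo_subset_Icc_self
    refine weakDiv_strip_of_pieces hκ hM hVC hx ?_ ?_ ?_
    · refine wN.congr (measurableSet_Iio.prod measurableSet_Ioo) (eNx.mono subN) (eNz.mono subN) ?_
      intro p hp
      simp only [lowerOrder, eN (subN hp), eNz (subN hp), hκm p.1 p.2 hp.1]
    · refine (hweak.weakDiv hae hC (isOpen_rect _ _) (rect_subset _ _)).congr
        (isOpen_rect _ _).measurableSet ((eU _ _ _).mono (rect_subset _ _))
        ((eU _ _ _).mono (rect_subset _ _)) ?_
      intro p hp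
      simp only [lowerOrder, hV, hVz, eU _ _ _ (rect_subset _ _ hp)]
    · refine wP.congr (measurableSet_Ioi.prod measurableSet_Ioo) (ePx.mono subP) (ePz.mono subP) ?_
      intro p hp
      simp only [lowerOrder, eP (subP hp), ePz (subP hp), hκp p.1 p.2 hp.1]
  refine ⟨V, ⟨⟨mV, Vx, Vz, hgrad⟩, ⟨Vx, Vz, hgrad, hdiv⟩, V, ⟨EventuallyEq.rfl,
    hVC.contDiffOn uniqueDiffOn_closedStrip⟩, ?_, ?_⟩, ?_⟩
  · exact glue_periodic hx (fun x => (pN x).1) pU fun x => (pP x).1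
  · intro x
    rw [hVC.partialZ_eq uniqueDiffOn_closedStrip ⟨trivial, left_mem_Icc.2 zero_le_one⟩,
      hVC.partialZ_eq uniqueDiffOn_closedStrip ⟨trivial, right_mem_Icc.2 zero_le_one⟩]
    exact glue_periodic hx (fun x => (pN x).2) pUz (fun x => (pP x).2) x
  · filter_upwards [hae, ae_restrict_mem (isOpen_rect xm xp).measurableSet] with p hp hpr
    rw [hp, hV, eU _ _ _ (rect_subset _ _ hpr)]

/-! ### From the strip to the bounded domain -/

lemma coeff_congr {f g : ℝ → ℂ} (h : EqOn f g (Ioo 0 1)) (k : ℤ) : coeff f k = coeff g k :=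
  setIntegral_congr_fun measurableSet_Ioo fun z hz => by simp only [h hz]

lemma continuousOn_coeff {a b : ℝ} {f : ℝ × ℝ → ℂ} (hf : ContinuousOn f (closedRect a b)) (k : ℤ) :
    ContinuousOn (fun x => coeff (fun z => f (x, z)) k) (Icc a b) :=
  continuousOn_integral_of_continuousOn_prod
    (f := fun p => f p * Complex.exp (-(2 * Real.pi * Complex.I * k * p.2)))
    (hf.mul (Continuous.continuousOn (by fun_prop)))

/-- Fourier coefficients commute with the derivative in `x`. -/
lemma coeff_sub_eq_integral {a b : ℝ} (hab : a < b) {U Ux Uz : ℝ × ℝ → ℂ}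
    (hU : C1On (closedRect a b) U Ux Uz) (k : ℤ) :
    coeff (fun z => U (b, z)) k - coeff (fun z => U (a, z)) k =
      ∫ x in Ioo a b, coeff (fun z => Ux (x, z)) k := by
  have ha : a ∈ Icc a b := left_mem_Icc.2 hab.le
  have hb : b ∈ Icc a b := right_mem_Icc.2 hab.le
  have hE := continuous_exp_neg_freq k
  have hi := integrableOn_rect_of_continuousOn (hU.continuousOn_x.mul (Continuous.continuousOn
    (f := fun p : ℝ × ℝ => Complex.exp (-(2 * Real.pi * Complex.I * k * p.2))) (by fun_prop)))
  rw [IntegrableOn, Measure.volume_eq_prod, ← Measure.prod_restrict] at hi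
  unfold coeff
  rw [integral_integral_swap hi, ← integral_sub]
  · refine setIntegral_congr_fun measurableSet_Ioo fun z hz => ?_
    have hz' := Ioo_subset_Icc_self hz
    have hc : ContinuousOn (fun x => Ux (x, z)) (Icc a b) :=
      hU.continuousOn_x.comp (by fun_prop) fun x hx => ⟨hx, hz'⟩
    have h1 := intervalIntegral.integral_eq_sub_of_hasDerivAt_of_le hab.le
      (f := fun x => U (x, z)) (f' := fun x => Ux (x, z))
      (fun x hx => (hU.hasDerivWithinAt_x hx hz').continuousWithinAt)
      (fun x hx => (hU.hasDerivWithinAt_x (Ioo_subset_Icc_self hx) hz').hasDerivAt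
        (Icc_mem_nhds hx.1 hx.2))
      ((intervalIntegrable_iff_integrableOn_Icc_of_le hab.le).2 hc.integrableOn_Icc)
    rw [intervalIntegral.integral_of_le hab.le, integral_Ioc_eq_integral_Ioo] at h1
    simp only
    rw [integral_mul_const, h1]
    ring
  · exact integrableOn_of_continuousOn
      ((continuousOn_slice hU.continuousOn hb).mul hE.continuousOn)
  · exact integrableOn_of_continuousOn
      ((continuousOn_slice hU.continuousOn ha).mul hE.continuousOn)

lemma fderiv_exp_neg_freq (k : ℤ) (p : ℝ × ℝ) :
    fderiv ℝ (fun q : ℝ × ℝ => Complex.exp (-(2 * Real.pi * Complex.I * k * q.2))) p =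
      gradMap 0 (-freq k * Complex.exp (-(2 * Real.pi * Complex.I * k * p.2))) := by
  have h1 : (fun q : ℝ × ℝ => -(2 * Real.pi * Complex.I * k * (q.2 : ℂ))) =
      gradMap 0 (-freq k) := by
    ext q
    rw [gradMap_apply, freq]
    ring
  have h2 : HasFDerivAt (fun q : ℝ × ℝ => -(2 * Real.pi * Complex.I * k * (q.2 : ℂ)))
      (gradMap 0 (-freq k)) p := by
    rw [h1]
    exact (gradMap 0 (-freq k)).hasFDerivAt
  have h3 := h2.cexp.fderiv
  rw [h3, eq_gradMap (_ • gradMap 0 (-freq k))]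
  simp [mul_comm]

/-- The Fourier coefficients of a periodic solution satisfy an ordinary differential equation where
the coefficient of the equation is constant. -/
lemma coeff_x_sub_eq_integral {a b : ℝ} (hab : a < b) {κinf : ℝ} {γ : ℂ} {U Ux Uz : ℝ × ℝ → ℂ}
    (hU : C1On (closedRect a b) U Ux Uz)
    (hw : WeakDiv (rect a b) Ux Uz (lowerOrder (fun _ => κinf) γ U Uz))
    (h0 : ∀ x ∈ Icc a b, U (x, 0) = U (x, 1)) (h1 : ∀ x ∈ Icc a b, Uz (x, 0) = Uz (x, 1)) (k : ℤ) :
    coeff (fun z => Ux (b, z)) k - coeff (fun z => Ux (a, z)) k =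
      ∫ x in Ioo a b, -beta κinf γ k * coeff (fun z => U (x, z)) k := by
  have cy := continuousOn_coeff hU.continuousOn k
  have cF := continuousOn_coeff hU.continuousOn_x k
  refine sub_eq_integral_of_weak_deriv (F := fun x => coeff (fun z => Ux (x, z)) k) hab cF
    ((continuousOn_const.mul cy).integrableOn_Icc.mono_set Ioo_subset_Icc_self) ?_
  intro η hη _ hηs
  -- The test function `exp(-2πikz) η(x)` does not vanish at `z = 0, 1`, so the equation is used
  -- through `flux_z`; the fluxes through these two sides cancel by periodicity of `E` and `Uz`.
  set E : ℝ × ℝ → ℂ := fun q => Complex.exp (-(2 * Real.pi * Complex.I * k * q.2)) with hE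
  have hEs : ContDiff ℝ ∞ E := by
    have hsnd : ContDiff ℝ ∞ fun q : ℝ × ℝ => (q.2 : ℂ) :=
      Complex.ofRealCLM.contDiff.comp contDiff_snd
    exact (contDiff_const.mul hsnd).neg.cexp
  have hφ : ContDiff ℝ ∞ fun q : ℝ × ℝ => E q * (η q.1 : ℂ) :=
    hEs.mul (Complex.ofRealCLM.contDiff.comp (hη.comp contDiff_fst))
  have hφs : tsupport (fun q : ℝ × ℝ => E q * (η q.1 : ℂ)) ⊆ Ioo a b ×ˢ univ := by
    have hs : tsupport (fun q : ℝ × ℝ => E q * (η q.1 : ℂ)) ⊆ Prod.fst ⁻¹' tsupport η := by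
      refine closure_minimal (fun p hp => ?_) ((isClosed_tsupport η).preimage continuous_fst)
      refine subset_tsupport η fun h0 => hp ?_
      simp [h0]
    exact hs.trans fun p hp => ⟨hηs hp, trivial⟩
  have hQ : ContinuousOn (lowerOrder (fun _ => κinf) γ U Uz) (closedRect a b) :=
    (continuousOn_const.mul hU.continuousOn_z).add (continuousOn_const.mul hU.continuousOn)
  have hflux := WeakDiv.flux_z (zero_lt_one' ℝ) hw hU.continuousOn_x hU.continuousOn_z
    (integrableOn_rect_of_continuousOn hQ) hφ hφs
  have hi := integrableOn_flux hU.continuousOn_x hU.continuousOn_z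
    (integrableOn_rect_of_continuousOn hQ) hφ
  have hE01 : ∀ x : ℝ, E (x, 1) = E (x, 0) := by
    intro x
    simp only [hE]
    rw [Complex.exp_neg, show 2 * Real.pi * Complex.I * k * ((1 : ℝ) : ℂ) =
      k * (2 * Real.pi * Complex.I) by push_cast; ring, Complex.exp_int_mul_two_pi_mul_I]
    simp
  have hrhs : (∫ x in Ioo a b, Uz (x, 1) * (E (x, 1) * (η x : ℂ))) =
      ∫ x in Ioo a b, Uz (x, 0) * (E (x, 0) * (η x : ℂ)) := by
    refine setIntegral_congr_fun measurableSet_Ioo fun x hx => ?_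
    simp only [hE01, h1 x (Ioo_subset_Icc_self hx)]
  rw [hrhs, sub_self] at hflux
  have hfub := setIntegral_prod (μ := volume) (ν := volume) _ hi
  rw [← Measure.volume_eq_prod, hflux] at hfub
  have hinner : ∀ x ∈ Ioo a b, (∫ z in Ioo (0 : ℝ) 1,
      (Ux (x, z) * fderiv ℝ (fun q : ℝ × ℝ => E q * (η q.1 : ℂ)) (x, z) (1, 0) +
        Uz (x, z) * fderiv ℝ (fun q : ℝ × ℝ => E q * (η q.1 : ℂ)) (x, z) (0, 1) -
        lowerOrder (fun _ => κinf) γ U Uz (x, z) * (E (x, z) * (η x : ℂ)))) =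
      coeff (fun z => Ux (x, z)) k * ((deriv η x : ℝ) : ℂ) +
        (-beta κinf γ k) * coeff (fun z => U (x, z)) k * (η x : ℂ) := by
    intro x hx
    have hx' := Ioo_subset_Icc_self hx
    have s0 := continuousOn_slice hU.continuousOn hx'
    have sx := continuousOn_slice hU.continuousOn_x hx'
    have sz := continuousOn_slice hU.continuousOn_z hx'
    have e1 : (∫ z in Ioo (0 : ℝ) 1,
        (Ux (x, z) * fderiv ℝ (fun q : ℝ × ℝ => E q * (η q.1 : ℂ)) (x, z) (1, 0) +
        Uz (x, z) * fderiv ℝ (fun q : ℝ × ℝ => E q * (η q.1 : ℂ)) (x, z) (0, 1) -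
        lowerOrder (fun _ => κinf) γ U Uz (x, z) * (E (x, z) * (η x : ℂ)))) =
        coeff (fun z => ((deriv η x : ℝ) : ℂ) * Ux (x, z) + ((-(freq k + 2 * γ) * η x) * Uz (x, z) +
          (-(γ ^ 2 + (κinf : ℂ) ^ 2) * η x) * U (x, z))) k := by
      refine integral_congr_ae (Eventually.of_forall fun z => ?_)
      simp only [fderiv_mul_ofReal_fst hEs hη, gradMap_x, gradMap_z]
      simp only [hE, fderiv_exp_neg_freq, gradMap_x, gradMap_z, lowerOrder]
      ring
    have e2 : coeff (fun z => Uz (x, z)) k = freq k * coeff (fun z => U (x, z)) k :=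
      coeff_deriv s0 sz (fun z hz => (hU.hasDerivWithinAt_z hx'
        (Ioo_subset_Icc_self hz)).hasDerivAt (Icc_mem_nhds hz.1 hz.2)) (h0 x hx') k
    have i0 : ∀ r : ℂ, IntegrableOn (fun z => r * U (x, z)) (Ioo 0 1) := fun r =>
      integrableOn_of_continuousOn (continuousOn_const.mul s0)
    have ix : ∀ r : ℂ, IntegrableOn (fun z => r * Ux (x, z)) (Ioo 0 1) := fun r =>
      integrableOn_of_continuousOn (continuousOn_const.mul sx)
    have iz : ∀ r : ℂ, IntegrableOn (fun z => r * Uz (x, z)) (Ioo 0 1) := fun r =>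
      integrableOn_of_continuousOn (continuousOn_const.mul sz)
    have izs : ∀ r r' : ℂ, IntegrableOn (fun z => r * Uz (x, z) + r' * U (x, z)) (Ioo 0 1) :=
      fun r r' => (iz r).add (i0 r')
    rw [e1, coeff_add (ix _) (izs _ _), coeff_add (iz _) (i0 _), coeff_const_mul,
      coeff_const_mul, coeff_const_mul, e2]
    -- The derivative of `E` contributes `-freq k`, and replacing the coefficient of `Uz` by `freq
    -- k` times that of `U` assembles the remaining terms into `-β_k`.
    linear_combination (-(η x : ℂ) * coeff (fun z => U (x, z)) k) * freq_zero_order κinf γ k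
  rw [setIntegral_congr_fun measurableSet_Ioo hinner, integral_add] at hfub
  · exact eq_neg_of_add_eq_zero_left hfub.symm
  · exact (cF.mul (Complex.continuous_ofReal.comp
      (hη.continuous_deriv (by simp))).continuousOn).integrableOn_Icc.mono_set Ioo_subset_Icc_self
  · exact ((continuousOn_const.mul cy).mul (Complex.continuous_ofReal.comp
      hη.continuous).continuousOn).integrableOn_Icc.mono_set Ioo_subset_Icc_self

lemma hasDerivAt_of_sub_eq_integral {S : Set ℝ} {f f' : ℝ → ℂ} (hf' : Continuous f')
    (h : ∀ a b, a < b → Icc a b ⊆ S → f b - f a = ∫ x in Ioo a b, f' x) {x : ℝ} (hx : S ∈ 𝓝 x) :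
    HasDerivAt f (f' x) x := by
  obtain ⟨ε, hε, hS⟩ := Metric.nhds_basis_closedBall.mem_iff.1 hx
  rw [Real.closedBall_eq_Icc] at hS
  have h1 : HasDerivAt (fun y => f (x - ε) + ∫ t in (x - ε)..y, f' t) (f' x) x :=
    (intervalIntegral.integral_hasDerivAt_right (hf'.intervalIntegrable _ _)
      (hf'.stronglyMeasurableAtFilter _ _) hf'.continuousAt).const_add _
  refine h1.congr_of_eventuallyEq ?_
  filter_upwards [Ioo_mem_nhds (sub_lt_self x hε) (lt_add_of_pos_right x hε)] with y hy
  rw [intervalIntegral.integral_of_le hy.1.le, integral_Ioc_eq_integral_Ioo,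
    ← h _ _ hy.1 ((Icc_subset_Icc_right hy.2.le).trans hS)]
  ring

lemma eq_of_hasDerivAt_zero {f : ℝ → ℂ} (hf : Continuous f) (h : ∀ t, 0 < t → HasDerivAt f 0 t)
    {t : ℝ} (ht : 0 ≤ t) : f t = f 0 := by
  have := intervalIntegral.integral_eq_sub_of_hasDerivAt_of_le ht hf.continuousOn
    (f' := fun _ => 0) (fun x hx => h x hx.1) (by simp)
  rw [intervalIntegral.integral_zero] at this
  exact (sub_eq_zero.1 this.symm)

/-- A solution of `Y'' = s² Y` on the half-line that does not grow is a multiple of `exp(s t)`. -/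
lemma eq_mul_of_not_growing {s : ℂ} (hs : s.re < 0) {Y G : ℝ → ℂ} (hY : Continuous Y)
    (hG : Continuous G) (hY' : ∀ t, 0 < t → HasDerivAt Y (G t) t)
    (hG' : ∀ t, 0 < t → HasDerivAt G (s ^ 2 * Y t) t) (hlarge : ∀ T, ∃ t, T ≤ t ∧ ‖Y t‖ < 1) :
    G 0 = s * Y 0 := by
  have hexp : ∀ (r : ℂ) (t : ℝ), HasDerivAt (fun t : ℝ => Complex.exp (r * t))
      (Complex.exp (r * t) * r) t := by
    intro r t
    have h : HasDerivAt (fun t : ℝ => r * (t : ℂ)) (r * 1) t :=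
      (Complex.ofRealCLM.hasDerivAt (x := t)).const_mul r
    rw [mul_one] at h
    exact h.cexp
  -- Factoring `Y'' - s² Y` into first-order equations makes `(G - sY) exp(st)` and `(G + sY)
  -- exp(-st)` constant.
  have hd : ∀ t, 0 ≤ t → (G t - s * Y t) * Complex.exp (s * t) = G 0 - s * Y 0 := by
    intro t ht
    have h1 := eq_of_hasDerivAt_zero (f := fun t : ℝ => (G t - s * Y t) * Complex.exp (s * t))
      (by fun_prop) (fun t ht => by
        refine (((hG' t ht).sub ((hY' t ht).const_mul s)).mul (hexp s t)).congr_deriv ?_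
        simp only [Pi.sub_apply]
        ring) ht
    simpa using h1
  have hm : ∀ t, 0 ≤ t → (G t + s * Y t) * Complex.exp (-s * t) = G 0 + s * Y 0 := by
    intro t ht
    have h1 := eq_of_hasDerivAt_zero (f := fun t : ℝ => (G t + s * Y t) * Complex.exp (-s * t))
      (by fun_prop) (fun t ht => by
        refine (((hG' t ht).add ((hY' t ht).const_mul s)).mul (hexp (-s) t)).congr_deriv ?_
        simp only [Pi.add_apply]
        ring) ht
    simpa using h1
  by_contra hne
  set d := G 0 - s * Y 0 with hdd
  set m := G 0 + s * Y 0 with hmm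
  have hd0 : 0 < ‖d‖ := norm_pos_iff.2 (sub_ne_zero.2 hne)
  -- The constant `d` multiplies the growing exponential. If it were nonzero, `Y` would be large for
  -- all large `t`, against `hlarge`.
  have hY2 : ∀ t : ℝ, 0 ≤ t → 2 * s * Y t = m * Complex.exp (s * t) - d * Complex.exp (-s * t) := by
    intro t ht
    have e1 : Complex.exp (s * t) * Complex.exp (-s * t) = 1 := by
      rw [← Complex.exp_add]; simp
    rw [← hd t ht, ← hm t ht]
    linear_combination (-(2 * s * Y t)) * e1
  have htend : Tendsto (fun t : ℝ => ‖d‖ * Real.exp (-s.re * t)) atTop atTop :=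
    (Real.tendsto_exp_atTop.comp (tendsto_id.const_mul_atTop (neg_pos.2 hs))).const_mul_atTop hd0
  obtain ⟨T, hT⟩ := (htend.eventually_ge_atTop (‖m‖ + 2 * ‖s‖ + 1)).exists_forall_of_atTop
  obtain ⟨t, ht, hYt⟩ := hlarge (max T 0)
  have ht0 : 0 ≤ t := (le_max_right _ _).trans ht
  have h3 := hT t ((le_max_left _ _).trans ht)
  have h4 : ‖d * Complex.exp (-s * t)‖ = ‖d‖ * Real.exp (-s.re * t) := by
    rw [norm_mul, Complex.norm_exp]; simp
  have h5 : ‖m * Complex.exp (s * t)‖ ≤ ‖m‖ := by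
    rw [norm_mul, Complex.norm_exp]
    refine mul_le_of_le_one_right (norm_nonneg _) (Real.exp_le_one_iff.2 ?_)
    rw [Complex.re_mul_ofReal]
    exact mul_nonpos_of_nonpos_of_nonneg hs.le ht0
  have h6 : ‖2 * s * Y t‖ ≤ 2 * ‖s‖ := by
    rw [norm_mul, norm_mul, Complex.norm_ofNat]
    exact mul_le_of_le_one_right (by positivity) hYt.le
  have h7 : ‖d * Complex.exp (-s * t)‖ ≤ ‖m * Complex.exp (s * t)‖ + ‖2 * s * Y t‖ := by
    have : d * Complex.exp (-s * t) = m * Complex.exp (s * t) - 2 * s * Y t := by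
      rw [hY2 t ht0]; ring
    rw [this]
    exact norm_sub_le _ _
  linarith

lemma norm_sq_coeff_le {g : ℝ → ℂ} (hg : ContinuousOn g (Icc 0 1)) (k : ℤ) :
    ‖coeff g k‖ ^ 2 ≤ ∫ z in Ioo (0 : ℝ) 1, ‖g z‖ ^ 2 := by
  have h := memLp_of_continuousOn hg
  rw [restrict_Ioo_eq_restrict_Ioc] at h
  have hP := hasSum_sq_fourierCoeffOn (zero_lt_one' ℝ) h
  rw [sub_zero, inv_one, one_smul, intervalIntegral.integral_of_le zero_le_one,
    integral_Ioc_eq_integral_Ioo] at hP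
  simp only [fourierCoeffOn_eq_coeff] at hP
  exact le_hasSum hP k fun _ _ => by positivity

/-- Fourier coefficients of a square integrable function do not stay large on a half-line. -/
lemma exists_norm_coeff_lt_one {U : ℝ × ℝ → ℂ} (hc : ContinuousOn U closedStrip)
    (hU : MemLp U 2 (volume.restrict strip)) {S : Set ℝ} (hS : volume S = ⊤) (k : ℤ) :
    ∃ x ∈ S, ‖coeff (fun z => U (x, z)) k‖ < 1 := by
  by_contra! h
  have h1 : Integrable (fun p => ‖U p‖ ^ 2) (volume.restrict strip) :=
    (memLp_two_iff_integrable_sq_norm hU.aestronglyMeasurable).1 hU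
  rw [volume_restrict_strip] at h1
  -- By Fubini and Chebyshev the set of `x` with `∫ |U(x, z)|² dz ≥ 1` has finite measure, so it
  -- cannot contain `S`; the coefficient is bounded by this integral through Parseval.
  have h2 := h1.integral_prod_left.measure_ge_lt_top one_pos
  refine absurd (measure_mono (fun x hx => ?_)) (not_le.2 (hS ▸ h2))
  have h3 := norm_sq_coeff_le (continuousOn_slice hc (mem_univ x)) k
  exact (one_le_pow₀ (h x hx)).trans h3

/-- On a half-strip where the equation has constant coefficients, the Fourier coefficients of a
square integrable solution satisfy the Dirichlet-to-Neumann relation. -/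
theorem coeff_x_eq_dtnSymbol_mul {κ : ℝ × ℝ → ℝ} {κinf : ℝ} {γ : ℂ}
    (hβ : ∀ k, (beta κinf γ k).im ≠ 0) {U Ux Uz : ℝ × ℝ → ℂ} (hU : C1On closedStrip U Ux Uz)
    (hL : MemLp U 2 (volume.restrict strip)) (hw : WeakDiv strip Ux Uz (lowerOrder κ γ U Uz))
    (h0 : ∀ x, U (x, 0) = U (x, 1)) (h1 : ∀ x, Uz (x, 0) = Uz (x, 1)) {σ : ℝ}
    (hσ : σ = 1 ∨ σ = -1) (c₀ : ℝ) (hκ : ∀ x z : ℝ, 0 < σ * (x - c₀) → κ (x, z) = κinf) (k : ℤ) :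
    σ * coeff (fun z => Ux (c₀, z)) k = dtnSymbol κinf γ k * coeff (fun z => U (c₀, z)) k := by
  have hσ2 : σ * σ = 1 := by rcases hσ with rfl | rfl <;> norm_num
  have hcont : ∀ f : ℝ × ℝ → ℂ, ContinuousOn f closedStrip →
      Continuous fun x => coeff (fun z => f (x, z)) k := by
    intro f hf
    refine continuous_iff_continuousAt.2 fun x => ?_
    refine (continuousOn_coeff (hf.mono (closedRect_subset_closedStrip (x - 1) (x + 1))) k
      ).continuousAt (Icc_mem_nhds (by linarith) (by linarith))
  have cy := hcont U hU.continuousOn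
  have cF := hcont Ux hU.continuousOn_x
  set y : ℝ → ℂ := fun x => coeff (fun z => U (x, z)) k with hy
  set F : ℝ → ℂ := fun x => coeff (fun z => Ux (x, z)) k with hF
  -- The relation `y' = F` needs no equation and holds on the whole line; only the one for `F'` is
  -- confined to the side where `κ` is constant.
  have dy : ∀ x, HasDerivAt y (F x) x := fun x =>
    hasDerivAt_of_sub_eq_integral (S := univ) cF (fun a b hab _ =>
      coeff_sub_eq_integral hab (hU.mono (closedRect_subset_closedStrip a b)) k) univ_mem
  have dF : ∀ x, 0 < σ * (x - c₀) → HasDerivAt F (-beta κinf γ k * y x) x := fun x hx => by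
    refine hasDerivAt_of_sub_eq_integral (S := {x | 0 < σ * (x - c₀)})
      (continuous_const.mul cy) (fun a b hab hS => ?_)
      ((isOpen_lt continuous_const (by fun_prop)).mem_nhds hx)
    refine coeff_x_sub_eq_integral hab (hU.mono (closedRect_subset_closedStrip a b)) ?_
      (fun x _ => h0 x) (fun x _ => h1 x) k
    refine (hw.mono isOpen_strip.measurableSet (rect_subset_strip a b)).congr
      (isOpen_rect a b).measurableSet (fun _ _ => rfl) (fun _ _ => rfl) fun p hp => ?_
    have hp' : κ p = κinf := hκ p.1 p.2 (hS (Ioo_subset_Icc_self hp.1))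
    simp only [lowerOrder, hp']
  have haff : ∀ t : ℝ, HasDerivAt (fun t : ℝ => c₀ + σ * t) σ t := fun t => by
    simpa using ((hasDerivAt_id t).const_mul σ).const_add c₀
  have hpos : ∀ t : ℝ, σ * (c₀ + σ * t - c₀) = t := fun t => by
    rw [add_sub_cancel_left, ← mul_assoc, hσ2, one_mul]
  -- The variable is the outward distance `t = σ (x - c₀)`, so `G = σ F` is the outward derivative
  -- and its value at `t = 0` is the quantity in the claim.
  have key := eq_mul_of_not_growing (dtnSymbol_re_neg κinf (hβ k))
    (Y := fun t => y (c₀ + σ * t)) (G := fun t => σ * F (c₀ + σ * t)) (by fun_prop) (by fun_prop)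
    (fun t _ => by
      have := (dy (c₀ + σ * t)).scomp t (haff t)
      simpa [Function.comp_def] using this)
    (fun t ht => by
      have h2 := ((dF (c₀ + σ * t) (by rwa [hpos])).scomp t (haff t)).const_mul (σ : ℂ)
      have h3 : (σ : ℂ) * (σ • (-beta κinf γ k * y (c₀ + σ * t))) =
          dtnSymbol κinf γ k ^ 2 * y (c₀ + σ * t) := by
        have hσc : (σ : ℂ) * σ = 1 := by exact_mod_cast hσ2
        rw [dtnSymbol_sq κinf (hβ k), Complex.real_smul]
        linear_combination (-beta κinf γ k * y (c₀ + σ * t)) * hσc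
      rw [h3] at h2
      exact h2)
    (fun T => by
      have hvol : volume {x : ℝ | T ≤ σ * (x - c₀)} = ⊤ := by
        rcases hσ with rfl | rfl
        · have : {x : ℝ | T ≤ 1 * (x - c₀)} = Ici (c₀ + T) := by
            ext x; simp only [mem_ofPred_eq, mem_Ici]; constructor <;> intro h <;> linarith
          rw [this, Real.volume_Ici]
        · have : {x : ℝ | T ≤ -1 * (x - c₀)} = Iic (c₀ - T) := by
            ext x; simp only [mem_ofPred_eq, mem_Iic]; constructor <;> intro h <;> linarith
          rw [this, Real.volume_Iic]
      obtain ⟨x, hx, hlt⟩ := exists_norm_coeff_lt_one hU.continuousOn hL hvol k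
      refine ⟨σ * (x - c₀), hx, ?_⟩
      have hxe : c₀ + σ * (σ * (x - c₀)) = x := by
        rw [← mul_assoc, hσ2]; ring
      simp only [hxe]
      exact hlt)
  simpa using key

/-- Restriction preserves everything except the boundary conditions at `xm` and `xp`, which follow
coefficientwise from `coeff_x_eq_dtnSymbol_mul` on the two outer half-strips. -/
theorem dtNSolution_of_stripSolution {κ : ℝ × ℝ → ℝ} {κm κp xm xp : ℝ} (hx : xm < xp)
    (hκm : ∀ x z : ℝ, x < xm → κ (x, z) = κm) (hκp : ∀ x z : ℝ, xp < x → κ (x, z) = κp) {γ : ℂ}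
    (hβm : ∀ k, (beta κm γ k).im ≠ 0) (hβp : ∀ k, (beta κp γ k).im ≠ 0) {u v : ℝ × ℝ → ℂ}
    (hv : IsStripSolution κ γ v) (huv : u =ᵐ[volume.restrict (rect xm xp)] v) :
    IsDtNSolution κ κm κp xm xp γ u := by
  obtain ⟨⟨hvL, vx, vz, hgrad⟩, hweak, V, ⟨hae, hVC⟩, hp0, hp1⟩ := hv
  have hmS := isOpen_strip.measurableSet
  have hsub := rect_subset_strip xm xp
  have hle := Measure.restrict_mono_set (volume : Measure (ℝ × ℝ)) hsub
  have hC := C1On.of_contDiffOn hVC uniqueDiffOn_closedStrip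
  have hCR : C1On (closedRect xm xp) V (partialX closedStrip V) (partialZ closedStrip V) :=
    hC.mono (closedRect_subset_closedStrip xm xp)
  have hud := uniqueDiffOn_closedRect hx
  have hVL : MemLp V 2 (volume.restrict strip) := (memLp_congr_ae hae).1 hvL
  have hdiv := hweak.weakDiv hae hC isOpen_strip strip_subset
  have hxm : xm ∈ Icc xm xp := left_mem_Icc.2 hx.le
  have hxp : xp ∈ Icc xm xp := right_mem_Icc.2 hx.le
  -- The derivative relative to the rectangle is one-sided at `xm` and `xp`; it agrees with the one
  -- relative to the strip because `V` is `C¹` across these lines.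
  have hpx : ∀ x ∈ Icc xm xp, ∀ z ∈ Icc (0 : ℝ) 1,
      partialX (closedRect xm xp) V (x, z) = partialX closedStrip V (x, z) := fun x hx z hz =>
    hCR.partialX_eq hud ⟨hx, hz⟩
  have hcx : ∀ x ∈ Icc xm xp,
      ContinuousOn (fun z => partialX (closedRect xm xp) V (x, z)) (Icc 0 1) := fun x hx =>
    (continuousOn_slice hCR.continuousOn_x hx).congr fun z hz => hpx x hx z hz
  refine ⟨⟨(memLp_congr_ae huv).2 (hvL.mono_measure hle), vx, vz,
    (hgrad.mono hmS hsub).congr huv.symm⟩, ?_, V, ⟨huv.trans (ae_mono hle hae), ?_⟩, ?_, ?_, ?_, ?_⟩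
  · obtain ⟨wx, wz, hg, hw⟩ := hweak
    refine ⟨wx, wz, (hg.mono hmS hsub).congr huv.symm, fun φ hφ => ?_⟩
    have h1 := hw φ (hφ.mono hsub)
    rw [setIntegral_eq_of_eq_zero hmS hsub fun p hp => by
      rw [(hφ.contDiff_fderiv (1, 0)).eq_zero hp, (hφ.contDiff_fderiv (0, 1)).eq_zero hp,
        hφ.eq_zero hp]; simp] at h1
    rw [← h1]
    refine integral_congr_ae ?_
    filter_upwards [huv] with p hp
    rw [hp]
  · exact hVC.mono (closedRect_subset_closedStrip xm xp)
  · exact fun x _ => hp0 x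
  · intro x hx
    have hx' := Ioo_subset_Icc_self hx
    rw [hCR.partialZ_eq hud ⟨hx', left_mem_Icc.2 zero_le_one⟩,
      hCR.partialZ_eq hud ⟨hx', right_mem_Icc.2 zero_le_one⟩, hp1]
  · refine dtnMapsTo_of_coeff_eq (memLp_of_continuousOn (hcx xm hxm).neg) fun k => ?_
    have h1 := coeff_x_eq_dtnSymbol_mul hβm hC hVL hdiv hp0 hp1 (σ := -1) (Or.inr rfl) xm
      (fun x z h => hκm x z (by linarith)) k
    rw [← h1, ← coeff_const_mul]
    refine coeff_congr (fun z hz => ?_) k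
    simp [hpx xm hxm z (Ioo_subset_Icc_self hz)]
  · refine dtnMapsTo_of_coeff_eq (memLp_of_continuousOn (hcx xp hxp)) fun k => ?_
    have h1 := coeff_x_eq_dtnSymbol_mul hβp hC hVL hdiv hp0 hp1 (σ := 1) (Or.inl rfl) xp
      (fun x z h => hκp x z (by linarith)) k
    rw [← h1, ← coeff_const_mul]
    refine coeff_congr (fun z hz => ?_) k
    simp [hpx xp hxp z (Ioo_subset_Icc_self hz)]

end Waveguide

end

theorem mainTheorem2
    (κ : ℝ × ℝ → ℝ) (κm κp xm xp : ℝ) (hx : xm < xp)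
    (hκ_meas : Measurable κ) (hκ_bdd : ∃ M : ℝ, ∀ p, |κ p| ≤ M)
    (hκ_per : ∀ x z : ℝ, κ (x, z + 1) = κ (x, z))
    (hκm : ∀ x z : ℝ, x < xm → κ (x, z) = κm)
    (hκp : ∀ x z : ℝ, xp < x → κ (x, z) = κp)
    (γ : ℂ) (hre : γ.re ≠ 0) (him : ∀ n : ℤ, γ.im ≠ 2 * Real.pi * n)
    (u : ℝ × ℝ → ℂ) :
    Waveguide.IsDtNSolution κ κm κp xm xp γ u ↔
      ∃ v : ℝ × ℝ → ℂ, Waveguide.IsStripSolution κ γ v ∧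
        u =ᵐ[MeasureTheory.volume.restrict (Waveguide.rect xm xp)] v := by
  obtain ⟨M, hM⟩ := hκ_bdd
  have hβm := Waveguide.beta_im_ne_zero κm hre him
  have hβp := Waveguide.beta_im_ne_zero κp hre him
  constructor
  · exact fun h =>
      Waveguide.exists_stripSolution_of_dtNSolution hx hκ_meas hM hκm hκp hβm hβp h
  · rintro ⟨v, hv, huv⟩
    exact Waveguide.dtNSolution_of_stripSolution hx hκm hκp hβm hβp hv huv
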